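/- Notation. Let $\pi(x,\omega)f(t)=e^{2\pi i\omega\cdot t}f(t-x)$ be the time-frequency shifts on $L^2(\mathbb{R}^d)$, $z=(x,\omega)\in\mathbb{R}^{2d}$, and let $\mathcal{HS}$ be the Hilbert--Schmidt operators on $L^2(\mathbb{R}^d)$. For $S,T\in\mathcal{HS}$ put $\mathfrak{V}_ST(z)=S^*\pi(z)^*T$. Let $v$ be a positive, locally integrable, submultiplicative weight on $\mathbb{R}^{2d}$ of at most polynomial growth, let $m$ be a positive, locally integrable weight that is $v$-moderate, i.e. $m(z+w)\le v(z)m(w)$, and let $1\le p,q\le\infty$. Let $L^{p,q}_m(\mathbb{R}^{2d};\mathcal{HS})$ be the space of (classes of) strongly measurable $\Psi$ for which $$\|\Psi\|_{L^{p,q}_m}=\Big(\int_{\mathbb{R}^d}\Big(\int_{\mathbb{R}^d}\|\Psi(x,\omega)\|_{\mathcal{HS}}^p\,m(x,\omega)^p\,dx\Big)^{q/p}d\omega\Big)^{1/q}$$ is finite (essential suprema for infinite exponents), and let $\mathfrak{A}_v=\{S\in\mathcal{HS}:\mathfrak{V}_SS\in L^{1}_v(\mathbb{R}^{2d};\mathcal{HS})\}$.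 The twisted convolution is $$F\natural H(z)=\int_{\mathbb{R}^{2d}}H(z-z')F(z')\,e^{-2\pi i x'\cdot(\omega-\omega')}\,dz',\qquad z=(x,\omega),\ z'=(x',\omega').$$ Let $\mathfrak{S}'$ be the space of continuous linear operators $\mathcal{S}(\mathbb{R}^d)\to\mathcal{S}'(\mathbb{R}^d)$ and $\varphi_0(t)=2^{d/4}e^{-\pi|t|^2}$. For $u\in\mathcal{S}'$ and $h\in L^2$ put $\langle u,h\rangle=\int_{\mathbb{R}^{2d}}\langle u,\pi(w)\varphi_0\rangle\,\overline{\langle h,\pi(w)\varphi_0\rangle}\,dw$ whenever the integral converges absolutely. For $S\in\mathcal{HS}$ and $T\in\mathfrak{S}'$ the operator $\mathfrak{V}_ST(z)=S^*\pi(z)^*T$ is the Hilbert--Schmidt operator, if it exists, with $\langle\mathfrak{V}_ST(z)f,g\rangle=\langle Tf,\pi(z)Sg\rangle$ for all $f\in\mathcal{S}(\mathbb{R}^d)$, $g\in L^2(\mathbb{R}^d)$. Fix $e_0\in L^2(\mathbb{R}^d)$ with $\|e_0\|=1$, let $S_0=\varphi_0\otimes e_0$, and let $$\mathfrak{M}^{p,q}_m=\{T\in\mathfrak{S}':\mathfrak{V}_{S_0}T\in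 L^{p,q}_m(\mathbb{R}^{2d};\mathcal{HS})\},\qquad \|T\|_{\mathfrak{M}^{p,q}_m}=\|\mathfrak{V}_{S_0}T\|_{L^{p,q}_m}.$$ Theorem (correspondence principle). Let $S\in\mathfrak{A}_v$ with $\|S\|_{\mathcal{HS}}=1$. Then $\mathfrak{V}_ST(z)$ is defined for all $T\in\mathfrak{M}^{p,q}_m$ and all $z$, the integral defining $\Psi\natural\mathfrak{V}_SS$ converges absolutely almost everywhere for all $\Psi\in L^{p,q}_m(\mathbb{R}^{2d};\mathcal{HS})$, and the map $T\mapsto\mathfrak{V}_ST$ is a linear bijection from $\mathfrak{M}^{p,q}_m$ onto the closed subspace $$\{\Psi\in L^{p,q}_m(\mathbb{R}^{2d};\mathcal{HS}):\Psi=\Psi\natural\mathfrak{V}_SS\}$$ of $L^{p,q}_m(\mathbb{R}^{2d};\mathcal{HS})$. It is isometric when $\mathfrak{M}^{p,q}_m$ carries the norm $\|\mathfrak{V}_ST\|_{L^{p,q}_m}$ induced by the window $S$; this norm is equivalent to $\|T\|_{\mathfrak{M}^{p,q}_m}$ (and equal to it if $S=S_0$). Moreover $\mathfrak{M}^{p,q}_m$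 is the coorbit space with window $S$: if $T$ belongs to some coorbit space $\mathfrak{M}^{p',q'}_{m'}$ with $1\le p',q'\le\infty$ and $m'$ a $v$-moderate weight (positive and locally integrable), then $T\in\mathfrak{M}^{p,q}_m$ if and only if $\mathfrak{V}_ST\in L^{p,q}_m(\mathbb{R}^{2d};\mathcal{HS})$. -/

import Mathlib

open MeasureTheory Complex
open scoped ENNReal SchwartzMap ComplexConjugate

noncomputable section

section HilbertSchmidt

theorem HSOp.hasSum_parseval {H : Type*} [NormedAddCommGroup H] [InnerProductSpace ℂ H]
    {ι : Type*} (b : HilbertBasis ι ℂ H) (g : H) :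
    HasSum (fun i => ‖inner ℂ (b i) g‖ ^ 2) (‖g‖ ^ 2) := by
  have := lp.hasSum_norm (p := 2) (by norm_num) (b.repr g)
  simpa [b.repr_apply_apply] using! this

variable (H : Type*) [NormedAddCommGroup H] [InnerProductSpace ℂ H] [CompleteSpace H]

/-- The index set of a fixed orthonormal basis of the Hilbert space `H`. -/
def basisIndex : Set H := (exists_hilbertBasis ℂ H).choose

/-- A fixed orthonormal basis of the Hilbert space `H`. -/
def onb : HilbertBasis (basisIndex H) ℂ H := (exists_hilbertBasis ℂ H).choose_spec.choose

/-- The bounded operators `T` with `∑ ‖T eᵢ‖² < ∞`, that is, with `T* T` of trace class. -/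
def hilbertSchmidtSubmodule : Submodule ℂ (H →L[ℂ] H) where
  carrier := {T | Memℓp (fun i => T (onb H i)) 2}
  zero_mem' := by simpa using! (zero_memℓp : Memℓp (0 : basisIndex H → H) 2)
  add_mem' hS hT := by simpa using! hS.add hT
  smul_mem' c T hT := by simpa using! hT.const_smul c

/-- The Hilbert–Schmidt operators on `H`. -/
def HSOp : Type _ := hilbertSchmidtSubmodule H

namespace HSOp

variable {H}

instance : AddCommGroup (HSOp H) := inferInstanceAs (AddCommGroup (hilbertSchmidtSubmodule H))

instance : Module ℂ (HSOp H) := inferInstanceAs (Module ℂ (hilbertSchmidtSubmodule H))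

/-- A bounded operator with `∑ ‖T eᵢ‖² < ∞`, regarded as a Hilbert–Schmidt operator. -/
def mk (T : H →L[ℂ] H) (hT : T ∈ hilbertSchmidtSubmodule H) : HSOp H :=
  (⟨T, hT⟩ : hilbertSchmidtSubmodule H)

/-- The bounded operator underlying a Hilbert–Schmidt operator. -/
def toCLM : HSOp H →ₗ[ℂ] (H →L[ℂ] H) := (hilbertSchmidtSubmodule H).subtype

/-- The family `(T eᵢ)ᵢ` as an element of the Hilbert sum of copies of `H`. -/
def coords : HSOp H →ₗ[ℂ] lp (fun _ : basisIndex H => H) 2 where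
  toFun T := ⟨fun i => toCLM T (onb H i), T.2⟩
  map_add' _ _ := rfl
  map_smul' _ _ := rfl

theorem toCLM_injective : Function.Injective (toCLM : HSOp H → (H →L[ℂ] H)) :=
  Subtype.val_injective

theorem ext_onb {S T : H →L[ℂ] H} (h : ∀ i, S (onb H i) = T (onb H i)) : S = T := by
  refine ContinuousLinearMap.ext_on (s := Set.range (onb H)) ?_ ?_
  · have := (onb H).dense_span
    rw [Submodule.dense_iff_topologicalClosure_eq_top]
    exact this
  · rintro _ ⟨i, rfl⟩
    exact h i

theorem coords_injective : Function.Injective (coords : HSOp H → lp (fun _ : basisIndex H => H) 2) := by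
  intro S T h
  refine toCLM_injective (ext_onb fun i => ?_)
  exact congrFun (congrArg Subtype.val h) i

/-- The Hilbert–Schmidt norm `‖T‖ = (∑ ‖T eᵢ‖²)^{1/2}`. -/
instance : NormedAddCommGroup (HSOp H) :=
  NormedAddCommGroup.induced (HSOp H) (lp (fun _ : basisIndex H => H) 2)
    (coords (H := H)) coords_injective

instance : NormedSpace ℂ (HSOp H) :=
  NormedSpace.induced ℂ (HSOp H) (lp (fun _ : basisIndex H => H) 2) (coords (H := H))

theorem norm_eq_norm_coords (T : HSOp H) : ‖T‖ = ‖coords T‖ := rfl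

theorem hasSum_norm_sq (T : HSOp H) : HasSum (fun i => ‖toCLM T (onb H i)‖ ^ 2) (‖T‖ ^ 2) := by
  have := lp.hasSum_norm (p := 2) (by norm_num) (coords T)
  simpa [norm_eq_norm_coords] using! this

theorem mem_of_summable {T : H →L[ℂ] H} (h : Summable fun i => ‖T (onb H i)‖ ^ 2) :
    T ∈ hilbertSchmidtSubmodule H := by
  refine memℓp_gen ?_
  simpa using! h

theorem norm_toCLM_le (T : HSOp H) : ‖toCLM T‖ ≤ ‖T‖ := by
  rw [← LinearIsometryEquiv.norm_map ContinuousLinearMap.adjoint (toCLM T)]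
  refine ContinuousLinearMap.opNorm_le_bound _ (norm_nonneg _) fun g => ?_
  have h1 := hasSum_parseval (onb H) (ContinuousLinearMap.adjoint (toCLM T) g)
  have h2 := (hasSum_norm_sq T).mul_right (‖g‖ ^ 2)
  have h3 := hasSum_le (fun i => ?_) h1 h2
  · rw [← mul_pow] at h3
    exact le_of_sq_le_sq h3 (by positivity)
  · rw [ContinuousLinearMap.adjoint_inner_right, ← mul_pow]
    gcongr
    exact norm_inner_le_norm _ _

instance : CompleteSpace (HSOp H) := by
  refine Metric.complete_of_cauchySeq_tendsto fun u hu => ?_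
  have hop : CauchySeq fun n => toCLM (u n) := by
    refine (LinearMap.mkContinuous (toCLM (H := H)) 1 fun T => ?_).lipschitz.cauchySeq_comp hu
    simpa using norm_toCLM_le T
  have hco : CauchySeq fun n => coords (u n) := by
    refine (LinearMap.mkContinuous (coords (H := H)) 1 fun T => ?_).lipschitz.cauchySeq_comp hu
    simp [norm_eq_norm_coords]
  obtain ⟨A, hA⟩ := cauchySeq_tendsto_of_complete hop
  obtain ⟨a, ha⟩ := cauchySeq_tendsto_of_complete hco
  have hAa : ∀ i, A (onb H i) = a i := fun i => by
    have h1 : Filter.Tendsto (fun n => toCLM (u n) (onb H i)) Filter.atTop (nhds (A (onb H i))) :=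
      ((ContinuousLinearMap.apply ℂ H (onb H i)).continuous.tendsto A).comp hA
    have h2 : Filter.Tendsto (fun n => toCLM (u n) (onb H i)) Filter.atTop (nhds (a i)) := by
      rw [tendsto_iff_norm_sub_tendsto_zero] at ha ⊢
      refine squeeze_zero (fun _ => norm_nonneg _) (fun n => ?_) ha
      exact lp.norm_apply_le_norm (by norm_num) (coords (u n) - a) i
    exact tendsto_nhds_unique h1 h2
  have hmem : A ∈ hilbertSchmidtSubmodule H := by
    have : (fun i => A (onb H i)) = a := funext hAa
    change Memℓp _ 2
    rw [this]
    exact a.2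
  have hc : coords (mk A hmem) = a := Subtype.ext (funext hAa)
  refine ⟨mk A hmem, ?_⟩
  rw [tendsto_iff_norm_sub_tendsto_zero] at ha ⊢
  refine ha.congr fun n => ?_
  rw [norm_eq_norm_coords, map_sub, ← hc]

theorem tsum_norm_sq_eq_adjoint {κ κ' : Type*} (c : HilbertBasis κ ℂ H) (c' : HilbertBasis κ' ℂ H)
    (A : H →L[ℂ] H) : ∑' j, ENNReal.ofReal (‖A (c j)‖ ^ 2) =
      ∑' i, ENNReal.ofReal (‖ContinuousLinearMap.adjoint A (c' i)‖ ^ 2) := by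
  have e1 : ∀ j, ENNReal.ofReal (‖A (c j)‖ ^ 2) =
      ∑' i, ENNReal.ofReal (‖inner ℂ (c' i) (A (c j))‖ ^ 2) := fun j => by
    rw [← (hasSum_parseval c' (A (c j))).tsum_eq,
      ENNReal.ofReal_tsum_of_nonneg (fun _ => by positivity) (hasSum_parseval c' _).summable]
  have e2 : ∀ i, ENNReal.ofReal (‖ContinuousLinearMap.adjoint A (c' i)‖ ^ 2) =
      ∑' j, ENNReal.ofReal (‖inner ℂ (c' i) (A (c j))‖ ^ 2) := fun i => by
    rw [← (hasSum_parseval c _).tsum_eq,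
      ENNReal.ofReal_tsum_of_nonneg (fun _ => by positivity) (hasSum_parseval c _).summable]
    refine tsum_congr fun j => ?_
    rw [ContinuousLinearMap.adjoint_inner_right, norm_inner_symm]
  simp_rw [e1, e2]
  exact ENNReal.tsum_comm

/-- The norm does not depend on the orthonormal basis. -/
theorem hasSum_norm_sq_of_basis {ι : Type*} (b : HilbertBasis ι ℂ H) (T : HSOp H) :
    HasSum (fun j => ‖toCLM T (b j)‖ ^ 2) (‖T‖ ^ 2) := by
  have h : ∑' j, ENNReal.ofReal (‖toCLM T (b j)‖ ^ 2) = ENNReal.ofReal (‖T‖ ^ 2) := by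
    rw [tsum_norm_sq_eq_adjoint b (onb H), ← tsum_norm_sq_eq_adjoint (onb H) (onb H), ← (hasSum_norm_sq T).tsum_eq,
      ENNReal.ofReal_tsum_of_nonneg (fun _ => by positivity) (hasSum_norm_sq T).summable]
  have hs : Summable fun j => ‖toCLM T (b j)‖ ^ 2 := by
    have := ENNReal.summable_toReal (h ▸ ENNReal.ofReal_ne_top :
      ∑' j, ENNReal.ofReal (‖toCLM T (b j)‖ ^ 2) ≠ ⊤)
    refine this.congr fun j => ?_
    rw [ENNReal.toReal_ofReal (by positivity)]
  rw [← ENNReal.ofReal_tsum_of_nonneg (fun _ => by positivity) hs] at h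
  rw [← (ENNReal.ofReal_eq_ofReal_iff (tsum_nonneg fun _ => by positivity) (by positivity)).1 h]
  exact hs.hasSum

/-- The composition `A T` of a bounded operator `A` and a Hilbert–Schmidt operator `T`. -/
def leftComp (A : H →L[ℂ] H) (T : HSOp H) : HSOp H :=
  mk (A ∘L toCLM T) <| mem_of_summable <| by
    refine Summable.of_nonneg_of_le (fun _ => by positivity) (fun i => ?_)
      ((hasSum_norm_sq T).summable.mul_left (‖A‖ ^ 2))
    rw [← mul_pow]
    gcongr
    exact A.le_opNorm _

theorem leftComp_add (A : H →L[ℂ] H) (S T : HSOp H) :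
    leftComp A (S + T) = leftComp A S + leftComp A T :=
  toCLM_injective (ContinuousLinearMap.ext fun f => map_add A (toCLM S f) (toCLM T f))

theorem leftComp_smul (A : H →L[ℂ] H) (c : ℂ) (T : HSOp H) :
    leftComp A (c • T) = c • leftComp A T :=
  toCLM_injective (ContinuousLinearMap.ext fun f => map_smul A c (toCLM T f))

/-- The rank one operator `φ ⊗ e : g ↦ ⟨g, e⟩ φ`. -/
def rankOne (φ e : H) : HSOp H :=
  mk (InnerProductSpace.rankOne ℂ φ e) <| mem_of_summable <| by
    refine ((hasSum_parseval (onb H) e).mul_right (‖φ‖ ^ 2)).summable.congr fun i => ?_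
    rw [InnerProductSpace.rankOne_apply, norm_smul, mul_pow, norm_inner_symm]

end HSOp

end HilbertSchmidt

/-- `ℝ^d`. -/
abbrev Rd (d : ℕ) : Type := EuclideanSpace ℝ (Fin d)

/-- Phase space `ℝ^{2d} = ℝ^d × ℝ^d`, with points `z = (x, ω)`. -/
abbrev Phase (d : ℕ) : Type := Rd d × Rd d

/-- The Hilbert space `L²(ℝ^d)`. -/
abbrev L2 (d : ℕ) : Type := Lp ℂ 2 (volume : Measure (Rd d))

/-- The character `t ↦ e^{2π i ω·t}`. -/
def character {d : ℕ} (ω t : Rd d) : ℂ := Complex.exp (2 * Real.pi * (inner ℝ ω t : ℝ) * I)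

theorem norm_character {d : ℕ} (ω t : Rd d) : ‖character ω t‖ = 1 := by
  rw [character, show (2 * Real.pi * (inner ℝ ω t : ℝ) * I : ℂ) =
    ((2 * Real.pi * inner ℝ ω t : ℝ) : ℂ) * I by push_cast; ring, norm_exp_ofReal_mul_I]

theorem continuous_character {d : ℕ} (ω : Rd d) : Continuous (character ω) := by
  unfold character
  fun_prop

theorem measurePreserving_sub {d : ℕ} (x : Rd d) :
    MeasurePreserving (fun t : Rd d => t - x) volume volume :=
  measurePreserving_sub_right volume x

theorem memLp_shift {d : ℕ} (z : Phase d) (f : L2 d) :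
    MemLp (fun t => character z.2 t * f (t - z.1)) 2 volume := by
  have h1 : MemLp (fun t => f (t - z.1)) 2 volume :=
    (Lp.memLp f).comp_measurePreserving (measurePreserving_sub z.1)
  refine h1.of_le ((continuous_character z.2).aestronglyMeasurable.mul h1.1) ?_
  filter_upwards with t
  rw [norm_mul, norm_character, one_mul]

/-- The time-frequency shift `π(x, ω) f(t) = e^{2π i ω·t} f(t - x)`, an isometry of `L²(ℝ^d)`. -/
def timeFreqShift {d : ℕ} (z : Phase d) : L2 d →ₗᵢ[ℂ] L2 d where
  toFun f := (memLp_shift z f).toLp _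
  map_add' f g := by
    rw [← MemLp.toLp_add]
    refine MemLp.toLp_congr _ _ ?_
    filter_upwards [(measurePreserving_sub z.1).quasiMeasurePreserving.ae (Lp.coeFn_add f g)]
      with t ht
    simp only [Pi.add_apply] at ht ⊢
    rw [ht, mul_add]
  map_smul' c f := by
    rw [RingHom.id_apply, ← MemLp.toLp_const_smul]
    refine MemLp.toLp_congr _ _ ?_
    filter_upwards [(measurePreserving_sub z.1).quasiMeasurePreserving.ae (Lp.coeFn_smul c f)]
      with t ht
    simp only [Pi.smul_apply, smul_eq_mul] at ht ⊢
    rw [ht]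
    ring
  norm_map' f := by
    change ‖(memLp_shift z f).toLp _‖ = ‖f‖
    rw [Lp.norm_toLp, Lp.norm_def]
    congr 1
    rw [← eLpNorm_comp_measurePreserving (Lp.aestronglyMeasurable f) (measurePreserving_sub z.1)]
    refine eLpNorm_congr_norm_ae ?_
    filter_upwards with t
    rw [norm_mul, norm_character, one_mul, Function.comp_apply]

theorem coeFn_timeFreqShift {d : ℕ} (z : Phase d) (f : L2 d) :
    timeFreqShift z f =ᵐ[volume] fun t => character z.2 t * f (t - z.1) :=
  MemLp.coeFn_toLp (memLp_shift z f)

theorem hasTemperateGrowth_character {d : ℕ} (ω : Rd d) :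
    (character ω).HasTemperateGrowth := by
  have h1 : (fun s : ℝ => Complex.exp (2 * Real.pi * s * I)).HasTemperateGrowth := by
    refine ⟨Complex.contDiff_exp.comp
      ((contDiff_const.mul Complex.ofRealCLM.contDiff).mul contDiff_const), fun n => ⟨0, (2 * Real.pi) ^ n, fun s => ?_⟩⟩
    have key : ∀ n : ℕ, iteratedDeriv n (fun s : ℝ => Complex.exp (2 * Real.pi * s * I)) =
        fun s : ℝ => (2 * Real.pi * I) ^ n * Complex.exp (2 * Real.pi * s * I) := by
      intro n
      induction n with
      | zero => simp
      | succ n ih =>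
        rw [iteratedDeriv_succ, ih]
        funext s
        have hd : HasDerivAt (fun s : ℝ => Complex.exp (2 * Real.pi * s * I))
            (Complex.exp (2 * Real.pi * s * I) * (2 * Real.pi * I)) s := by
          have h0 : HasDerivAt (fun s : ℝ => (2 * Real.pi * s * I : ℂ)) (2 * Real.pi * I) s := by
            have := ((hasDerivAt_id s).ofReal_comp.const_mul (2 * Real.pi : ℂ)).mul_const I
            simpa using this
          exact h0.cexp
        rw [(hd.const_mul _).deriv]
        ring
    rw [norm_iteratedFDeriv_eq_norm_iteratedDeriv, key, norm_mul,
      show (2 * Real.pi * s * I : ℂ) = ((2 * Real.pi * s : ℝ) : ℂ) * I by push_cast; ring,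
      norm_exp_ofReal_mul_I]
    simp [abs_of_pos Real.pi_pos]
  exact h1.comp (Function.hasTemperateGrowth_inner_right ω)

theorem gaussian_decay (d k n : ℕ) : ∃ C : ℝ, ∀ t : Rd d,
    ‖t‖ ^ k * ‖iteratedFDeriv ℝ n (fun t : Rd d => Real.exp (-Real.pi * ‖t‖ ^ 2)) t‖ ≤ C := by
  have hf : (fun t : Rd d => -Real.pi * ‖t‖ ^ 2).HasTemperateGrowth := by fun_prop
  obtain ⟨K, C, hC0, hC⟩ := hf.norm_iteratedFDeriv_le_uniform n
  set B : ℝ := max C 1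
  have hbound : ∀ t : Rd d,
      ‖iteratedFDeriv ℝ n (fun t : Rd d => Real.exp (-Real.pi * ‖t‖ ^ 2)) t‖ ≤
        n.factorial * Real.exp (-Real.pi * ‖t‖ ^ 2) * (B * (1 + ‖t‖) ^ K) ^ n := by
    intro t
    refine norm_iteratedFDeriv_comp_le (N := ((⊤ : ℕ∞) : WithTop ℕ∞)) (g := Real.exp)
      (f := fun t : Rd d => -Real.pi * ‖t‖ ^ 2) Real.contDiff_exp hf.1
      (by exact_mod_cast le_top) t (fun i _ => ?_) (fun i hi1 hi => ?_)
    · rw [norm_iteratedFDeriv_eq_norm_iteratedDeriv, iteratedDeriv_eq_iterate, Real.iter_deriv_exp,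
        Real.norm_of_nonneg (Real.exp_pos _).le]
    · have hB : 1 ≤ B * (1 + ‖t‖) ^ K :=
        one_le_mul_of_one_le_of_one_le (le_max_right _ _)
          (one_le_pow₀ (by linarith [norm_nonneg t]))
      calc _ ≤ C * (1 + ‖t‖) ^ K := hC i hi t
        _ ≤ B * (1 + ‖t‖) ^ K := by gcongr; exact le_max_left _ _
        _ ≤ (B * (1 + ‖t‖) ^ K) ^ i := le_self_pow₀ hB (by omega)
  refine ⟨n.factorial * B ^ n * ((k + K * n).factorial * Real.exp 2), fun t => ?_⟩
  set r := ‖t‖ with hr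
  have hr0 : 0 ≤ r := norm_nonneg t
  have h1 : (1 + r) ^ (k + K * n) ≤ (k + K * n).factorial * Real.exp (1 + r) := by
    have := Real.pow_div_factorial_le_exp (1 + r) (by linarith) (k + K * n)
    rwa [div_le_iff₀' (by positivity)] at this
  have h2 : Real.exp (-Real.pi * r ^ 2) ≤ Real.exp (1 - r) := by
    refine Real.exp_le_exp.2 ?_
    nlinarith [Real.pi_gt_three, sq_nonneg (r - 1), sq_nonneg r]
  calc r ^ k * _ ≤ (1 + r) ^ k * (n.factorial * Real.exp (-Real.pi * r ^ 2) * (B * (1 + r) ^ K) ^ n) := by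
        gcongr
        · linarith
        · exact hbound t
    _ = n.factorial * B ^ n * ((1 + r) ^ (k + K * n) * Real.exp (-Real.pi * r ^ 2)) := by
        rw [mul_pow, ← pow_mul, pow_add]; ring
    _ ≤ n.factorial * B ^ n * ((k + K * n).factorial * Real.exp (1 + r) * Real.exp (1 - r)) := by
        gcongr
    _ = _ := by
        rw [mul_assoc ((k + K * n).factorial : ℝ), ← Real.exp_add]
        norm_num

/-- The normalised Gaussian `φ₀(t) = 2^{d/4} e^{-π |t|²}` as a Schwartz function. -/
def gaussian (d : ℕ) : 𝓢(Rd d, ℂ) :=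
  (((2 : ℝ) ^ ((d : ℝ) / 4) : ℝ) : ℂ) • SchwartzMap.postcompCLM (𝕜 := ℝ) Complex.ofRealCLM
    { toFun := fun t : Rd d => Real.exp (-Real.pi * ‖t‖ ^ 2)
      smooth' := (Real.contDiff_exp.comp (contDiff_const.mul (contDiff_norm_sq ℝ)))
      decay' := fun k n => gaussian_decay d k n }

theorem gaussian_apply (d : ℕ) (t : Rd d) :
    gaussian d t = (((2 : ℝ) ^ ((d : ℝ) / 4) * Real.exp (-Real.pi * ‖t‖ ^ 2) : ℝ) : ℂ) := by
  rw [Complex.ofReal_mul]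
  rfl

/-- The shifted Gaussian `π(x, ω) φ₀` as a Schwartz function. -/
def gaussianShift {d : ℕ} (z : Phase d) : 𝓢(Rd d, ℂ) :=
  SchwartzMap.smulLeftCLM ℂ (character z.2) (SchwartzMap.compSubConstCLM ℂ z.1 (gaussian d))

theorem gaussianShift_apply {d : ℕ} (z : Phase d) (t : Rd d) :
    gaussianShift z t = character z.2 t * gaussian d (t - z.1) := by
  rw [gaussianShift, SchwartzMap.smulLeftCLM_apply_apply (hasTemperateGrowth_character z.2)]
  rfl

theorem conj_gaussianShift {d : ℕ} (x ω t : Rd d) :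
    gaussianShift (x, -ω) t = conj (gaussianShift (x, ω) t) := by
  simp only [gaussianShift_apply, gaussian_apply, map_mul, Complex.conj_ofReal, character,
    ← Complex.exp_conj, inner_neg_left, Complex.conj_I, Complex.conj_ofNat]
  simp

theorem timeFreqShift_gaussian {d : ℕ} (z : Phase d) :
    timeFreqShift z ((gaussian d).toLp 2) = (gaussianShift z).toLp 2 := by
  refine Lp.ext ?_
  filter_upwards [coeFn_timeFreqShift z ((gaussian d).toLp 2), (gaussianShift z).coeFn_toLp 2,
    (measurePreserving_sub z.1).quasiMeasurePreserving.ae (Filter.EventuallyEq.eventually ((gaussian d).coeFn_toLp 2))]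
    with t h1 h2 h3
  rw [h1, h2, gaussianShift_apply, h3]

/-- `‖φ₀‖ = 1`. -/
theorem norm_gaussian (d : ℕ) : ‖(gaussian d).toLp 2‖ = 1 := by
  have h := SchwartzMap.norm_toLp' (f := gaussian d) (p := 2) (μ := volume) (by norm_num) (by norm_num)
  rw [h]
  have h2 : ∀ t : Rd d, ‖gaussian d t‖ ^ (2 : ℝ≥0∞).toReal =
      (2 : ℝ) ^ ((d : ℝ) / 2) * Real.exp (-(2 * Real.pi) * ‖t‖ ^ 2) := by
    intro t
    rw [gaussian_apply, Complex.norm_real, Real.norm_of_nonneg (by positivity)]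
    simp only [ENNReal.toReal_ofNat, Real.rpow_ofNat]
    rw [mul_pow, ← Real.rpow_natCast, ← Real.rpow_mul (by norm_num), ← Real.exp_nat_mul]
    congr 2
    · push_cast; ring
    · push_cast; ring
  simp_rw [h2]
  rw [integral_const_mul, GaussianFourier.integral_rexp_neg_mul_sq_norm (by positivity)]
  simp only [finrank_euclideanSpace, Fintype.card_fin]
  rw [← Real.mul_rpow (by positivity) (by positivity)]
  have : 2 * (Real.pi / (2 * Real.pi)) = 1 := by field_simp
  rw [this]
  simp

/-- The Hilbert–Schmidt operators on `L²(ℝ^d)`. -/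
abbrev HS (d : ℕ) : Type := HSOp (L2 d)

/-- A weight on phase space: a positive, locally integrable function. -/
structure Weight (d : ℕ) where
  toFun : Phase d → ℝ
  pos : ∀ z, 0 < toFun z
  locallyIntegrable : LocallyIntegrable toFun volume

instance (d : ℕ) : CoeFun (Weight d) (fun _ => Phase d → ℝ) := ⟨Weight.toFun⟩

namespace Weight

variable {d : ℕ}

/-- `v (z + w) ≤ v z * v w`. -/
def IsSubmultiplicative (v : Weight d) : Prop := ∀ z w, v (z + w) ≤ v z * v w

/-- `m` is `v`-moderate: `m (z + w) ≤ v z * m w`. -/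
def IsModerate (m v : Weight d) : Prop := ∀ z w, m (z + w) ≤ v z * m w

/-- `v` has at most polynomial growth. -/
def HasPolynomialGrowth (v : Weight d) : Prop :=
  ∃ (C : ℝ) (N : ℕ), ∀ z, v z ≤ C * (1 + ‖z‖) ^ N

end Weight

section MixedNorm

variable {d : ℕ}

/-- The mixed norm of a nonnegative function `g(x, ω)` on phase space: the `L^p` norm in `x`
followed by the `L^q` norm in `ω` (essential suprema for infinite exponents). -/
def mixedNorm (p q : ℝ≥0∞) (g : Phase d → ℝ≥0∞) : ℝ≥0∞ :=
  eLpNorm (fun ω : Rd d => eLpNorm (fun x : Rd d => g (x, ω)) p volume) q volume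

/-- The `L^{p,q}_m` norm of an operator valued function on phase space, with values in `[0, ∞]`. -/
def weightedNorm (p q : ℝ≥0∞) (m : Weight d) (F : Phase d → HS d) : ℝ≥0∞ :=
  mixedNorm p q (fun z => ENNReal.ofReal (m z) * ‖F z‖ₑ)

/-- Membership of `F` in `L^{p,q}_m(ℝ^{2d}; HS)`. -/
def MemLpqm (p q : ℝ≥0∞) (m : Weight d) (F : Phase d → HS d) : Prop :=
  AEStronglyMeasurable F volume ∧ weightedNorm p q m F < ∞

theorem ae_ae_swap {P : Phase d → Prop} (h : ∀ᵐ z, P z) :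
    ∀ᵐ ω : Rd d, ∀ᵐ x : Rd d, P (x, ω) := by
  have h' : ∀ᵐ w : Rd d × Rd d ∂(volume.prod volume), P w.swap :=
    (Measure.measurePreserving_swap (μ := (volume : Measure (Rd d)))
      (ν := (volume : Measure (Rd d)))).quasiMeasurePreserving.ae h
  exact Measure.ae_ae_of_ae_prod h'

theorem mixedNorm_mono_ae {p q : ℝ≥0∞} {g h : Phase d → ℝ≥0∞} (hgh : ∀ᵐ z, g z ≤ h z) :
    mixedNorm p q g ≤ mixedNorm p q h := by
  refine eLpNorm_mono_enorm_ae ?_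
  filter_upwards [ae_ae_swap hgh] with ω hω
  exact eLpNorm_mono_enorm_ae hω

theorem mixedNorm_congr_ae {p q : ℝ≥0∞} {g h : Phase d → ℝ≥0∞} (hgh : g =ᵐ[volume] h) :
    mixedNorm p q g = mixedNorm p q h :=
  le_antisymm (mixedNorm_mono_ae (hgh.mono fun _ hz => hz.le))
    (mixedNorm_mono_ae (hgh.mono fun _ hz => hz.ge))

theorem measurable_inner_norm {p : ℝ≥0∞} {g : Phase d → ℝ≥0∞} (hg : Measurable g) :
    Measurable (fun ω : Rd d => eLpNorm (fun x : Rd d => g (x, ω)) p volume) := by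
  have hk : Measurable (fun w : Rd d × Rd d => g (w.2, w.1)) := hg.comp measurable_swap
  rcases eq_or_ne p 0 with rfl | hp0
  · simp
  rcases eq_or_ne p ∞ with rfl | hpt
  · simp only [eLpNorm_exponent_top, eLpNormEssSup, enorm_eq_self]
    refine measurable_of_Iic fun a => ?_
    have : (fun ω : Rd d => essSup (fun x : Rd d => g (x, ω)) volume) ⁻¹' Set.Iic a =
        {ω | (volume : Measure (Rd d)) (Prod.mk ω ⁻¹' {w : Rd d × Rd d | a < g (w.2, w.1)}) = 0} := by
      ext ω
      simp only [Set.mem_preimage, Set.mem_Iic, Set.mem_ofPred_eq]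
      constructor
      · intro h
        have := ae_le_essSup (μ := (volume : Measure (Rd d))) (f := fun x => g (x, ω))
        rw [← nonpos_iff_eq_zero, ← ae_iff.1 (this.mono fun x hx => hx.trans h)]
        refine measure_mono fun x hx => ?_
        simpa using hx
      · intro h
        refine essSup_le_of_ae_le a ?_
        refine ae_iff.2 ?_
        rw [← h]
        congr 1
        ext x
        simp
    rw [this]
    exact measurable_measure_prodMk_left (measurableSet_lt measurable_const hk)
      (measurableSet_singleton 0)
  · simp only [eLpNorm_eq_lintegral_rpow_enorm_toReal hp0 hpt, enorm_eq_self]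
    exact (Measurable.lintegral_prod_right' (hk.pow_const _)).pow_const _

theorem mixedNorm_add_le {p q : ℝ≥0∞} (hp : 1 ≤ p) (hq : 1 ≤ q) {g h : Phase d → ℝ≥0∞}
    (hg : AEMeasurable g volume) (hh : AEMeasurable h volume) :
    mixedNorm p q (fun z => g z + h z) ≤ mixedNorm p q g + mixedNorm p q h := by
  rw [mixedNorm_congr_ae hg.ae_eq_mk, mixedNorm_congr_ae hh.ae_eq_mk,
    mixedNorm_congr_ae (g := fun z => g z + h z) (hg.ae_eq_mk.add hh.ae_eq_mk)]
  have hg' := hg.measurable_mk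
  have hh' := hh.measurable_mk
  refine le_trans ?_ (eLpNorm_add_le (measurable_inner_norm hg').aestronglyMeasurable
    (measurable_inner_norm hh').aestronglyMeasurable hq)
  refine eLpNorm_mono_enorm fun ω => ?_
  exact eLpNorm_add_le (hg'.comp measurable_prodMk_right).aestronglyMeasurable
    (hh'.comp measurable_prodMk_right).aestronglyMeasurable hp

theorem ae_zero_of_mixedNorm_eq_zero {p q : ℝ≥0∞} (hp : 1 ≤ p) (hq : 1 ≤ q)
    {g : Phase d → ℝ≥0∞} (hg : AEMeasurable g volume) (h : mixedNorm p q g = 0) :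
    g =ᵐ[volume] 0 := by
  have hp0 : p ≠ 0 := (zero_lt_one.trans_le hp).ne'
  have hq0 : q ≠ 0 := (zero_lt_one.trans_le hq).ne'
  rw [mixedNorm_congr_ae hg.ae_eq_mk] at h
  refine hg.ae_eq_mk.trans ?_
  have hg' := hg.measurable_mk
  set k := hg.mk g
  rw [mixedNorm, eLpNorm_eq_zero_iff (measurable_inner_norm hg').aestronglyMeasurable hq0] at h
  have h2 : ∀ᵐ ω : Rd d, ∀ᵐ x : Rd d, k (x, ω) = 0 := by
    filter_upwards [h] with ω hω
    exact (eLpNorm_eq_zero_iff (hg'.comp measurable_prodMk_right).aestronglyMeasurable hp0).1 hω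
  have h3 : ∀ᵐ w : Rd d × Rd d ∂(volume.prod volume), k w.swap = 0 :=
    (Measure.ae_prod_iff_ae_ae (p := fun w : Rd d × Rd d => k w.swap = 0)
      ((hg'.comp measurable_swap) (measurableSet_singleton 0))).2 h2
  have := (Measure.measurePreserving_swap (μ := (volume : Measure (Rd d)))
      (ν := (volume : Measure (Rd d)))).quasiMeasurePreserving.ae h3
  exact this

theorem Weight.aemeasurable (m : Weight d) : AEMeasurable (m : Phase d → ℝ) volume :=
  m.locallyIntegrable.aestronglyMeasurable.aemeasurable

theorem aemeasurable_weighted (m : Weight d) {F : Phase d → HS d}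
    (hF : AEStronglyMeasurable F volume) :
    AEMeasurable (fun z => ENNReal.ofReal (m z) * ‖F z‖ₑ) volume :=
  m.aemeasurable.ennreal_ofReal.mul hF.enorm

theorem weightedNorm_congr_ae {p q : ℝ≥0∞} {m : Weight d} {F G : Phase d → HS d}
    (h : F =ᵐ[volume] G) : weightedNorm p q m F = weightedNorm p q m G :=
  mixedNorm_congr_ae (h.mono fun z hz => by simp only [hz])

theorem weightedNorm_add_le {p q : ℝ≥0∞} (hp : 1 ≤ p) (hq : 1 ≤ q) {m : Weight d}
    {F G : Phase d → HS d} (hF : AEStronglyMeasurable F volume)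
    (hG : AEStronglyMeasurable G volume) :
    weightedNorm p q m (F + G) ≤ weightedNorm p q m F + weightedNorm p q m G := by
  refine le_trans (mixedNorm_mono_ae (Filter.Eventually.of_forall fun z => ?_))
    (mixedNorm_add_le hp hq (aemeasurable_weighted m hF) (aemeasurable_weighted m hG))
  rw [← mul_add]
  gcongr
  exact enorm_add_le _ _

theorem weightedNorm_smul {p q : ℝ≥0∞} {m : Weight d} (c : ℂ) (F : Phase d → HS d) :
    weightedNorm p q m (c • F) = ‖c‖ₑ * weightedNorm p q m F := by
  have h1 : ∀ (r : ℝ≥0∞) (f : Rd d → ℝ≥0∞),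
      eLpNorm (fun x => ‖c‖ₑ * f x) r volume = ‖c‖ₑ * eLpNorm f r volume := by
    intro r f
    rcases eq_or_ne r 0 with rfl | hr0
    · simp
    rcases eq_or_ne r ∞ with rfl | hrt
    · simp only [eLpNorm_exponent_top, eLpNormEssSup, enorm_eq_self]
      exact ENNReal.essSup_const_mul
    · have hr : 0 < r.toReal := ENNReal.toReal_pos hr0 hrt
      simp only [eLpNorm_eq_lintegral_rpow_enorm_toReal hr0 hrt, enorm_eq_self,
        ENNReal.mul_rpow_of_nonneg _ _ hr.le]
      rw [lintegral_const_mul' _ _ (ENNReal.rpow_ne_top_of_nonneg hr.le enorm_ne_top),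
        ENNReal.mul_rpow_of_nonneg _ _ (by positivity), ← ENNReal.rpow_mul,
        mul_one_div_cancel hr.ne', ENNReal.rpow_one]
  simp only [weightedNorm, mixedNorm, Pi.smul_apply, enorm_smul]
  simp_rw [mul_left_comm _ ‖c‖ₑ, h1]

theorem weightedNorm_zero {p q : ℝ≥0∞} {m : Weight d} :
    weightedNorm p q m (0 : Phase d → HS d) = 0 := by
  simpa using weightedNorm_smul (p := p) (q := q) (m := m) 0 (0 : Phase d → HS d)

end MixedNorm

section Lpqm

variable {d : ℕ} (p q : ℝ≥0∞) [hp : Fact (1 ≤ p)] [hq : Fact (1 ≤ q)] (m : Weight d)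

/-- The weighted mixed-norm space `L^{p,q}_m(ℝ^{2d}; HS)`, consisting of classes of functions
modulo equality almost everywhere. -/
def Lpqm : Submodule ℂ (Phase d →ₘ[volume] HS d) where
  carrier := {F | weightedNorm p q m F < ∞}
  zero_mem' := by
    change weightedNorm p q m _ < ∞
    rw [weightedNorm_congr_ae AEEqFun.coeFn_zero, weightedNorm_zero]
    exact ENNReal.zero_lt_top
  add_mem' {F G} hF hG := by
    change weightedNorm p q m _ < ∞
    rw [weightedNorm_congr_ae (AEEqFun.coeFn_add F G)]
    exact (weightedNorm_add_le hp.out hq.out F.aestronglyMeasurable G.aestronglyMeasurable).trans_lt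
      (ENNReal.add_lt_top.2 ⟨hF, hG⟩)
  smul_mem' c F hF := by
    change weightedNorm p q m _ < ∞
    rw [weightedNorm_congr_ae (AEEqFun.coeFn_smul c F), weightedNorm_smul]
    exact ENNReal.mul_lt_top enorm_lt_top hF

variable {p q m}

/-- The norm `‖Ψ‖_{L^{p,q}_m}`. -/
instance : NormedAddCommGroup (Lpqm p q m) :=
  AddGroupNorm.toNormedAddCommGroup
    { toFun := fun F => (weightedNorm p q m F.1).toReal
      map_zero' := by
        rw [Submodule.coe_zero, weightedNorm_congr_ae AEEqFun.coeFn_zero, weightedNorm_zero]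
        rfl
      add_le' := fun F G => by
        rw [← ENNReal.toReal_add F.2.ne G.2.ne]
        refine ENNReal.toReal_mono (ENNReal.add_ne_top.2 ⟨F.2.ne, G.2.ne⟩) ?_
        rw [Submodule.coe_add, weightedNorm_congr_ae (AEEqFun.coeFn_add F.1 G.1)]
        exact weightedNorm_add_le hp.out hq.out F.1.aestronglyMeasurable G.1.aestronglyMeasurable
      neg' := fun F => by
        have h : ((-F : Lpqm p q m) : Phase d →ₘ[volume] HS d) = (-1 : ℂ) • F.1 := by simp
        rw [h, weightedNorm_congr_ae (AEEqFun.coeFn_smul (-1 : ℂ) F.1), weightedNorm_smul]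
        simp
      eq_zero_of_map_eq_zero' := fun F h => by
        have h0 : weightedNorm p q m F.1 = 0 :=
          ((ENNReal.toReal_eq_zero_iff _).1 h).resolve_right F.2.ne
        refine Subtype.ext (AEEqFun.ext ?_)
        have h1 := ae_zero_of_mixedNorm_eq_zero hp.out hq.out
          (aemeasurable_weighted m F.1.aestronglyMeasurable) h0
        filter_upwards [h1, AEEqFun.coeFn_zero (μ := (volume : Measure (Phase d))) (β := HS d)]
          with z hz hz0
        have hm : ENNReal.ofReal (m z) ≠ 0 := (ENNReal.ofReal_pos.2 (m.pos z)).ne'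
        rw [Submodule.coe_zero, hz0]
        exact enorm_eq_zero.1 ((mul_eq_zero.1 hz).resolve_left hm) }

theorem Lpqm.norm_def (F : Lpqm p q m) : ‖F‖ = (weightedNorm p q m F.1).toReal := rfl

instance : NormedSpace ℂ (Lpqm p q m) where
  norm_smul_le c F := by
    rw [Lpqm.norm_def, Lpqm.norm_def, Submodule.coe_smul,
      weightedNorm_congr_ae (AEEqFun.coeFn_smul c F.1), weightedNorm_smul, ENNReal.toReal_mul,
      toReal_enorm]

end Lpqm

section OperatorSTFT

variable {d : ℕ}

/-- The operator `S* π(z)*` on `L²(ℝ^d)`. -/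
def adjointShift (S : HS d) (z : Phase d) : L2 d →L[ℂ] L2 d :=
  ContinuousLinearMap.adjoint (HSOp.toCLM S) ∘L
    ContinuousLinearMap.adjoint (timeFreqShift z).toContinuousLinearMap

/-- The operator STFT `𝔙_S T (z) = S* π(z)* T` for Hilbert–Schmidt operators `S` and `T`. -/
def opSTFT (S T : HS d) (z : Phase d) : HS d := HSOp.leftComp (adjointShift S z) T

/-- The admissible operators `𝔄_v`: those `S` in `HS` with `𝔙_S S ∈ L¹_v(ℝ^{2d}; HS)`. -/
def admissible (v : Weight d) : Set (HS d) := {S | MemLpqm 1 1 v (opSTFT S S)}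

/-- The integrand `z' ↦ H(z - z') F(z') c(z, z')` of the twisted convolution, where
`c(z, z') = e^{-2π i x'·(ω - ω')}` for `z = (x, ω)` and `z' = (x', ω')`. -/
def twistedIntegrand (F H : Phase d → HS d) (z z' : Phase d) : HS d :=
  character z'.1 (z'.2 - z.2) • HSOp.leftComp (HSOp.toCLM (H (z - z'))) (F z')

/-- The twisted convolution `F ♮ H (z) = ∫ H(z - z') F(z') c(z, z') dz'`, a Bochner integral. -/
def twistedConv (F H : Phase d → HS d) (z : Phase d) : HS d := ∫ z', twistedIntegrand F H z z'

theorem twistedIntegrand_congr {F G H : Phase d → HS d} (h : F =ᵐ[volume] G) (z : Phase d) :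
    twistedIntegrand F H z =ᵐ[volume] twistedIntegrand G H z :=
  h.mono fun z' hz' => by simp only [twistedIntegrand, hz']

theorem twistedIntegrand_add (F G H : Phase d → HS d) (z : Phase d) :
    twistedIntegrand (F + G) H z = twistedIntegrand F H z + twistedIntegrand G H z := by
  funext z'
  simp only [twistedIntegrand, Pi.add_apply, HSOp.leftComp_add, smul_add]

theorem twistedIntegrand_smul (c : ℂ) (F H : Phase d → HS d) (z : Phase d) :
    twistedIntegrand (c • F) H z = c • twistedIntegrand F H z := by
  funext z'
  simp only [twistedIntegrand, Pi.smul_apply, HSOp.leftComp_smul, smul_comm c]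

theorem twistedIntegrand_zero (H : Phase d → HS d) (z : Phase d) :
    twistedIntegrand 0 H z = 0 := by
  simpa using twistedIntegrand_smul 0 0 H z

variable (d) in
/-- The dual `𝔖'` of the Schwartz operators, that is, the continuous linear operators from the
Schwartz space to the space of tempered distributions (with the weak-* topology). -/
abbrev SchwartzOpDual : Type := 𝓢(Rd d, ℂ) →L[ℂ] 𝓢'(Rd d, ℂ)

/-- The STFT with Gaussian window of a tempered distribution, `V_{φ₀} u (z) = ⟨u, π(z) φ₀⟩`; the
bracket is antilinear on the right, so that `u` is applied to the complex conjugate of `π(z) φ₀`,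
which is `π(x, -ω) φ₀` for `z = (x, ω)`. -/
def distSTFT (u : 𝓢'(Rd d, ℂ)) (z : Phase d) : ℂ := u (gaussianShift (z.1, -z.2))

/-- The STFT with Gaussian window of `h ∈ L²(ℝ^d)`, `V_{φ₀} h (z) = ⟨h, π(z) φ₀⟩`. -/
def gaussSTFT (h : L2 d) (z : Phase d) : ℂ :=
  inner ℂ (timeFreqShift z ((gaussian d).toLp 2)) h

/-- The pairing of a tempered distribution `u` and `h ∈ L²(ℝ^d)`, antilinear in `h`, is defined by
the absolutely convergent integral
`⟨u, h⟩ = ∫ V_{φ₀} u (w) conj (V_{φ₀} h (w)) dw`. This is the usual extension of the duality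
between `𝒮'` and `𝒮`, and of the inner product of `L²`, to modulation spaces. The predicate says
that the integral converges absolutely and has the value `a`. -/
def HasPairing (u : 𝓢'(Rd d, ℂ)) (h : L2 d) (a : ℂ) : Prop :=
  Integrable (fun w => distSTFT u w * conj (gaussSTFT h w)) (volume : Measure (Phase d)) ∧
    ∫ w, distSTFT u w * conj (gaussSTFT h w) = a

/-- For `T ∈ 𝔖'`, the operator `S* π(z)* T` is defined, and equal to the Hilbert–Schmidt operator
`A`: one has `⟨A f, g⟩ = ⟨T f, π(z) S g⟩` for all `f ∈ 𝒮(ℝ^d)` and `g ∈ L²(ℝ^d)`. -/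
def HasOpSTFTAt (S : HS d) (T : SchwartzOpDual d) (z : Phase d) (A : HS d) : Prop :=
  ∀ (f : 𝓢(Rd d, ℂ)) (g : L2 d),
    HasPairing (T f) (timeFreqShift z (HSOp.toCLM S g)) (inner ℂ g (HSOp.toCLM A (f.toLp 2)))

theorem HasOpSTFTAt.unique {S : HS d} {T : SchwartzOpDual d} {z : Phase d} {A B : HS d}
    (hA : HasOpSTFTAt S T z A) (hB : HasOpSTFTAt S T z B) : A = B := by
  refine HSOp.toCLM_injective (ContinuousLinearMap.coeFn_injective ?_)
  refine (SchwartzMap.denseRange_toLpCLM (E := Rd d) (F := ℂ) (p := 2) (μ := volume)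
    (by norm_num)).equalizer (HSOp.toCLM A).continuous (HSOp.toCLM B).continuous ?_
  funext f
  refine ext_inner_left ℂ fun g => ?_
  exact (hA f g).2.symm.trans (hB f g).2

theorem HasOpSTFTAt.add {S : HS d} {T T' : SchwartzOpDual d} {z : Phase d} {A B : HS d}
    (hA : HasOpSTFTAt S T z A) (hB : HasOpSTFTAt S T' z B) :
    HasOpSTFTAt S (T + T') z (A + B) := by
  intro f g
  have e : ∀ w, distSTFT ((T + T') f) w = distSTFT (T f) w + distSTFT (T' f) w := fun _ => rfl
  simp only [HasPairing, e, add_mul]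
  refine ⟨(hA f g).1.add (hB f g).1, ?_⟩
  rw [integral_add (hA f g).1 (hB f g).1, (hA f g).2, (hB f g).2, map_add,
    add_apply, inner_add_right]

theorem HasOpSTFTAt.smul {S : HS d} {T : SchwartzOpDual d} {z : Phase d} {A : HS d} (c : ℂ)
    (hA : HasOpSTFTAt S T z A) : HasOpSTFTAt S (c • T) z (c • A) := by
  intro f g
  have e : ∀ w, distSTFT ((c • T) f) w = c * distSTFT (T f) w := fun _ => rfl
  simp only [HasPairing, e, mul_assoc]
  refine ⟨(hA f g).1.const_mul c, ?_⟩
  rw [integral_const_mul, (hA f g).2, map_smul, smul_apply, inner_smul_right]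

theorem HasOpSTFTAt.zero (S : HS d) (z : Phase d) : HasOpSTFTAt S 0 z 0 := by
  intro f g
  have e : ∀ w, distSTFT ((0 : SchwartzOpDual d) f) w = 0 := fun _ => rfl
  simp only [HasPairing, e]
  simp

open scoped Classical in
/-- The operator STFT `𝔙_S T (z) = S* π(z)* T` for `T ∈ 𝔖'`, with the value `0` at those `z` where
it is not defined as a Hilbert–Schmidt operator. -/
def opSTFTDual (S : HS d) (T : SchwartzOpDual d) (z : Phase d) : HS d :=
  if h : ∃ A, HasOpSTFTAt S T z A then h.choose else 0

theorem HasOpSTFTAt.eq {S : HS d} {T : SchwartzOpDual d} {z : Phase d} {A : HS d}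
    (hA : HasOpSTFTAt S T z A) : opSTFTDual S T z = A := by
  have h : ∃ A, HasOpSTFTAt S T z A := ⟨A, hA⟩
  rw [opSTFTDual, dif_pos h]
  exact h.choose_spec.unique hA

end OperatorSTFT

section Coorbit

variable {d : ℕ} (S : HS d) (p q : ℝ≥0∞) [hp : Fact (1 ≤ p)] [hq : Fact (1 ≤ q)] (m : Weight d)

/-- The space of all `T ∈ 𝔖'` for which `𝔙_S T` is defined almost everywhere and belongs to
`L^{p,q}_m(ℝ^{2d}; HS)`. -/
def coorbitWith : Submodule ℂ (SchwartzOpDual d) where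
  carrier := {T | (∀ᵐ z, ∃ A, HasOpSTFTAt S T z A) ∧ MemLpqm p q m (opSTFTDual S T)}
  zero_mem' := by
    have h : opSTFTDual S (0 : SchwartzOpDual d) = 0 := funext fun z => (HasOpSTFTAt.zero S z).eq
    refine ⟨Filter.Eventually.of_forall fun z => ⟨0, HasOpSTFTAt.zero S z⟩, ?_⟩
    rw [h]
    exact ⟨aestronglyMeasurable_zero, by rw [weightedNorm_zero]; exact ENNReal.zero_lt_top⟩
  add_mem' {T T'} hT hT' := by
    have h : opSTFTDual S (T + T') =ᵐ[volume] opSTFTDual S T + opSTFTDual S T' := by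
      filter_upwards [hT.1, hT'.1] with z ⟨A, hA⟩ ⟨B, hB⟩
      rw [Pi.add_apply, (hA.add hB).eq, hA.eq, hB.eq]
    refine ⟨?_, (hT.2.1.add hT'.2.1).congr h.symm, ?_⟩
    · filter_upwards [hT.1, hT'.1] with z ⟨A, hA⟩ ⟨B, hB⟩
      exact ⟨A + B, hA.add hB⟩
    · rw [weightedNorm_congr_ae h]
      exact (weightedNorm_add_le hp.out hq.out hT.2.1 hT'.2.1).trans_lt
        (ENNReal.add_lt_top.2 ⟨hT.2.2, hT'.2.2⟩)
  smul_mem' c T hT := by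
    have h : opSTFTDual S (c • T) =ᵐ[volume] c • opSTFTDual S T := by
      filter_upwards [hT.1] with z ⟨A, hA⟩
      rw [Pi.smul_apply, (hA.smul c).eq, hA.eq]
    refine ⟨?_, (hT.2.1.const_smul c).congr h.symm, ?_⟩
    · filter_upwards [hT.1] with z ⟨A, hA⟩
      exact ⟨c • A, hA.smul c⟩
    · rw [weightedNorm_congr_ae h, weightedNorm_smul]
      exact ENNReal.mul_lt_top enorm_lt_top hT.2.2

/-- The norm `‖𝔙_S T‖_{L^{p,q}_m}` that the window `S` induces. -/
def coorbitNorm (T : SchwartzOpDual d) : ℝ := (weightedNorm p q m (opSTFTDual S T)).toReal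

/-- The operator `S₀ = φ₀ ⊗ e₀`. -/
def gaussianWindow (e₀ : L2 d) : HS d := HSOp.rankOne ((gaussian d).toLp 2) e₀

/-- The operator coorbit space `𝔐^{p,q}_m = {T ∈ 𝔖' : 𝔙_{S₀} T ∈ L^{p,q}_m(ℝ^{2d}; HS)}`, where
`S₀ = φ₀ ⊗ e₀`. -/
def coorbit (e₀ : L2 d) : Submodule ℂ (SchwartzOpDual d) := coorbitWith (gaussianWindow e₀) p q m

/-- The space of all `Ψ ∈ L^{p,q}_m(ℝ^{2d}; HS)` with `Ψ = Ψ ♮ 𝔙_S S`; the integral that defines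
the twisted convolution has to converge absolutely almost everywhere. -/
def reproducingSpace : Submodule ℂ (Lpqm p q m) where
  carrier := {Ψ | ∀ᵐ z, Integrable (twistedIntegrand Ψ.1 (opSTFT S S) z) ∧
    Ψ.1 z = twistedConv Ψ.1 (opSTFT S S) z}
  zero_mem' := by
    have h : ((0 : Lpqm p q m).1 : Phase d → HS d) =ᵐ[volume] 0 := AEEqFun.coeFn_zero
    filter_upwards [h] with z hz
    have e := twistedIntegrand_congr (H := opSTFT S S) h z
    rw [twistedIntegrand_zero] at e
    refine ⟨(integrable_zero _ _ _).congr e.symm, ?_⟩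
    rw [hz, twistedConv, integral_congr_ae e]
    simp
  add_mem' {Ψ Φ} hΨ hΦ := by
    change ∀ᵐ z, _
    have h : ((Ψ + Φ : Lpqm p q m).1 : Phase d → HS d) =ᵐ[volume] Ψ.1 + Φ.1 :=
      AEEqFun.coeFn_add Ψ.1 Φ.1
    filter_upwards [h, hΨ, hΦ] with z hz h1 h2
    have e := twistedIntegrand_congr (H := opSTFT S S) h z
    rw [twistedIntegrand_add] at e
    refine ⟨(h1.1.add h2.1).congr e.symm, ?_⟩
    rw [hz, twistedConv, integral_congr_ae e, integral_add' h1.1 h2.1, Pi.add_apply, h1.2, h2.2]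
    rfl
  smul_mem' c Ψ hΨ := by
    change ∀ᵐ z, _
    have h : ((c • Ψ : Lpqm p q m).1 : Phase d → HS d) =ᵐ[volume] c • (Ψ.1 : Phase d → HS d) :=
      AEEqFun.coeFn_smul c Ψ.1
    filter_upwards [h, hΨ] with z hz h1
    have e := twistedIntegrand_congr (H := opSTFT S S) h z
    rw [twistedIntegrand_smul] at e
    refine ⟨(h1.1.smul c).congr e.symm, ?_⟩
    rw [hz, twistedConv, integral_congr_ae e, Pi.smul_apply, h1.2]
    exact (integral_smul c _).symm

end Coorbit

end

/-!
The operator short-time Fourier transform (STFT) `𝔙_S T(z) = S* π(z)* T` behaves like a wavelet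
transform with values in the Hilbert–Schmidt operators, and the theorem is the coorbit principle
for it. Everything rests on the reproducing formula

  `𝔙_S T ♮ 𝔙_Q R = tr(S* R) 𝔙_Q T`.

For Hilbert–Schmidt `T` (`twistedConv_opSTFT`) it is Moyal's identity `∫ π(w) R S* π(w)* dw =
tr(S* R) I` (`integral_inner_adjointShift`), which reduces to the scalar identity
`integral_inner_mul_inner` and so to Plancherel's theorem. The same formula under an integral sign
gives `(Ψ ♮ 𝔙_S P) ♮ 𝔙_Q R = tr(S* R) Ψ ♮ 𝔙_Q P` for every `Ψ ∈ L^{p,q}_m`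
(`twistedConv_twistedConv`). Convergence is a matter of Young's inequality `L¹_v * L^{p,q}_m ⊆
L^{p,q}_m` (`mixedNorm_weight_mul_convolution_le`), which follows from Minkowski's integral
inequality. Hence `Ψ ↦ Ψ ♮ 𝔙_R Q` is bounded on `L^{p,q}_m` as soon as `𝔙_R Q ∈ L¹_v`, and the
reproducing subspace is closed, being the set of fixed points of such an operator.

To compare windows, `𝔙_{S₀} S` and `𝔙_S S₀` must lie in `L¹_v` for every admissible `S`. Choose an
operator `R` of rank one with Schwartz range and `tr(S* R) ≠ 0`. Then `𝔙_{S₀} R` decays rapidly,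
and the reproducing formula writes `tr(S* R) 𝔙_{S₀} S` as `𝔙_S S ♮ 𝔙_{S₀} R`, a convolution of two
elements of `L¹_v` (`kernelNorm_gaussianWindow_lt_top`). The other kernel is treated by passing to
adjoints.

For operators `T` from the Schwartz space to its dual, the link with distributions is the
inversion formula `u(k) = ∫ u(π(w) φ₀) V_{φ₀} k(w) dw` for tempered `u` (`tempered_inversion`).
Its proof needs no weak integrals in the Schwartz space: by the Gabor expansion of Schwartz
functions, `u` is bounded for a weighted `L²` norm of `V_{φ₀} k`, so the theorems of Hahn–Banach
and Riesz write `u(k)` as an integral against `V_{φ₀} k`, and Moyal's identity does the rest. The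
inversion formula identifies the operator STFT for the Gaussian window
(`hasOpSTFTAt_gaussianWindow_iff`) and shows that `𝔙_R T = 𝔙_{S₀} T ♮ 𝔙_R S₀` on a coorbit space.
This holds at every point of phase space, because `𝔙_{S₀} T = 𝔙_{S₀} T ♮ 𝔙_{S₀} S₀` becomes
bounded when multiplied by `m` (`opSTFTDual_of_mem_coorbit`).

Together these give `𝔙_S T ♮ 𝔙_R S = 𝔙_R T` on coorbit spaces (`twistedConv_opSTFTDual`). With `R
= S`, the range of `𝔙_S` lies in the reproducing subspace. With `R = S₀`, the map is injective,
the norms are equivalent, and membership in a coorbit space can be tested with `S`. For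
surjectivity, a `Ψ` with `Ψ = Ψ ♮ 𝔙_S S` is turned into `A = Ψ ♮ 𝔙_{S₀} S`, which grows
polynomially in the integrated sense and so can be integrated to an operator `T` with `𝔙_{S₀} T =
A` (`exists_schwartzOpDual`, `hasOpSTFTAt_synthesis`). Then `𝔙_S T = A ♮ 𝔙_S S₀ = Ψ ♮ 𝔙_S S = Ψ`.
-/

noncomputable section

/-! ### Hilbert–Schmidt operators -/

section HilbertSchmidtCalculus

namespace HSOp

variable {H : Type*} [NormedAddCommGroup H] [InnerProductSpace ℂ H] [CompleteSpace H]

theorem toCLM_rankOne (φ e f : H) : toCLM (rankOne φ e) f = inner ℂ e f • φ := rfl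

theorem norm_sq_le_of_hasSum {T : HSOp H} {g : basisIndex H → ℝ} {c : ℝ} (hg : HasSum g c)
    (h : ∀ i, ‖toCLM T (onb H i)‖ ^ 2 ≤ g i) : ‖T‖ ^ 2 ≤ c :=
  hasSum_le h (hasSum_norm_sq T) hg

theorem norm_leftComp_le (A : H →L[ℂ] H) (T : HSOp H) : ‖leftComp A T‖ ≤ ‖A‖ * ‖T‖ := by
  have h := norm_sq_le_of_hasSum (T := leftComp A T) ((hasSum_norm_sq T).mul_left (‖A‖ ^ 2))
    fun i => by
      rw [← mul_pow]
      gcongr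
      exact A.le_opNorm _
  rw [← mul_pow] at h
  exact le_of_sq_le_sq h (by positivity)

/-- Composition `(A, T) ↦ A T` of bounded operators and Hilbert–Schmidt operators, as a continuous
bilinear map. -/
def leftCompL : (H →L[ℂ] H) →L[ℂ] HSOp H →L[ℂ] HSOp H :=
  LinearMap.mkContinuous₂
    (LinearMap.mk₂ ℂ leftComp
      (fun A B T => toCLM_injective (ContinuousLinearMap.ext fun _ => rfl))
      (fun c A T => toCLM_injective (ContinuousLinearMap.ext fun _ => rfl))
      leftComp_add (fun c A T => leftComp_smul A c T)) 1
    fun A T => by simpa using norm_leftComp_le A T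

/-- The inclusion of the Hilbert–Schmidt operators into the bounded operators, as a continuous
linear map. -/
def toCLML : HSOp H →L[ℂ] H →L[ℂ] H :=
  LinearMap.mkContinuous toCLM 1 fun T => by simpa using norm_toCLM_le T

theorem norm_leftComp_toCLM_le (A T : HSOp H) : ‖leftComp (toCLM A) T‖ ≤ ‖A‖ * ‖T‖ :=
  (norm_leftComp_le _ _).trans (by gcongr; exact norm_toCLM_le A)

theorem norm_apply_le (T : HSOp H) (f : H) : ‖toCLM T f‖ ≤ ‖T‖ * ‖f‖ :=
  ((toCLM T).le_opNorm f).trans (by gcongr; exact norm_toCLM_le T)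

theorem adjoint_mem (T : HSOp H) :
    ContinuousLinearMap.adjoint (toCLM T) ∈ hilbertSchmidtSubmodule H := by
  refine mem_of_summable ?_
  have h := tsum_norm_sq_eq_adjoint (onb H) (onb H) (toCLM T)
  rw [← ENNReal.ofReal_tsum_of_nonneg (fun _ => by positivity) (hasSum_norm_sq T).summable] at h
  refine (ENNReal.summable_toReal (h ▸ ENNReal.ofReal_ne_top)).congr fun j => ?_
  rw [ENNReal.toReal_ofReal (by positivity)]

/-- The adjoint of a Hilbert–Schmidt operator. -/
def adj (T : HSOp H) : HSOp H := mk (ContinuousLinearMap.adjoint (toCLM T)) (adjoint_mem T)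

theorem toCLM_adj (T : HSOp H) : toCLM (adj T) = ContinuousLinearMap.adjoint (toCLM T) := rfl

theorem norm_adj (T : HSOp H) : ‖adj T‖ = ‖T‖ := by
  have h := tsum_norm_sq_eq_adjoint (onb H) (onb H) (toCLM T)
  have h2 := hasSum_norm_sq (adj T)
  rw [toCLM_adj] at h2
  rw [← ENNReal.ofReal_tsum_of_nonneg (fun _ => by positivity) (hasSum_norm_sq T).summable,
    ← ENNReal.ofReal_tsum_of_nonneg (fun _ => by positivity) h2.summable,
    (hasSum_norm_sq T).tsum_eq, h2.tsum_eq,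
    ENNReal.ofReal_eq_ofReal_iff (by positivity) (by positivity)] at h
  exact ((sq_eq_sq₀ (norm_nonneg _) (norm_nonneg _)).1 h).symm

theorem norm_rankOne (φ e : H) : ‖rankOne φ e‖ = ‖φ‖ * ‖e‖ := by
  have h := ((hasSum_parseval (onb H) e).mul_left (‖φ‖ ^ 2)).unique
    (((hasSum_norm_sq (rankOne φ e))).congr_fun fun i => by
      rw [toCLM_rankOne, norm_smul, mul_pow, norm_inner_symm, mul_comm])
  rw [← mul_pow] at h
  exact ((sq_eq_sq₀ (by positivity) (norm_nonneg _)).1 h).symm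

theorem ext_inner {S T : HSOp H} (h : ∀ f g, inner ℂ g (toCLM S f) = inner ℂ g (toCLM T f)) :
    S = T :=
  toCLM_injective (ContinuousLinearMap.ext fun f => ext_inner_left ℂ fun g => h f g)

/-- A bounded, strongly continuous family `A x` of operators gives a norm continuous family
`A x T` of Hilbert–Schmidt operators. -/
theorem continuous_leftComp {X : Type*} [TopologicalSpace X] {A : X → H →L[ℂ] H} {C : ℝ}
    (hC : ∀ x, ‖A x‖ ≤ C) (hA : ∀ f, Continuous fun x => A x f) (T : HSOp H) :
    Continuous fun x => leftComp (A x) T := by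
  rw [continuous_iff_continuousAt]
  intro x₀
  -- Dominated convergence for the sum `∑ ‖(A x - A x₀) T eᵢ‖²`.
  have e : ∀ x, ‖leftComp (A x) T - leftComp (A x₀) T‖ ^ 2 =
      ∑' i, ‖A x (toCLM T (onb H i)) - A x₀ (toCLM T (onb H i))‖ ^ 2 := fun x =>
    (hasSum_norm_sq _).tsum_eq.symm
  have h0 : Filter.Tendsto (fun x => ‖leftComp (A x) T - leftComp (A x₀) T‖ ^ 2) (nhds x₀)
      (nhds (∑' _ : basisIndex H, (0 : ℝ))) := by
    simp_rw [e]
    refine tendsto_tsum_of_dominated_convergence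
      (bound := fun i => (2 * C) ^ 2 * ‖toCLM T (onb H i)‖ ^ 2)
      ((hasSum_norm_sq T).summable.mul_left _) (fun i => ?_)
      (Filter.Eventually.of_forall fun x i => ?_)
    · have := ((hA (toCLM T (onb H i))).tendsto x₀).sub_const (A x₀ (toCLM T (onb H i)))
      simpa using! (this.norm.pow 2)
    · rw [Real.norm_of_nonneg (by positivity), ← mul_pow]
      gcongr
      change ‖(A x - A x₀) (toCLM T (onb H i))‖ ≤ _
      refine ((A x - A x₀).le_opNorm _).trans ?_
      gcongr
      exact (norm_sub_le _ _).trans (by linarith [hC x, hC x₀])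
  rw [tsum_zero] at h0
  rw [ContinuousAt, tendsto_iff_norm_sub_tendsto_zero]
  have := (Real.continuous_sqrt.tendsto 0).comp h0
  simpa [Function.comp_def, Real.sqrt_sq] using this

/-- Balls of radius `1 / 2` around orthonormal vectors are disjoint, and a separable space has room
for only countably many of them. -/
instance countable_basisIndex [TopologicalSpace.SeparableSpace H] : Countable (basisIndex H) := by
  have ho := (onb H).orthonormal
  have hd : ∀ i j : basisIndex H, i ≠ j → 1 ≤ dist (onb H i) (onb H j) := fun i j hij => by
    have h := norm_sub_sq (𝕜 := ℂ) (onb H i) (onb H j)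
    rw [ho.1 i, ho.1 j, ho.2 hij] at h
    rw [dist_eq_norm]
    have h2 : (1 : ℝ) ≤ ‖onb H i - onb H j‖ ^ 2 := by rw [h]; norm_num
    nlinarith [norm_nonneg (onb H i - onb H j)]
  have h := Set.PairwiseDisjoint.countable_of_isOpen (a := (Set.univ : Set (basisIndex H)))
    (s := fun i => Metric.ball (onb H i) (1 / 2)) (fun i _ j _ hij => ?_)
    (fun _ _ => Metric.isOpen_ball) (fun i _ => ⟨onb H i, Metric.mem_ball_self (by norm_num)⟩)
  · exact Set.countable_univ_iff.1 h
  · exact Metric.ball_disjoint_ball (by linarith [hd i j hij])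

/-- The Hilbert–Schmidt inner product `tr(R* S) = ∑ ⟨S eᵢ, R eᵢ⟩`. -/
def traceInner (R S : HSOp H) : ℂ :=
  ∑' i, inner ℂ (toCLM R (onb H i)) (toCLM S (onb H i))

theorem summable_norm_mul_norm (R S : HSOp H) :
    Summable fun i => ‖toCLM R (onb H i)‖ * ‖toCLM S (onb H i)‖ := by
  refine Summable.of_nonneg_of_le (fun _ => by positivity) (fun i => ?_)
    ((hasSum_norm_sq R).summable.add (hasSum_norm_sq S).summable)
  nlinarith [sq_nonneg (‖toCLM R (onb H i)‖ - ‖toCLM S (onb H i)‖),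
    sq_nonneg (‖toCLM R (onb H i)‖), sq_nonneg (‖toCLM S (onb H i)‖)]

theorem hasSum_traceInner (R S : HSOp H) :
    HasSum (fun i => inner ℂ (toCLM R (onb H i)) (toCLM S (onb H i))) (traceInner R S) :=
  ((summable_norm_mul_norm R S).of_norm_bounded fun _ => norm_inner_le_norm _ _).hasSum

theorem traceInner_self (S : HSOp H) : traceInner S S = (‖S‖ : ℂ) ^ 2 := by
  refine (hasSum_traceInner S S).unique ?_
  have h := (Complex.hasSum_ofReal).2 (hasSum_norm_sq S)
  push_cast at h
  refine h.congr_fun fun i => ?_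
  rw [inner_self_eq_norm_sq_to_K]
  rfl

theorem traceInner_rankOne (φ : H) (i : basisIndex H) (S : HSOp H) :
    traceInner (rankOne φ (onb H i)) S = inner ℂ φ (toCLM S (onb H i)) := by
  classical
  refine (hasSum_traceInner _ S).unique ?_
  refine (hasSum_ite_eq i (inner ℂ φ (toCLM S (onb H i)))).congr_fun fun j => ?_
  rw [toCLM_rankOne, (orthonormal_iff_ite.1 (onb H).orthonormal) i j, inner_smul_left]
  rcases eq_or_ne j i with rfl | h
  · simp
  · simp [h, h.symm]

end HSOp

end HilbertSchmidtCalculus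

/-! ### Time-frequency shifts and Plancherel's identity -/

section TimeFrequencyShifts

open FourierTransform

variable {d : ℕ}

/-- Plancherel's identity for `f ∈ L¹ ∩ L²` and the Fourier integral of `f`. -/
theorem lintegral_enorm_sq_fourier {f : Rd d → ℂ} (h1 : Integrable f) (h2 : MemLp f 2 volume) :
    ∫⁻ ω, ‖𝓕 f ω‖ₑ ^ 2 = ∫⁻ t, ‖f t‖ₑ ^ 2 := by
  set F : L2 d := h2.toLp f with hF
  have hFf : F =ᵐ[volume] f := h2.coeFn_toLp
  have hcont : Continuous (𝓕 f) :=
    VectorFourier.fourierIntegral_continuous Real.continuous_fourierChar continuous_inner h1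
  -- The `L²` Fourier transform and the Fourier integral define the same distribution, hence agree.
  have key : ∀ᵐ ω, (𝓕 F : L2 d) ω = 𝓕 f ω := by
    refine ae_eq_of_integral_contDiff_smul_eq
      ((Lp.memLp _).locallyIntegrable (by norm_num)) hcont.locallyIntegrable fun g hg hgs => ?_
    let G : 𝓢(Rd d, ℂ) := (hgs.comp_left (g := Complex.ofReal) rfl).toSchwartzMap
      (Complex.ofRealCLM.contDiff.comp hg)
    have hG : ∀ t, G t = (g t : ℂ) := fun t => rfl
    have e1 := Lp.toTemperedDistribution_apply (𝓕 F : L2 d) G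
    rw [← Lp.fourier_toTemperedDistribution_eq, TemperedDistribution.fourier_apply,
      Lp.toTemperedDistribution_apply] at e1
    have e2 : ∫ t, (𝓕 G) t • F t = ∫ t, 𝓕 (G : Rd d → ℂ) t • f t :=
      integral_congr_ae (hFf.mono fun t ht => by simp only [ht, SchwartzMap.fourier_coe])
    have e3 : ∫ t, 𝓕 (G : Rd d → ℂ) t • f t = ∫ t, G t • 𝓕 f t :=
      VectorFourier.integral_fourierIntegral_smul_eq_flip (L := innerₗ (Rd d))
        Real.continuous_fourierChar continuous_inner G.integrable h1 |>.trans (by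
          simp [Real.fourier_eq, VectorFourier.fourierIntegral, real_inner_comm])
    have e4 : ∀ h : Rd d → ℂ, ∫ t, g t • h t = ∫ t, G t • h t := fun h => by
      simp only [hG, Complex.real_smul, smul_eq_mul]
    rw [e4, e4, ← e3, ← e2, e1]
  have hn := Lp.norm_fourier_eq F
  rw [Lp.norm_def, Lp.norm_def, ENNReal.toReal_eq_toReal_iff' (Lp.memLp _).2.ne (Lp.memLp _).2.ne,
    eLpNorm_congr_ae key, eLpNorm_congr_ae hFf] at hn
  have h3 : ∀ h : Rd d → ℂ, ∫⁻ t, ‖h t‖ₑ ^ 2 = eLpNorm h 2 volume ^ 2 := fun h => by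
    have := eLpNorm_nnreal_pow_eq_lintegral (f := h) (μ := volume) (p := 2) (by norm_num)
    simpa using! this.symm
  rw [h3, h3, hn]

theorem character_comm (ω t : Rd d) : character ω t = character t ω := by
  rw [character, character, real_inner_comm]

theorem character_add_right (ω s t : Rd d) :
    character ω (s + t) = character ω s * character ω t := by
  rw [character, character, character, inner_add_right, ← Complex.exp_add]
  push_cast
  ring_nf

theorem character_zero_right (ω : Rd d) : character ω 0 = 1 := by simp [character]

theorem character_neg_right (ω t : Rd d) : character ω (-t) = (character ω t)⁻¹ := by
  refine eq_inv_of_mul_eq_one_left ?_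
  rw [← character_add_right, neg_add_cancel, character_zero_right]

theorem character_sub_right (ω s t : Rd d) :
    character ω (s - t) = character ω s * (character ω t)⁻¹ := by
  rw [sub_eq_add_neg, character_add_right, character_neg_right]

theorem character_add_left (ω η t : Rd d) :
    character (ω + η) t = character ω t * character η t := by
  rw [character_comm, character_add_right, character_comm t, character_comm t]

theorem character_neg_left (ω t : Rd d) : character (-ω) t = (character ω t)⁻¹ := by
  rw [character_comm, character_neg_right, character_comm]

theorem character_sub_left (ω η t : Rd d) :
    character (ω - η) t = character ω t * (character η t)⁻¹ := by
  rw [sub_eq_add_neg, character_add_left, character_neg_left]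

theorem character_ne_zero (ω t : Rd d) : character ω t ≠ 0 := by
  rw [← norm_ne_zero_iff, norm_character]
  norm_num

/-- The time-frequency shifts form a projective representation of phase space. -/
theorem timeFreqShift_timeFreqShift (z w : Phase d) (f : L2 d) :
    timeFreqShift z (timeFreqShift w f) = character w.2 (-z.1) • timeFreqShift (z + w) f := by
  refine Lp.ext ?_
  filter_upwards [coeFn_timeFreqShift z (timeFreqShift w f), coeFn_timeFreqShift (z + w) f,
    Lp.coeFn_smul (character w.2 (-z.1)) (timeFreqShift (z + w) f),
    (measurePreserving_sub z.1).quasiMeasurePreserving.ae (coeFn_timeFreqShift w f)]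
    with t h1 h2 h3 h4
  rw [h1, h3, Pi.smul_apply, h2, h4, Prod.fst_add, Prod.snd_add, character_add_left,
    character_sub_right, character_neg_right, smul_eq_mul, sub_sub]
  ring

theorem timeFreqShift_zero (f : L2 d) : timeFreqShift 0 f = f := by
  refine Lp.ext ?_
  filter_upwards [coeFn_timeFreqShift 0 f] with t h1
  rw [h1]
  simp [character]

theorem timeFreqShift_neg_apply (z : Phase d) (f : L2 d) :
    timeFreqShift z (timeFreqShift (-z) f) = character z.2 z.1 • f := by
  rw [timeFreqShift_timeFreqShift, add_neg_cancel, timeFreqShift_zero, Prod.snd_neg,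
    character_neg_left, character_neg_right, inv_inv]

theorem adjoint_timeFreqShift (z : Phase d) (f : L2 d) :
    ContinuousLinearMap.adjoint (timeFreqShift z).toContinuousLinearMap f =
      (character z.2 z.1)⁻¹ • timeFreqShift (-z) f := by
  refine ext_inner_left ℂ fun g => ?_
  rw [ContinuousLinearMap.adjoint_inner_right]
  change inner ℂ (timeFreqShift z g) f = _
  rw [← (timeFreqShift z).inner_map_map g, map_smul, timeFreqShift_neg_apply, smul_smul,
    inv_mul_cancel₀ (character_ne_zero _ _), one_smul]

theorem adjoint_timeFreqShift_timeFreqShift (z w : Phase d) (f : L2 d) :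
    ContinuousLinearMap.adjoint (timeFreqShift z).toContinuousLinearMap (timeFreqShift w f) =
      character w.1 (w.2 - z.2) •
        ContinuousLinearMap.adjoint (timeFreqShift (z - w)).toContinuousLinearMap f := by
  rw [adjoint_timeFreqShift, adjoint_timeFreqShift, timeFreqShift_timeFreqShift, smul_smul,
    smul_smul, neg_sub, neg_add_eq_sub]
  congr 1
  simp only [Prod.fst_sub, Prod.snd_sub, Prod.fst_neg, character_sub_right, character_sub_left,
    character_neg_right, character_comm w.1]
  have := character_ne_zero z.2 z.1
  have := character_ne_zero w.2 z.1
  have := character_ne_zero w.2 w.1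
  have := character_ne_zero z.2 w.1
  field_simp

end TimeFrequencyShifts

/-! ### Moyal's identity -/

section Moyal

open FourierTransform

variable {d : ℕ}

theorem inner_timeFreqShift_left (w : Phase d) (g f : L2 d) :
    inner ℂ (timeFreqShift w g) f =
      ∫ t, f t * (conj (character w.2 t) * conj (g (t - w.1))) := by
  rw [L2.inner_def]
  refine integral_congr_ae ?_
  filter_upwards [coeFn_timeFreqShift w g] with t ht
  rw [ht, RCLike.inner_apply, map_mul]

/-- The STFT at `(x, ω)` is the Fourier transform at `ω` of `f` times the conjugate of the
translated window. -/
theorem inner_timeFreqShift_eq_fourier (w : Phase d) (g f : L2 d) :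
    inner ℂ (timeFreqShift w g) f = 𝓕 (fun t => f t * conj (g (t - w.1))) w.2 := by
  rw [inner_timeFreqShift_left, Real.fourier_eq']
  refine integral_congr_ae (Filter.Eventually.of_forall fun t => ?_)
  simp only [character, ← Complex.exp_conj, smul_eq_mul, map_mul, Complex.conj_ofReal, conj_I,
    Complex.conj_ofNat]
  rw [real_inner_comm t w.2, mul_left_comm]
  congr 2
  push_cast
  ring

theorem aestronglyMeasurable_shift (f : L2 d) (x : Rd d) :
    AEStronglyMeasurable (fun t => f (t - x)) volume :=
  (Lp.aestronglyMeasurable f).comp_measurePreserving (measurePreserving_sub x)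

theorem continuous_inner_timeFreqShift_schwartz (f h : 𝓢(Rd d, ℂ)) :
    Continuous fun w : Phase d => inner ℂ (timeFreqShift w (f.toLp 2)) (h.toLp 2) := by
  have e : ∀ w : Phase d, inner ℂ (timeFreqShift w (f.toLp 2)) (h.toLp 2) =
      ∫ t, h t * (conj (character w.2 t) * conj (f (t - w.1))) := fun w => by
    rw [inner_timeFreqShift_left]
    refine integral_congr_ae ?_
    filter_upwards [h.coeFn_toLp 2, (measurePreserving_sub w.1).quasiMeasurePreserving.ae
      (Filter.EventuallyEq.eventually (f.coeFn_toLp 2))] with t h1 h2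
    rw [h1, h2]
  simp_rw [e]
  obtain ⟨C, hC⟩ : ∃ C, ∀ t, ‖f t‖ ≤ C := ⟨_, f.norm_le_seminorm ℂ⟩
  have hchar : Continuous fun p : Rd d × Rd d => character p.1 p.2 := by
    unfold character
    fun_prop
  refine continuous_of_dominated (bound := fun t => ‖h t‖ * C) (fun w => ?_)
    (fun w => Filter.Eventually.of_forall fun t => ?_) (h.integrable.norm.mul_const _)
    (Filter.Eventually.of_forall fun t => ?_)
  · have hc : Continuous fun t => h t * (conj (character w.2 t) * conj (f (t - w.1))) := by
      have := h.continuous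
      have := f.continuous
      have := continuous_character w.2
      fun_prop
    exact hc.aestronglyMeasurable
  · rw [norm_mul, norm_mul, RCLike.norm_conj, RCLike.norm_conj, norm_character, one_mul]
    gcongr
    exact hC _
  · have := f.continuous
    fun_prop

/-- Schwartz functions are dense in `L²`. -/
theorem exists_schwartz_norm_sub_lt (f : L2 d) {ε : ℝ} (hε : 0 < ε) :
    ∃ g : 𝓢(Rd d, ℂ), ‖f - g.toLp 2 volume‖ < ε := by
  obtain ⟨g, hg⟩ := (SchwartzMap.denseRange_toLpCLM (E := Rd d) (F := ℂ) (p := 2) (μ := volume)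
    (by norm_num)).exists_dist_lt f hε
  exact ⟨g, by simpa [dist_eq_norm] using! hg⟩

/-- Weak continuity of the time-frequency shifts, by approximation from Schwartz functions. -/
theorem continuous_inner_timeFreqShift (g f : L2 d) :
    Continuous fun w : Phase d => inner ℂ (timeFreqShift w g) f := by
  refine continuous_of_uniform_approx_of_continuous fun u hu => ?_
  obtain ⟨ε, hε, hεu⟩ := Metric.mem_uniformity_dist.1 hu
  obtain ⟨g', hg'⟩ := exists_schwartz_norm_sub_lt g (ε := ε / (2 * (‖f‖ + 1))) (by positivity)
  obtain ⟨f', hf'⟩ := exists_schwartz_norm_sub_lt f (ε := ε / (2 * (‖g'.toLp 2 volume‖ + 1)))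
    (by positivity)
  refine ⟨_, continuous_inner_timeFreqShift_schwartz g' f', fun w => hεu ?_⟩
  rw [dist_eq_norm]
  have e : inner ℂ (timeFreqShift w g) f -
      inner ℂ (timeFreqShift w (g'.toLp 2 volume)) (f'.toLp 2 volume) =
      inner ℂ (timeFreqShift w (g - g'.toLp 2 volume)) f +
        inner ℂ (timeFreqShift w (g'.toLp 2 volume)) (f - f'.toLp 2 volume) := by
    rw [map_sub, inner_sub_left, inner_sub_right]
    ring
  rw [e]
  have h1 : ‖(inner ℂ (timeFreqShift w (g - g'.toLp 2 volume)) f : ℂ)‖ ≤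
      ‖g - g'.toLp 2 volume‖ * ‖f‖ :=
    (norm_inner_le_norm _ _).trans_eq (by rw [LinearIsometry.norm_map])
  have h2 : ‖(inner ℂ (timeFreqShift w (g'.toLp 2 volume)) (f - f'.toLp 2 volume) : ℂ)‖ ≤
      ‖g'.toLp 2 volume‖ * ‖f - f'.toLp 2 volume‖ :=
    (norm_inner_le_norm _ _).trans_eq (by rw [LinearIsometry.norm_map])
  rw [lt_div_iff₀ (by positivity)] at hg' hf'
  refine (norm_add_le _ _).trans_lt ?_
  nlinarith [norm_nonneg (g - g'.toLp 2 volume), norm_nonneg (f - f'.toLp 2 volume)]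

/-- Strong continuity follows from weak continuity because the operators are isometries. -/
theorem continuous_timeFreqShift (f : L2 d) : Continuous fun w : Phase d => timeFreqShift w f := by
  rw [continuous_iff_continuousAt]
  intro w₀
  have e : ∀ w, ‖timeFreqShift w f - timeFreqShift w₀ f‖ ^ 2 =
      2 * ‖f‖ ^ 2 - 2 * RCLike.re (inner ℂ (timeFreqShift w f) (timeFreqShift w₀ f)) := fun w => by
    rw [norm_sub_sq (𝕜 := ℂ), LinearIsometry.norm_map, LinearIsometry.norm_map]
    ring
  have h0 : Filter.Tendsto (fun w => ‖timeFreqShift w f - timeFreqShift w₀ f‖ ^ 2) (nhds w₀)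
      (nhds 0) := by
    simp_rw [e]
    have h1 : Continuous fun w : Phase d =>
        2 * ‖f‖ ^ 2 - 2 * RCLike.re (inner ℂ (timeFreqShift w f) (timeFreqShift w₀ f)) :=
      continuous_const.sub (continuous_const.mul
        (RCLike.continuous_re.comp (continuous_inner_timeFreqShift f (timeFreqShift w₀ f))))
    have h2 := h1.tendsto w₀
    rw [inner_self_eq_norm_sq, LinearIsometry.norm_map, sub_self] at h2
    exact h2
  rw [ContinuousAt, tendsto_iff_norm_sub_tendsto_zero]
  have := (Real.continuous_sqrt.tendsto 0).comp h0
  simpa [Function.comp_def, Real.sqrt_sq] using this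

theorem lintegral_enorm_sq_L2 (f : L2 d) : ∫⁻ t, ‖f t‖ₑ ^ 2 = ‖f‖ₑ ^ 2 := by
  have := eLpNorm_nnreal_pow_eq_lintegral (f := f) (μ := volume) (p := 2) (by norm_num)
  rw [Lp.enorm_def]
  simpa using! this.symm

/-- The norm form of Moyal's identity. -/
theorem lintegral_enorm_inner_timeFreqShift (g f : L2 d) :
    ∫⁻ w : Phase d, ‖(inner ℂ (timeFreqShift w g) f : ℂ)‖ₑ ^ 2 = ‖g‖ₑ ^ 2 * ‖f‖ₑ ^ 2 := by
  have hm : AEMeasurable (fun p : Rd d × Rd d => ‖f p.2‖ₑ ^ 2 * ‖g (p.2 - p.1)‖ₑ ^ 2)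
      (volume.prod volume) := by
    have hf : AEStronglyMeasurable (fun p : Rd d × Rd d => f p.2) (volume.prod volume) :=
      (Lp.aestronglyMeasurable f).comp_snd
    have hg : AEStronglyMeasurable (fun p : Rd d × Rd d => g (p.2 - p.1)) (volume.prod volume) :=
      (Lp.aestronglyMeasurable g).comp_quasiMeasurePreserving
        ((quasiMeasurePreserving_sub volume volume).comp
          Measure.measurePreserving_swap.quasiMeasurePreserving)
    exact (hf.enorm.pow_const 2).mul (hg.enorm.pow_const 2)
  -- After Plancherel in `ω` this is what remains of the integral over phase space.
  have hI : ∫⁻ x : Rd d, ∫⁻ t : Rd d, ‖f t‖ₑ ^ 2 * ‖g (t - x)‖ₑ ^ 2 = ‖g‖ₑ ^ 2 * ‖f‖ₑ ^ 2 := by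
    rw [lintegral_lintegral_swap hm]
    have : ∀ t : Rd d, ∫⁻ x : Rd d, ‖f t‖ₑ ^ 2 * ‖g (t - x)‖ₑ ^ 2 = ‖f t‖ₑ ^ 2 * ‖g‖ₑ ^ 2 :=
      fun t => by
        rw [lintegral_const_mul' _ _ (by finiteness),
          lintegral_sub_left_eq_self (fun x => ‖g x‖ₑ ^ 2) t, lintegral_enorm_sq_L2]
    simp_rw [this]
    rw [lintegral_mul_const' _ _ (by finiteness), lintegral_enorm_sq_L2, mul_comm]
  have hfin : ∀ᵐ x : Rd d, ∫⁻ t : Rd d, ‖f t‖ₑ ^ 2 * ‖g (t - x)‖ₑ ^ 2 < ∞ :=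
    ae_lt_top' hm.lintegral_prod_right' (hI.trans_ne (by finiteness))
  rw [← hI, Measure.volume_eq_prod, lintegral_prod _
    ((continuous_inner_timeFreqShift g f).enorm.measurable.pow_const 2).aemeasurable]
  refine lintegral_congr_ae ?_
  filter_upwards [hfin] with x hx
  have hmeas : AEStronglyMeasurable (fun t => f t * conj (g (t - x))) volume :=
    (Lp.aestronglyMeasurable f).mul
      (Complex.continuous_conj.comp_aestronglyMeasurable (aestronglyMeasurable_shift g x))
  have h1 : Integrable (fun t => f t * conj (g (t - x))) := by
    refine (Lp.memLp f).integrable_mul (q := 2) ?_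
    exact ((Lp.memLp g).comp_measurePreserving (measurePreserving_sub x)).star
  have hsq : ∀ t, ‖f t * conj (g (t - x))‖ₑ ^ 2 = ‖f t‖ₑ ^ 2 * ‖g (t - x)‖ₑ ^ 2 := fun t => by
    rw [enorm_mul, mul_pow, RCLike.enorm_conj]
  have h2 : MemLp (fun t => f t * conj (g (t - x))) 2 volume := by
    refine ⟨hmeas, ?_⟩
    have := eLpNorm_nnreal_pow_eq_lintegral (f := fun t => f t * conj (g (t - x)))
      (μ := volume) (p := 2) (by norm_num)
    simp only [NNReal.coe_ofNat, ENNReal.coe_ofNat, ENNReal.rpow_ofNat, hsq] at this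
    rw [← this] at hx
    exact (ENNReal.pow_lt_top_iff.1 hx).resolve_right (by norm_num)
  simp only [inner_timeFreqShift_eq_fourier]
  rw [lintegral_enorm_sq_fourier h1 h2]
  simp_rw [hsq]

theorem memLp_inner_timeFreqShift (g f : L2 d) :
    MemLp (fun w : Phase d => (inner ℂ (timeFreqShift w g) f : ℂ)) 2 volume := by
  refine ⟨(continuous_inner_timeFreqShift g f).aestronglyMeasurable, ?_⟩
  have h := eLpNorm_nnreal_pow_eq_lintegral
    (f := fun w : Phase d => (inner ℂ (timeFreqShift w g) f : ℂ)) (μ := volume) (p := 2)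
    (by norm_num)
  simp only [NNReal.coe_ofNat, ENNReal.coe_ofNat, ENNReal.rpow_ofNat,
    lintegral_enorm_inner_timeFreqShift] at h
  refine (ENNReal.pow_lt_top_iff.1 (h.trans_lt ?_)).resolve_right (by norm_num)
  finiteness

theorem memLp_inner_timeFreqShift_right (g f : L2 d) :
    MemLp (fun w : Phase d => (inner ℂ f (timeFreqShift w g) : ℂ)) 2 volume := by
  have h := (memLp_inner_timeFreqShift g f).star
  refine h.ae_eq (Filter.Eventually.of_forall fun w => ?_)
  exact inner_conj_symm _ _

theorem integrable_inner_mul_inner (b a g h : L2 d) :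
    Integrable fun w : Phase d =>
      (inner ℂ b (timeFreqShift w g) * inner ℂ (timeFreqShift w h) a : ℂ) :=
  (memLp_inner_timeFreqShift_right g b).integrable_mul (memLp_inner_timeFreqShift h a)

/-- A sesquilinear form on a complex vector space that vanishes on the diagonal is zero. -/
theorem sesquilinear_eq_zero {E : Type*} [AddCommGroup E] [Module ℂ E] {B : E → E → ℂ}
    (hl : ∀ x x' y, B (x + x') y = B x y + B x' y) (hr : ∀ x y y', B x (y + y') = B x y + B x y')
    (hls : ∀ (c : ℂ) x y, B (c • x) y = conj c * B x y)
    (hrs : ∀ (c : ℂ) x y, B x (c • y) = c * B x y) (h : ∀ x, B x x = 0) (x y : E) :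
    B x y = 0 := by
  have h1 := h (x + y)
  have h2 := h (x + I • y)
  rw [hl, hr, hr, h, h] at h1
  rw [hl, hr, hr, h, h, hls, hrs, conj_I] at h2
  linear_combination (1 / 2 : ℂ) * h1 - (I / 2) * h2 + (B x y - B y x) / 2 * Complex.I_sq

theorem integral_inner_mul_inner_diag (a g : L2 d) :
    ∫ w : Phase d, (inner ℂ a (timeFreqShift w g) * inner ℂ (timeFreqShift w g) a : ℂ) =
      inner ℂ a a * inner ℂ g g := by
  have e : ∀ w : Phase d, (inner ℂ a (timeFreqShift w g) * inner ℂ (timeFreqShift w g) a : ℂ) =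
      ((‖(inner ℂ (timeFreqShift w g) a : ℂ)‖ ^ 2 : ℝ) : ℂ) := fun w => by
    rw [← inner_conj_symm, Complex.conj_mul']
    push_cast
    rfl
  simp_rw [e]
  have hc : Continuous fun w : Phase d => ‖(inner ℂ (timeFreqShift w g) a : ℂ)‖ ^ 2 :=
    (continuous_inner_timeFreqShift g a).norm.pow 2
  rw [integral_complex_ofReal, integral_eq_lintegral_of_nonneg_ae
    (Filter.Eventually.of_forall fun _ => by positivity) hc.aestronglyMeasurable]
  have e2 : ∀ w : Phase d, ENNReal.ofReal (‖(inner ℂ (timeFreqShift w g) a : ℂ)‖ ^ 2) =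
      ‖(inner ℂ (timeFreqShift w g) a : ℂ)‖ₑ ^ 2 := fun w => by
    rw [ENNReal.ofReal_pow (norm_nonneg _), ofReal_norm]
  simp_rw [e2]
  rw [lintegral_enorm_inner_timeFreqShift, inner_self_eq_norm_sq_to_K, inner_self_eq_norm_sq_to_K,
    ENNReal.toReal_mul, ENNReal.toReal_pow, ENNReal.toReal_pow, toReal_enorm, toReal_enorm]
  push_cast
  exact mul_comm _ _

/-- Moyal's identity, obtained from its norm form by polarisation in both pairs of arguments. -/
theorem integral_inner_mul_inner (b a g h : L2 d) :
    ∫ w : Phase d, (inner ℂ b (timeFreqShift w g) * inner ℂ (timeFreqShift w h) a : ℂ) =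
      inner ℂ b a * inner ℂ h g := by
  have h1 : ∀ g b a : L2 d,
      (∫ w : Phase d, (inner ℂ b (timeFreqShift w g) * inner ℂ (timeFreqShift w g) a : ℂ)) -
        inner ℂ b a * inner ℂ g g = 0 := fun g => by
    refine sesquilinear_eq_zero (fun x x' y => ?_) (fun x y y' => ?_) (fun c x y => ?_)
      (fun c x y => ?_) (fun x => ?_)
    · simp only [inner_add_left, add_mul]
      rw [integral_add (integrable_inner_mul_inner _ _ _ _) (integrable_inner_mul_inner _ _ _ _)]
      ring
    · simp only [inner_add_right, mul_add, add_mul]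
      rw [integral_add (integrable_inner_mul_inner _ _ _ _) (integrable_inner_mul_inner _ _ _ _)]
      ring
    · simp only [inner_smul_left, mul_assoc]
      rw [integral_const_mul]
      ring
    · simp only [inner_smul_right, mul_left_comm _ c]
      rw [integral_const_mul]
      ring
    · rw [integral_inner_mul_inner_diag, sub_self]
  refine sub_eq_zero.1 (sesquilinear_eq_zero (B := fun h g : L2 d =>
    (∫ w : Phase d, (inner ℂ b (timeFreqShift w g) * inner ℂ (timeFreqShift w h) a : ℂ)) -
        inner ℂ b a * inner ℂ h g) (fun x x' y => ?_) (fun x y y' => ?_) (fun c x y => ?_)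
      (fun c x y => ?_) (fun x => h1 x b a) h g)
  · simp only [map_add, inner_add_left, mul_add]
    rw [integral_add (integrable_inner_mul_inner _ _ _ _) (integrable_inner_mul_inner _ _ _ _)]
    ring
  · simp only [map_add, inner_add_right, mul_add, add_mul]
    rw [integral_add (integrable_inner_mul_inner _ _ _ _) (integrable_inner_mul_inner _ _ _ _)]
    ring
  · simp only [map_smul, inner_smul_left, mul_left_comm _ (conj c)]
    rw [integral_const_mul]
    ring
  · simp only [map_smul, inner_smul_right, mul_left_comm _ c, mul_assoc]
    rw [integral_const_mul]
    ring

/-- Cauchy–Schwarz and Moyal's identity bound the `L¹` norm of a product of two STFTs. -/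
theorem integral_norm_inner_mul_inner_le (b a g h : L2 d) :
    ∫ w : Phase d, ‖(inner ℂ b (timeFreqShift w g) * inner ℂ (timeFreqShift w h) a : ℂ)‖ ≤
      ‖b‖ * ‖g‖ * (‖a‖ * ‖h‖) := by
  have hsq : ∀ g f : L2 d, (∫ w : Phase d, ‖(inner ℂ (timeFreqShift w g) f : ℂ)‖ ^ (2 : ℝ)) ^
      (1 / (2 : ℝ)) = ‖f‖ * ‖g‖ := fun g f => by
    have h := integral_inner_mul_inner_diag f g
    have e : ∀ w : Phase d, (inner ℂ f (timeFreqShift w g) * inner ℂ (timeFreqShift w g) f : ℂ) =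
        ((‖(inner ℂ (timeFreqShift w g) f : ℂ)‖ ^ 2 : ℝ) : ℂ) := fun w => by
      rw [← inner_conj_symm, Complex.conj_mul']
      push_cast
      rfl
    simp_rw [e] at h
    rw [integral_complex_ofReal, inner_self_eq_norm_sq_to_K, inner_self_eq_norm_sq_to_K] at h
    have h' : ∫ w : Phase d, ‖(inner ℂ (timeFreqShift w g) f : ℂ)‖ ^ 2 =
        (‖f‖ * ‖g‖) ^ 2 := by
      rw [mul_pow]
      refine Complex.ofReal_injective (h.trans ?_)
      push_cast
      rfl
    simp only [Real.rpow_ofNat]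
    rw [h', ← Real.sqrt_eq_rpow, Real.sqrt_sq (by positivity)]
  have := integral_mul_norm_le_Lp_mul_Lq (μ := (volume : Measure (Phase d)))
    (f := fun w : Phase d => (inner ℂ b (timeFreqShift w g) : ℂ))
    (g := fun w : Phase d => (inner ℂ (timeFreqShift w h) a : ℂ)) Real.HolderConjugate.two_two
    (by simpa using memLp_inner_timeFreqShift_right g b)
    (by simpa using memLp_inner_timeFreqShift h a)
  simp only [norm_mul]
  refine this.trans_eq ?_
  simp_rw [norm_inner_symm b]
  rw [hsq, hsq]

end Moyal

/-! ### Minkowski, Young and Hölder inequalities for mixed norms -/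

section MixedNormInequalities

variable {X W : Type*} [MeasurableSpace X] [MeasurableSpace W] {μ : Measure X} {ν : Measure W}

theorem eLpNorm_const_mul_ennreal {p : ℝ≥0∞} (hp : 1 ≤ p) (c : ℝ≥0∞) {f : X → ℝ≥0∞}
    (hf : Measurable f) : eLpNorm (fun x => c * f x) p μ = c * eLpNorm f p μ := by
  have hp0 : p ≠ 0 := (zero_lt_one.trans_le hp).ne'
  rcases eq_or_ne p ∞ with rfl | hpt
  · simp only [eLpNorm_exponent_top, eLpNormEssSup, enorm_eq_self]
    exact ENNReal.essSup_const_mul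
  · have hr : 0 < p.toReal := ENNReal.toReal_pos hp0 hpt
    simp only [eLpNorm_eq_lintegral_rpow_enorm_toReal hp0 hpt, enorm_eq_self,
      ENNReal.mul_rpow_of_nonneg _ _ hr.le]
    rw [lintegral_const_mul _ (hf.pow_const _), ENNReal.mul_rpow_of_nonneg _ _ (by positivity),
      ← ENNReal.rpow_mul, mul_one_div_cancel hr.ne', ENNReal.rpow_one]

/-- Measurable dependence of the `L^p` norm of a section on the parameter. -/
theorem measurable_eLpNorm_section [SFinite μ] {p : ℝ≥0∞} {F : W → X → ℝ≥0∞}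
    (hF : Measurable (Function.uncurry F)) : Measurable fun w => eLpNorm (F w) p μ := by
  rcases eq_or_ne p 0 with rfl | hp0
  · simp
  rcases eq_or_ne p ∞ with rfl | hpt
  · simp only [eLpNorm_exponent_top, eLpNormEssSup, enorm_eq_self]
    refine measurable_of_Iic fun a => ?_
    have : (fun w => essSup (fun x => F w x) μ) ⁻¹' Set.Iic a =
        {w | μ (Prod.mk w ⁻¹' {y : W × X | a < Function.uncurry F y}) = 0} := by
      ext w
      simp only [Set.mem_preimage, Set.mem_Iic, Set.mem_ofPred_eq]
      constructor
      · intro h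
        have := ae_le_essSup (μ := μ) (f := fun x => F w x)
        rw [← nonpos_iff_eq_zero, ← ae_iff.1 (this.mono fun x hx => hx.trans h)]
        refine measure_mono fun x hx => ?_
        simpa using hx
      · intro h
        refine essSup_le_of_ae_le a ?_
        refine ae_iff.2 ?_
        rw [← h]
        congr 1
        ext x
        simp
    rw [this]
    exact measurable_measure_prodMk_left (measurableSet_lt measurable_const hF)
      (measurableSet_singleton 0)
  · simp only [eLpNorm_eq_lintegral_rpow_enorm_toReal hp0 hpt, enorm_eq_self]
    exact (Measurable.lintegral_prod_right' (f := fun y : W × X => F y.1 y.2 ^ p.toReal)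
      (hF.pow_const _)).pow_const _

/-- Minkowski's integral inequality for exponents `1 < p < ∞`. The function on the left is
truncated, so that Hölder's inequality can be divided by a finite power of its norm. -/
theorem lintegral_rpow_lintegral_le [SigmaFinite μ] [SFinite ν] {p r : ℝ}
    (hpr : p.HolderConjugate r) {F : X → W → ℝ≥0∞} (hF : Measurable (Function.uncurry F)) :
    ∫⁻ x, (∫⁻ w, F x w ∂ν) ^ p ∂μ ≤ (∫⁻ w, (∫⁻ x, F x w ^ p ∂μ) ^ (1 / p) ∂ν) ^ p := by
  set M := ∫⁻ w, (∫⁻ x, F x w ^ p ∂μ) ^ (1 / p) ∂ν with hM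
  set h : X → ℝ≥0∞ := fun x => ∫⁻ w, F x w ∂ν with hh
  have hp := hpr.pos
  have hhm : Measurable h := Measurable.lintegral_prod_right' hF
  let k : ℕ → X → ℝ≥0∞ := fun n => (spanningSets μ n).indicator fun x => min (h x) n
  have hkm : ∀ n, Measurable (k n) := fun n =>
    (hhm.min measurable_const).indicator (measurableSet_spanningSets μ n)
  have hkh : ∀ n x, k n x ≤ h x := fun n x =>
    Set.indicator_le (fun x _ => min_le_left _ _) x
  have hA : ∀ n, ∫⁻ x, k n x ^ p ∂μ ≤ M ^ p := by
    intro n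
    set A := ∫⁻ x, k n x ^ p ∂μ with hAdef
    have hAfin : A ≠ ∞ := by
      have hle : A ≤ ∫⁻ x, (spanningSets μ n).indicator (fun _ => (n : ℝ≥0∞) ^ p) x ∂μ := by
        refine lintegral_mono fun x => ?_
        by_cases hx : x ∈ spanningSets μ n
        · simp only [k, Set.indicator_of_mem hx]
          exact ENNReal.rpow_le_rpow (min_le_right _ _) hp.le
        · simp [k, Set.indicator_of_notMem hx, hp]
      refine (hle.trans_lt ?_).ne
      rw [lintegral_indicator (measurableSet_spanningSets μ n), lintegral_const,
        Measure.restrict_apply_univ]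
      exact ENNReal.mul_lt_top (ENNReal.rpow_lt_top_of_nonneg hp.le (ENNReal.natCast_ne_top n))
        (measure_spanningSets_lt_top μ n)
    -- Split off one factor `k n ≤ h`, exchange the integrals and use Hölder in `x`.
    have h1 : A ≤ A ^ (1 / r) * M := by
      calc A = ∫⁻ x, k n x ^ (p - 1) * k n x ∂μ := by
            refine lintegral_congr fun x => ?_
            nth_rewrite 3 [← ENNReal.rpow_one (k n x)]
            rw [← ENNReal.rpow_add_of_nonneg _ _ hpr.sub_one_pos.le zero_le_one, sub_add_cancel]
        _ ≤ ∫⁻ x, k n x ^ (p - 1) * h x ∂μ := by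
            gcongr
            exact hkh n _
        _ = ∫⁻ x, ∫⁻ w, k n x ^ (p - 1) * F x w ∂ν ∂μ := by
            refine lintegral_congr fun x => ?_
            exact (lintegral_const_mul _ (hF.comp measurable_prodMk_left)).symm
        _ = ∫⁻ w, ∫⁻ x, k n x ^ (p - 1) * F x w ∂μ ∂ν := by
            refine lintegral_lintegral_swap ?_
            exact ((((hkm n).comp measurable_fst).pow_const _).mul hF).aemeasurable
        _ ≤ ∫⁻ w, A ^ (1 / r) * (∫⁻ x, F x w ^ p ∂μ) ^ (1 / p) ∂ν := by
            refine lintegral_mono fun w => ?_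
            refine (ENNReal.lintegral_mul_le_Lp_mul_Lq μ hpr.symm
              ((hkm n).pow_const (p - 1)).aemeasurable
              (hF.comp measurable_prodMk_right).aemeasurable).trans_eq ?_
            congr 2
            refine lintegral_congr fun x => ?_
            rw [← ENNReal.rpow_mul, hpr.sub_one_mul_conj]
        _ = A ^ (1 / r) * M := by
            rw [lintegral_const_mul' _ _ (ENNReal.rpow_ne_top_of_nonneg (by
              have := hpr.symm.pos
              positivity) hAfin)]
    rcases eq_or_ne A 0 with h0 | h0
    · rw [h0]
      exact zero_le
    have h2 : A ^ (1 / p) ≤ M := by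
      have h3 : A = A ^ (1 / r) * A ^ (1 / p) := by
        rw [← ENNReal.rpow_add _ _ h0 hAfin, add_comm, one_div, one_div, hpr.inv_add_inv_eq_one,
          ENNReal.rpow_one]
      have hpos : A ^ (1 / r) ≠ 0 := (ENNReal.rpow_pos (pos_iff_ne_zero.2 h0) hAfin).ne'
      have hfin : A ^ (1 / r) ≠ ∞ := ENNReal.rpow_ne_top_of_nonneg (by
        have := hpr.symm.pos
        positivity) hAfin
      exact (ENNReal.mul_le_mul_iff_right hpos hfin).1 (h3.symm.trans_le h1)
    calc A = (A ^ (1 / p)) ^ p := by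
          rw [← ENNReal.rpow_mul, one_div_mul_cancel hp.ne', ENNReal.rpow_one]
      _ ≤ M ^ p := ENNReal.rpow_le_rpow h2 hp.le
  -- The truncations increase to `h`; Fatou removes them.
  have hlim : ∀ x, Filter.Tendsto (fun n => k n x ^ p) Filter.atTop (nhds (h x ^ p)) := by
    intro x
    have h1 : Filter.Tendsto (fun n : ℕ => min (h x) (n : ℝ≥0∞)) Filter.atTop (nhds (h x)) := by
      have := (tendsto_const_nhds (x := h x)).min ENNReal.tendsto_nat_nhds_top
      rwa [min_top_right] at this
    refine (ENNReal.continuous_rpow_const.tendsto _).comp (h1.congr' ?_)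
    filter_upwards [Filter.eventually_ge_atTop (spanningSetsIndex μ x)] with n hn
    have hx : x ∈ spanningSets μ n :=
      monotone_spanningSets μ hn (mem_spanningSetsIndex μ x)
    simp only [k, Set.indicator_of_mem hx]
  calc ∫⁻ x, h x ^ p ∂μ = ∫⁻ x, Filter.liminf (fun n => k n x ^ p) Filter.atTop ∂μ :=
        lintegral_congr fun x => ((hlim x).liminf_eq).symm
    _ ≤ Filter.liminf (fun n => ∫⁻ x, k n x ^ p ∂μ) Filter.atTop :=
        lintegral_liminf_le fun n => (hkm n).pow_const _
    _ ≤ M ^ p := Filter.liminf_le_of_le ⟨0, Filter.Eventually.of_forall fun _ => zero_le⟩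
        fun b hb => by
          obtain ⟨n, hn⟩ := hb.exists
          exact hn.trans (hA n)

/-- Minkowski's integral inequality. -/
theorem eLpNorm_lintegral_le [SigmaFinite μ] [SFinite ν] {p : ℝ≥0∞} (hp : 1 ≤ p)
    {F : X → W → ℝ≥0∞} (hF : Measurable (Function.uncurry F)) :
    eLpNorm (fun x => ∫⁻ w, F x w ∂ν) p μ ≤ ∫⁻ w, eLpNorm (fun x => F x w) p μ ∂ν := by
  have hp0 : p ≠ 0 := (zero_lt_one.trans_le hp).ne'
  have hF' : Measurable (Function.uncurry fun w x => F x w) := hF.comp measurable_swap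
  rcases eq_or_ne p ∞ with rfl | hpt
  · have hm := measurable_eLpNorm_section (μ := μ) (p := ∞) hF'
    have h1 : ∀ᵐ w ∂ν, ∀ᵐ x ∂μ, F x w ≤ eLpNorm (fun x => F x w) ∞ μ := by
      refine Filter.Eventually.of_forall fun w => ?_
      simpa [eLpNorm_exponent_top, eLpNormEssSup] using!
        ae_le_essSup (μ := μ) (f := fun x => F x w)
    have h2 : ∀ᵐ x ∂μ, ∀ᵐ w ∂ν, F x w ≤ eLpNorm (fun x => F x w) ∞ μ :=
      (Measure.ae_ae_comm (p := fun x w => F x w ≤ eLpNorm (fun x => F x w) ∞ μ)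
        (measurableSet_le hF (hm.comp measurable_snd))).2 h1
    rw [eLpNorm_exponent_top, eLpNormEssSup]
    refine essSup_le_of_ae_le _ ?_
    filter_upwards [h2] with x hx
    exact lintegral_mono_ae hx
  rcases eq_or_ne p 1 with rfl | hp1
  · simp only [eLpNorm_one_eq_lintegral_enorm, enorm_eq_self]
    exact (lintegral_lintegral_swap hF.aemeasurable).le
  · have hpr : (p.toReal).HolderConjugate (p.toReal.conjExponent) :=
      Real.HolderConjugate.conjExponent (by
        rw [← ENNReal.toReal_one]
        exact (ENNReal.toReal_lt_toReal ENNReal.one_ne_top hpt).2 (lt_of_le_of_ne hp hp1.symm))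
    simp only [eLpNorm_eq_lintegral_rpow_enorm_toReal hp0 hpt, enorm_eq_self]
    rw [one_div, ENNReal.rpow_inv_le_iff hpr.pos, ← one_div]
    exact lintegral_rpow_lintegral_le hpr hF

/-- Hölder's inequality against a function `ρ ≤ 1`, with a constant that does not depend on the
exponent. -/
theorem lintegral_mul_le_of_le_one {p : ℝ≥0∞} (hp : 1 ≤ p) {g ρ : X → ℝ≥0∞} (hg : Measurable g)
    (hρ : Measurable ρ) (hρ1 : ∀ x, ρ x ≤ 1) :
    ∫⁻ x, g x * ρ x ∂μ ≤ eLpNorm g p μ * (1 + ∫⁻ x, ρ x ∂μ) := by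
  have hp0 : p ≠ 0 := (zero_lt_one.trans_le hp).ne'
  rcases eq_or_ne p ∞ with rfl | hpt
  · have h1 : ∀ᵐ x ∂μ, g x ≤ eLpNorm g ∞ μ := by
      simpa [eLpNorm_exponent_top, eLpNormEssSup] using! ae_le_essSup (μ := μ) (f := g)
    calc ∫⁻ x, g x * ρ x ∂μ ≤ ∫⁻ x, eLpNorm g ∞ μ * ρ x ∂μ :=
          lintegral_mono_ae (h1.mono fun x hx => by gcongr)
      _ = eLpNorm g ∞ μ * ∫⁻ x, ρ x ∂μ := lintegral_const_mul _ hρ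
      _ ≤ _ := by gcongr; exact le_add_self
  rcases eq_or_ne p 1 with rfl | hp1
  · rw [eLpNorm_one_eq_lintegral_enorm]
    simp only [enorm_eq_self]
    calc ∫⁻ x, g x * ρ x ∂μ ≤ ∫⁻ x, g x * 1 ∂μ := by gcongr; exact hρ1 _
      _ = (∫⁻ x, g x ∂μ) * 1 := by simp
      _ ≤ _ := by gcongr; exact le_self_add
  · have hpr : (p.toReal).HolderConjugate (p.toReal.conjExponent) :=
      Real.HolderConjugate.conjExponent (by
        rw [← ENNReal.toReal_one]
        exact (ENNReal.toReal_lt_toReal ENNReal.one_ne_top hpt).2 (lt_of_le_of_ne hp hp1.symm))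
    have h := ENNReal.lintegral_mul_le_Lp_mul_Lq μ hpr hg.aemeasurable hρ.aemeasurable
    rw [eLpNorm_eq_lintegral_rpow_enorm_toReal hp0 hpt]
    simp only [enorm_eq_self]
    refine h.trans ?_
    gcongr
    have hr := hpr.symm.lt
    calc (∫⁻ x, ρ x ^ p.toReal.conjExponent ∂μ) ^ (1 / p.toReal.conjExponent) ≤
          (1 + ∫⁻ x, ρ x ∂μ) ^ (1 / p.toReal.conjExponent) := by
          gcongr
          refine le_trans (lintegral_mono fun x => ?_) le_add_self
          simpa using ENNReal.rpow_le_rpow_of_exponent_ge (hρ1 x) hr.le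
      _ ≤ (1 + ∫⁻ x, ρ x ∂μ) ^ (1 : ℝ) := by
          refine ENNReal.rpow_le_rpow_of_exponent_le le_self_add ?_
          rw [div_le_one (by linarith)]
          exact hr.le
      _ = _ := ENNReal.rpow_one _

variable {d : ℕ} {p q : ℝ≥0∞}

/-- Minkowski's integral inequality for the mixed norm, by applying it to each of the two norms. -/
theorem mixedNorm_lintegral_le [SFinite ν] (hp : 1 ≤ p) (hq : 1 ≤ q) {F : Phase d → W → ℝ≥0∞}
    (hF : Measurable (Function.uncurry F)) :
    mixedNorm p q (fun z => ∫⁻ w, F z w ∂ν) ≤ ∫⁻ w, mixedNorm p q (fun z => F z w) ∂ν := by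
  have h1 : Measurable (Function.uncurry fun (ω : Rd d) (w : W) =>
      eLpNorm (fun x : Rd d => F (x, ω) w) p volume) := by
    refine measurable_eLpNorm_section (W := Rd d × W) (F := fun y x => F (x, y.1) y.2) ?_
    exact hF.comp (f := fun y : (Rd d × W) × Rd d => ((y.2, y.1.1), y.1.2)) (by fun_prop)
  refine le_trans (eLpNorm_mono_enorm fun ω => ?_) (eLpNorm_lintegral_le hq h1)
  exact eLpNorm_lintegral_le hp (hF.comp (f := fun y : Rd d × W => ((y.1, ω), y.2)) (by fun_prop))

theorem mixedNorm_const_mul (hp : 1 ≤ p) (hq : 1 ≤ q) (c : ℝ≥0∞) {g : Phase d → ℝ≥0∞}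
    (hg : Measurable g) : mixedNorm p q (fun z => c * g z) = c * mixedNorm p q g := by
  unfold mixedNorm
  rw [← eLpNorm_const_mul_ennreal hq c (measurable_inner_norm hg)]
  congr 1
  funext ω
  exact eLpNorm_const_mul_ennreal hp c (hg.comp measurable_prodMk_right)

theorem mixedNorm_comp_sub {g : Phase d → ℝ≥0∞} (hg : Measurable g) (w : Phase d) :
    mixedNorm p q (fun z => g (z - w)) = mixedNorm p q g := by
  unfold mixedNorm
  rw [← eLpNorm_comp_measurePreserving (measurable_inner_norm hg).aestronglyMeasurable
    (measurePreserving_sub w.2)]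
  congr 1
  funext ω
  exact eLpNorm_comp_measurePreserving (f := fun x : Rd d => x - w.1)
    (g := fun x : Rd d => g (x, ω - w.2))
    (hg.comp measurable_prodMk_right).aestronglyMeasurable (measurePreserving_sub w.1)

instance isAddHaarMeasure_volume_phase : (volume : Measure (Phase d)).IsAddHaarMeasure :=
  inferInstanceAs (Measure.IsAddHaarMeasure
    ((volume : Measure (Rd d)).prod (volume : Measure (Rd d))))

instance isNegInvariant_volume_phase : (volume : Measure (Phase d)).IsNegInvariant :=
  Measure.IsAddHaarMeasure.isNegInvariant_of_regular _

theorem lintegral_sub_swap (f g : Phase d → ℝ≥0∞) (z : Phase d) :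
    ∫⁻ w, f (z - w) * g w = ∫⁻ w, f w * g (z - w) := by
  rw [← lintegral_sub_left_eq_self (fun w => f w * g (z - w)) z]
  simp

theorem quasiMeasurePreserving_const_sub (z : Phase d) :
    Measure.QuasiMeasurePreserving (fun w : Phase d => z - w) volume volume :=
  (Measure.measurePreserving_sub_left volume z).quasiMeasurePreserving

/-- Young's inequality for mixed norms, deduced from Minkowski's integral inequality and the
translation invariance of the mixed norm. -/
theorem mixedNorm_convolution_le (hp : 1 ≤ p) (hq : 1 ≤ q) {f g : Phase d → ℝ≥0∞}
    (hf : AEMeasurable f) (hg : AEMeasurable g) :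
    mixedNorm p q (fun z => ∫⁻ w, f (z - w) * g w) ≤ (∫⁻ z, f z) * mixedNorm p q g := by
  have e : ∀ z, ∫⁻ w, f (z - w) * g w = ∫⁻ w, hf.mk f w * hg.mk g (z - w) := fun z => by
    rw [← lintegral_sub_swap]
    refine lintegral_congr_ae ?_
    filter_upwards [hg.ae_eq_mk, (quasiMeasurePreserving_const_sub z).ae hf.ae_eq_mk] with w h1 h2
    rw [h1, h2]
  simp_rw [e]
  rw [lintegral_congr_ae hf.ae_eq_mk, mixedNorm_congr_ae hg.ae_eq_mk]
  have hf' := hf.measurable_mk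
  have hg' := hg.measurable_mk
  refine (mixedNorm_lintegral_le (F := fun z w => hf.mk f w * hg.mk g (z - w)) hp hq ?_).trans_eq ?_
  · exact (hf'.comp measurable_snd).mul (hg'.comp (measurable_fst.sub measurable_snd))
  · rw [← lintegral_mul_const _ hf']
    refine lintegral_congr fun w => ?_
    rw [mixedNorm_const_mul hp hq _ (g := fun z => hg.mk g (z - w))
      (hg'.comp (measurable_id.sub_const w)), mixedNorm_comp_sub hg' w]

/-- Hölder's inequality for the mixed norm, against a product of two functions bounded by `1`. -/
theorem lintegral_mul_le_mixedNorm (hp : 1 ≤ p) (hq : 1 ≤ q) {g : Phase d → ℝ≥0∞}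
    (hg : AEMeasurable g) {ρ : Rd d → ℝ≥0∞} (hρ : Measurable ρ) (hρ1 : ∀ x, ρ x ≤ 1) :
    ∫⁻ z, g z * (ρ z.1 * ρ z.2) ≤ mixedNorm p q g * (1 + ∫⁻ x, ρ x) ^ 2 := by
  have e : ∫⁻ z, g z * (ρ z.1 * ρ z.2) = ∫⁻ z, hg.mk g z * (ρ z.1 * ρ z.2) :=
    lintegral_congr_ae (hg.ae_eq_mk.mono fun z hz => by simp only [hz])
  rw [e, mixedNorm_congr_ae hg.ae_eq_mk]
  have hg' := hg.measurable_mk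
  set k := hg.mk g
  rw [Measure.volume_eq_prod, lintegral_prod_symm _ (by fun_prop), sq, ← mul_assoc]
  calc ∫⁻ ω, ∫⁻ x, k (x, ω) * (ρ x * ρ ω)
      = ∫⁻ ω, (∫⁻ x, k (x, ω) * ρ x) * ρ ω := by
        refine lintegral_congr fun ω => ?_
        rw [← lintegral_mul_const _ (by fun_prop)]
        simp_rw [mul_assoc]
    _ ≤ ∫⁻ ω, (eLpNorm (fun x => k (x, ω)) p volume * (1 + ∫⁻ x, ρ x)) * ρ ω := by
        gcongr with ω
        exact lintegral_mul_le_of_le_one hp (by fun_prop) hρ hρ1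
    _ = (∫⁻ ω, eLpNorm (fun x => k (x, ω)) p volume * ρ ω) * (1 + ∫⁻ x, ρ x) := by
        refine Eq.trans (lintegral_congr fun ω => ?_)
          (lintegral_mul_const _ ((measurable_inner_norm hg').mul hρ))
        ring
    _ ≤ _ := by
        gcongr
        exact lintegral_mul_le_of_le_one hq (measurable_inner_norm hg') hρ hρ1

end MixedNormInequalities

/-! ### The operator short-time Fourier transform and twisted convolution -/

section OperatorKernels

variable {d : ℕ}

theorem norm_adjointShift_le (S : HS d) (z : Phase d) : ‖adjointShift S z‖ ≤ ‖S‖ := by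
  refine (ContinuousLinearMap.opNorm_comp_le _ _).trans ?_
  rw [LinearIsometryEquiv.norm_map, LinearIsometryEquiv.norm_map]
  calc _ ≤ ‖S‖ * 1 := by
        gcongr
        · exact HSOp.norm_toCLM_le S
        · exact LinearIsometry.norm_toContinuousLinearMap_le _
    _ = ‖S‖ := mul_one _

theorem inner_adjointShift (S : HS d) (z : Phase d) (g f : L2 d) :
    inner ℂ g (adjointShift S z f) = inner ℂ (timeFreqShift z (HSOp.toCLM S g)) f := by
  rw [adjointShift, ContinuousLinearMap.comp_apply, ContinuousLinearMap.adjoint_inner_right,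
    ContinuousLinearMap.adjoint_inner_right]
  rfl

theorem continuous_adjointShift (S : HS d) (f : L2 d) :
    Continuous fun z => adjointShift S z f := by
  have h : ∀ z, adjointShift S z f = ContinuousLinearMap.adjoint (HSOp.toCLM S)
      ((character z.2 z.1)⁻¹ • timeFreqShift (-z) f) := fun z => by
    rw [← adjoint_timeFreqShift]
    rfl
  simp_rw [h]
  have h1 : Continuous fun z : Phase d => (character z.2 z.1)⁻¹ :=
    Continuous.inv₀ (by unfold character; fun_prop) fun z => character_ne_zero _ _
  exact (ContinuousLinearMap.continuous _).comp
    (h1.smul ((continuous_timeFreqShift f).comp continuous_neg))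

theorem toCLM_opSTFT (S T : HS d) (z : Phase d) (f : L2 d) :
    HSOp.toCLM (opSTFT S T z) f = adjointShift S z (HSOp.toCLM T f) := rfl

theorem inner_opSTFT (S T : HS d) (z : Phase d) (g f : L2 d) :
    inner ℂ g (HSOp.toCLM (opSTFT S T z) f) =
      inner ℂ (timeFreqShift z (HSOp.toCLM S g)) (HSOp.toCLM T f) := by
  rw [toCLM_opSTFT, inner_adjointShift]

theorem continuous_opSTFT (S T : HS d) : Continuous (opSTFT S T) :=
  HSOp.continuous_leftComp (norm_adjointShift_le S) (continuous_adjointShift S) T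

theorem measurable_enorm_opSTFT (S T : HS d) : Measurable fun z => ‖opSTFT S T z‖ₑ :=
  (continuous_opSTFT S T).enorm.measurable

theorem opSTFT_smul (S T : HS d) (c : ℂ) (z : Phase d) :
    opSTFT S (c • T) z = c • opSTFT S T z := HSOp.leftComp_smul _ _ _

/-- Passing to adjoints exchanges the two operators and reflects phase space. -/
theorem norm_opSTFT_neg (S T : HS d) (z : Phase d) : ‖opSTFT S T (-z)‖ = ‖opSTFT T S z‖ := by
  have h : HSOp.adj (opSTFT S T (-z)) = character z.2 z.1 • opSTFT T S z := by
    refine HSOp.ext_inner fun f g => ?_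
    rw [HSOp.toCLM_adj, ContinuousLinearMap.adjoint_inner_right, map_smul, smul_apply,
      inner_smul_right, inner_opSTFT, ← inner_conj_symm, inner_opSTFT, inner_conj_symm]
    have h2 := (timeFreqShift z).inner_map_map (HSOp.toCLM T g)
      (timeFreqShift (-z) (HSOp.toCLM S f))
    rw [timeFreqShift_neg_apply, inner_smul_right] at h2
    exact h2.symm
  rw [← HSOp.norm_adj, h, norm_smul, norm_character, one_mul]

/-- The twisted convolution with `𝔙_R Q` has the kernel `R* π(z)* π(w) Q`. -/
theorem twistedIntegrand_opSTFT (Ψ : Phase d → HS d) (R Q : HS d) (z w : Phase d) :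
    twistedIntegrand Ψ (opSTFT R Q) z w =
      opSTFT R (HSOp.leftComp (timeFreqShift w).toContinuousLinearMap
        (HSOp.leftComp (HSOp.toCLM Q) (Ψ w))) z := by
  refine HSOp.toCLM_injective (ContinuousLinearMap.ext fun f => ?_)
  rw [twistedIntegrand, map_smul, smul_apply]
  change _ • adjointShift R (z - w) (HSOp.toCLM Q (HSOp.toCLM (Ψ w) f)) =
    adjointShift R z (timeFreqShift w (HSOp.toCLM Q (HSOp.toCLM (Ψ w) f)))
  simp only [adjointShift, ContinuousLinearMap.comp_apply, adjoint_timeFreqShift_timeFreqShift,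
    map_smul]

theorem inner_twistedIntegrand (Ψ : Phase d → HS d) (R Q : HS d) (z w : Phase d) (g f : L2 d) :
    inner ℂ g (HSOp.toCLM (twistedIntegrand Ψ (opSTFT R Q) z w) f) =
      inner ℂ (timeFreqShift z (HSOp.toCLM R g))
        (timeFreqShift w (HSOp.toCLM Q (HSOp.toCLM (Ψ w) f))) := by
  rw [twistedIntegrand_opSTFT, inner_opSTFT]
  rfl

theorem enorm_twistedIntegrand_le (F H : Phase d → HS d) (z w : Phase d) :
    ‖twistedIntegrand F H z w‖ₑ ≤ ‖H (z - w)‖ₑ * ‖F w‖ₑ := by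
  rw [← ofReal_norm, ← ofReal_norm, ← ofReal_norm, ← ENNReal.ofReal_mul (norm_nonneg _)]
  refine ENNReal.ofReal_le_ofReal ?_
  rw [twistedIntegrand, norm_smul, norm_character, one_mul]
  exact HSOp.norm_leftComp_toCLM_le _ _

theorem aestronglyMeasurable_twistedIntegrand_uncurry {F H : Phase d → HS d}
    (hF : AEStronglyMeasurable F) (hH : Continuous H) :
    AEStronglyMeasurable (Function.uncurry (twistedIntegrand F H))
      ((volume : Measure (Phase d)).prod volume) := by
  have h1 : Continuous fun y : Phase d × Phase d => character y.2.1 (y.2.2 - y.1.2) := by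
    unfold character
    fun_prop
  have h2 : Continuous fun y : Phase d × Phase d =>
      HSOp.leftCompL (HSOp.toCLML (H (y.1 - y.2))) := by fun_prop
  have h3 : AEStronglyMeasurable (fun y : Phase d × Phase d => F y.2)
      ((volume : Measure (Phase d)).prod volume) := hF.comp_snd
  exact h1.aestronglyMeasurable.smul
    (isBoundedBilinearMap_apply.continuous.comp_aestronglyMeasurable
      (h2.aestronglyMeasurable.prodMk h3))

theorem aestronglyMeasurable_twistedIntegrand {F H : Phase d → HS d}
    (hF : AEStronglyMeasurable F) (hH : Continuous H) (z : Phase d) :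
    AEStronglyMeasurable (twistedIntegrand F H z) := by
  have h1 : Continuous fun w : Phase d => character w.1 (w.2 - z.2) := by
    unfold character
    fun_prop
  have h2 : Continuous fun w : Phase d => HSOp.leftCompL (HSOp.toCLML (H (z - w))) := by fun_prop
  exact h1.aestronglyMeasurable.smul
    (isBoundedBilinearMap_apply.continuous.comp_aestronglyMeasurable
      (h2.aestronglyMeasurable.prodMk hF))

theorem aestronglyMeasurable_twistedConv {F H : Phase d → HS d}
    (hF : AEStronglyMeasurable F) (hH : Continuous H) :
    AEStronglyMeasurable (twistedConv F H) :=
  (aestronglyMeasurable_twistedIntegrand_uncurry hF hH).integral_prod_right'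

theorem integrable_twistedIntegrand {F H : Phase d → HS d} (hF : AEStronglyMeasurable F)
    (hH : Continuous H) {z : Phase d} (h : ∫⁻ w, ‖H (z - w)‖ₑ * ‖F w‖ₑ < ∞) :
    Integrable (twistedIntegrand F H z) :=
  ⟨aestronglyMeasurable_twistedIntegrand hF hH z,
    (lintegral_mono (enorm_twistedIntegrand_le F H z)).trans_lt h⟩

theorem enorm_twistedConv_le (F H : Phase d → HS d) (z : Phase d) :
    ‖twistedConv F H z‖ₑ ≤ ∫⁻ w, ‖H (z - w)‖ₑ * ‖F w‖ₑ :=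
  (enorm_integral_le_lintegral_enorm _).trans (lintegral_mono (enorm_twistedIntegrand_le F H z))

/-- The matrix coefficient `A ↦ ⟨A f, g⟩` as a continuous linear functional on the
Hilbert–Schmidt operators. -/
def matrixCoeff (g f : L2 d) : HS d →L[ℂ] ℂ :=
  LinearMap.mkContinuous
    { toFun := fun A : HS d => (inner ℂ g (HSOp.toCLM A f) : ℂ)
      map_add' := fun A B => by rw [map_add, add_apply, inner_add_right]
      map_smul' := fun c A => by rw [map_smul, smul_apply, inner_smul_right]; rfl }
    (‖g‖ * ‖f‖) fun A => by
      refine (norm_inner_le_norm (𝕜 := ℂ) g (HSOp.toCLM A f)).trans ?_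
      have := HSOp.norm_apply_le A f
      nlinarith [norm_nonneg g]

theorem matrixCoeff_apply (g f : L2 d) (A : HS d) :
    matrixCoeff g f A = inner ℂ g (HSOp.toCLM A f) := rfl

theorem inner_twistedConv {F H : Phase d → HS d} {z : Phase d}
    (h : Integrable (twistedIntegrand F H z)) (g f : L2 d) :
    inner ℂ g (HSOp.toCLM (twistedConv F H z) f) =
      ∫ w, inner ℂ g (HSOp.toCLM (twistedIntegrand F H z w) f) :=
  ((matrixCoeff g f).integral_comp_comm h).symm

theorem integrable_inner_twistedIntegrand {F H : Phase d → HS d} {z : Phase d}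
    (h : Integrable (twistedIntegrand F H z)) (g f : L2 d) :
    Integrable fun w => (inner ℂ g (HSOp.toCLM (twistedIntegrand F H z w) f) : ℂ) :=
  (matrixCoeff g f).integrable_comp h

instance separableSpace_L2 : TopologicalSpace.SeparableSpace (L2 d) := by
  have : Fact ((2 : ℝ≥0∞) ≠ ∞) := ⟨by norm_num⟩
  infer_instance

/-- Moyal's identity for two Hilbert–Schmidt windows: `∫ π(w) R S* π(w)* dw = tr(S* R) I`, in the
weak sense. -/
theorem integral_inner_adjointShift (R S : HS d) (b a : L2 d) :
    ∫ w, (inner ℂ (adjointShift R w b) (adjointShift S w a) : ℂ) =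
      HSOp.traceInner S R * inner ℂ b a := by
  have hs : ∀ w, HasSum (fun i => (inner ℂ b (timeFreqShift w (HSOp.toCLM R (onb (L2 d) i))) *
      inner ℂ (timeFreqShift w (HSOp.toCLM S (onb (L2 d) i))) a : ℂ))
      (inner ℂ (adjointShift R w b) (adjointShift S w a)) := fun w => by
    refine ((onb (L2 d)).hasSum_inner_mul_inner _ _).congr_fun fun i => ?_
    rw [inner_adjointShift, ← inner_conj_symm (adjointShift R w b), inner_adjointShift,
      inner_conj_symm]
  -- Expand in an orthonormal basis and apply the scalar identity to each term.
  have h := hasSum_integral_of_summable_integral_norm (μ := (volume : Measure (Phase d)))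
    (F := fun i w => (inner ℂ b (timeFreqShift w (HSOp.toCLM R (onb (L2 d) i))) *
      inner ℂ (timeFreqShift w (HSOp.toCLM S (onb (L2 d) i))) a : ℂ))
    (fun i => integrable_inner_mul_inner _ _ _ _) ?_
  · simp only [(hs _).tsum_eq, integral_inner_mul_inner] at h
    rw [mul_comm]
    exact h.unique ((HSOp.hasSum_traceInner S R).mul_left _)
  · refine Summable.of_nonneg_of_le (fun i => integral_nonneg fun _ => norm_nonneg _)
      (fun i => integral_norm_inner_mul_inner_le _ _ _ _)
      (((HSOp.summable_norm_mul_norm R S).mul_left (‖b‖ * ‖a‖)).congr fun i => ?_)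
    ring

/-- The reproducing formula `𝔙_S T ♮ 𝔙_Q R = tr(S* R) 𝔙_Q T` for Hilbert–Schmidt operators. -/
theorem twistedConv_opSTFT {S T Q R : HS d} {z : Phase d}
    (h : Integrable (twistedIntegrand (opSTFT S T) (opSTFT Q R) z)) :
    twistedConv (opSTFT S T) (opSTFT Q R) z = HSOp.traceInner S R • opSTFT Q T z := by
  refine HSOp.ext_inner fun f g => ?_
  rw [inner_twistedConv h, map_smul, smul_apply, inner_smul_right, inner_opSTFT,
    ← integral_inner_adjointShift]
  refine integral_congr_ae (Filter.Eventually.of_forall fun w => ?_)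
  simp only [inner_twistedIntegrand, toCLM_opSTFT]
  rw [← inner_conj_symm (adjointShift R w _), inner_adjointShift R w, inner_conj_symm]

end OperatorKernels

/-! ### Twisted convolution on weighted mixed-norm spaces -/

section WeightedConvolution

variable {d : ℕ} {v m : Weight d} {p q : ℝ≥0∞}

theorem lintegral_decay_lt_top (d : ℕ) :
    ∫⁻ x : Rd d, ENNReal.ofReal ((1 + ‖x‖) ^ (-((d : ℝ) + 1))) < ∞ := by
  have h := integrable_one_add_norm (E := Rd d) (μ := volume) (r := (d : ℝ) + 1) (by simp)
  have h2 := h.2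
  rw [hasFiniteIntegral_iff_ofReal (Filter.Eventually.of_forall fun x => by positivity)] at h2
  exact h2

/-- Functions with finite weighted mixed norm are integrable against rapidly decaying ones. -/
theorem lintegral_mul_decay_le (hp : 1 ≤ p) (hq : 1 ≤ q) {g : Phase d → ℝ≥0∞}
    (hg : AEMeasurable g) :
    ∫⁻ z, g z * ENNReal.ofReal ((1 + ‖z‖) ^ (-(2 * ((d : ℝ) + 1)))) ≤
      mixedNorm p q g *
        (1 + ∫⁻ x : Rd d, ENNReal.ofReal ((1 + ‖x‖) ^ (-((d : ℝ) + 1)))) ^ 2 := by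
  refine le_trans (lintegral_mono fun z => ?_) (lintegral_mul_le_mixedNorm hp hq hg
    (ρ := fun x : Rd d => ENNReal.ofReal ((1 + ‖x‖) ^ (-((d : ℝ) + 1)))) (by fun_prop)
    fun x => ?_)
  · dsimp only
    gcongr
    rw [← ENNReal.ofReal_mul (by positivity)]
    refine ENNReal.ofReal_le_ofReal ?_
    rw [← Real.mul_rpow (by positivity) (by positivity),
      show -(2 * ((d : ℝ) + 1)) = (2 : ℕ) * (-((d : ℝ) + 1)) by push_cast; ring,
      Real.rpow_mul (by positivity), Real.rpow_natCast]
    refine Real.rpow_le_rpow_of_nonpos (by positivity) ?_ (by linarith [Nat.cast_nonneg (α := ℝ) d])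
    rw [sq]
    gcongr
    · exact norm_fst_le z
    · exact norm_snd_le z
  · rw [← ENNReal.ofReal_one]
    refine ENNReal.ofReal_le_ofReal ?_
    exact Real.rpow_le_one_of_one_le_of_nonpos (by linarith [norm_nonneg x])
      (by linarith [Nat.cast_nonneg (α := ℝ) d])

/-- The integral against a positive decaying function is finite, which leaves no room for the value
`∞` on a set of positive measure. -/
theorem ae_lt_top_of_mixedNorm_lt_top (hp : 1 ≤ p) (hq : 1 ≤ q) {g : Phase d → ℝ≥0∞}
    (hg : AEMeasurable g) (h : mixedNorm p q g < ∞) : ∀ᵐ z, g z < ∞ := by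
  have h1 := (lintegral_mul_decay_le hp hq hg).trans_lt (ENNReal.mul_lt_top h (by
    have := (lintegral_decay_lt_top d).ne
    finiteness))
  filter_upwards [ae_lt_top' (hg.mul (by fun_prop)) h1.ne] with z hz
  refine lt_of_le_of_ne le_top fun h0 => ?_
  rw [Pi.mul_apply, h0, ENNReal.top_mul] at hz
  · exact hz.ne rfl
  · exact (ENNReal.ofReal_pos.2 (by positivity)).ne'

theorem Weight.ofReal_mul_le (hm : m.IsModerate v) (z w : Phase d) :
    ENNReal.ofReal (m z) ≤ ENNReal.ofReal (v (z - w)) * ENNReal.ofReal (m w) := by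
  rw [← ENNReal.ofReal_mul (v.pos _).le]
  refine ENNReal.ofReal_le_ofReal ?_
  simpa using hm (z - w) w

/-- Pointwise form of the weighted Young inequality. -/
theorem weight_mul_convolution_le (hm : m.IsModerate v) (N G : Phase d → ℝ≥0∞) (z : Phase d) :
    ENNReal.ofReal (m z) * ∫⁻ w, N (z - w) * G w ≤
      ∫⁻ w, (ENNReal.ofReal (v (z - w)) * N (z - w)) * (ENNReal.ofReal (m w) * G w) := by
  rw [← lintegral_const_mul' _ _ ENNReal.ofReal_ne_top]
  refine lintegral_mono fun w => ?_
  calc ENNReal.ofReal (m z) * (N (z - w) * G w)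
      ≤ (ENNReal.ofReal (v (z - w)) * ENNReal.ofReal (m w)) * (N (z - w) * G w) := by
        gcongr
        exact Weight.ofReal_mul_le hm z w
    _ = _ := by ring

/-- The weighted Young inequality `L¹_v * L^{p,q}_m ⊆ L^{p,q}_m`. -/
theorem mixedNorm_weight_mul_convolution_le (hm : m.IsModerate v) (hp : 1 ≤ p) (hq : 1 ≤ q)
    {N G : Phase d → ℝ≥0∞} (hN : AEMeasurable N) (hG : AEMeasurable G) :
    mixedNorm p q (fun z => ENNReal.ofReal (m z) * ∫⁻ w, N (z - w) * G w) ≤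
      (∫⁻ z, ENNReal.ofReal (v z) * N z) *
        mixedNorm p q fun z => ENNReal.ofReal (m z) * G z := by
  have h1 : AEMeasurable fun z => ENNReal.ofReal (v z) * N z :=
    v.aemeasurable.ennreal_ofReal.mul hN
  have h2 : AEMeasurable fun z => ENNReal.ofReal (m z) * G z :=
    m.aemeasurable.ennreal_ofReal.mul hG
  have h3 := mixedNorm_convolution_le (f := fun z => ENNReal.ofReal (v z) * N z)
    (g := fun z => ENNReal.ofReal (m z) * G z) hp hq h1 h2
  refine le_trans (mixedNorm_mono_ae (Filter.Eventually.of_forall fun z => ?_)) h3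
  exact weight_mul_convolution_le hm N G z

theorem aemeasurable_convolution {N G : Phase d → ℝ≥0∞} (hN : Measurable N)
    (hG : AEMeasurable G) : AEMeasurable fun z => ∫⁻ w, N (z - w) * G w := by
  have h : AEMeasurable (fun y : Phase d × Phase d => N (y.1 - y.2) * G y.2)
      ((volume : Measure (Phase d)).prod volume) :=
    (hN.comp (measurable_fst.sub measurable_snd)).aemeasurable.mul hG.comp_snd
  exact h.lintegral_prod_right'

theorem ae_convolution_lt_top (hm : m.IsModerate v) (hp : 1 ≤ p) (hq : 1 ≤ q)
    {N G : Phase d → ℝ≥0∞} (hN : Measurable N) (hG : AEMeasurable G)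
    (hN1 : ∫⁻ z, ENNReal.ofReal (v z) * N z < ∞)
    (hG1 : mixedNorm p q (fun z => ENNReal.ofReal (m z) * G z) < ∞) :
    ∀ᵐ z, ∫⁻ w, N (z - w) * G w < ∞ := by
  have h := ae_lt_top_of_mixedNorm_lt_top hp hq
    (m.aemeasurable.ennreal_ofReal.mul (aemeasurable_convolution hN hG))
    ((mixedNorm_weight_mul_convolution_le hm hp hq hN.aemeasurable hG).trans_lt
      (ENNReal.mul_lt_top hN1 hG1))
  filter_upwards [h] with z hz
  refine lt_of_le_of_ne le_top fun h0 => ?_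
  rw [Pi.mul_apply, h0, ENNReal.mul_top (ENNReal.ofReal_pos.2 (m.pos z)).ne'] at hz
  exact hz.ne rfl

/-- The `L¹_v` norm of `𝔙_R Q`. -/
def kernelNorm (v : Weight d) (R Q : HS d) : ℝ≥0∞ :=
  ∫⁻ z, ENNReal.ofReal (v z) * ‖opSTFT R Q z‖ₑ

theorem weightedNorm_one_one (v : Weight d) {F : Phase d → HS d} (hF : AEStronglyMeasurable F) :
    weightedNorm 1 1 v F = ∫⁻ z, ENNReal.ofReal (v z) * ‖F z‖ₑ := by
  rw [weightedNorm, mixedNorm]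
  simp only [eLpNorm_one_eq_lintegral_enorm, enorm_eq_self]
  rw [Measure.volume_eq_prod, lintegral_prod_symm _ (aemeasurable_weighted v hF)]

theorem kernelNorm_lt_top_of_admissible {S : HS d} (hS : S ∈ admissible v) :
    kernelNorm v S S < ∞ := by
  rw [kernelNorm, ← weightedNorm_one_one v (continuous_opSTFT S S).aestronglyMeasurable]
  exact hS.2

/-- Twisted convolution with `𝔙_R Q ∈ L¹_v` converges absolutely almost everywhere. -/
theorem ae_convolution_opSTFT_lt_top (hm : m.IsModerate v) (hp : 1 ≤ p) (hq : 1 ≤ q) {R Q : HS d}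
    (hk : kernelNorm v R Q < ∞) {Ψ : Phase d → HS d} (hΨ : MemLpqm p q m Ψ) :
    ∀ᵐ z, ∫⁻ w, ‖opSTFT R Q (z - w)‖ₑ * ‖Ψ w‖ₑ < ∞ :=
  ae_convolution_lt_top hm hp hq (measurable_enorm_opSTFT R Q) hΨ.1.enorm hk hΨ.2

theorem ae_integrable_twistedIntegrand (hm : m.IsModerate v) (hp : 1 ≤ p) (hq : 1 ≤ q)
    {R Q : HS d} (hk : kernelNorm v R Q < ∞) {Ψ : Phase d → HS d} (hΨ : MemLpqm p q m Ψ) :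
    ∀ᵐ z, Integrable (twistedIntegrand Ψ (opSTFT R Q) z) :=
  (ae_convolution_opSTFT_lt_top hm hp hq hk hΨ).mono fun _ hz =>
    integrable_twistedIntegrand hΨ.1 (continuous_opSTFT R Q) hz

theorem weightedNorm_twistedConv_le (hm : m.IsModerate v) (hp : 1 ≤ p) (hq : 1 ≤ q) (R Q : HS d)
    {Ψ : Phase d → HS d} (hΨ : AEStronglyMeasurable Ψ) :
    weightedNorm p q m (twistedConv Ψ (opSTFT R Q)) ≤ kernelNorm v R Q * weightedNorm p q m Ψ := by
  have h := mixedNorm_weight_mul_convolution_le (N := fun z => ‖opSTFT R Q z‖ₑ)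
    (G := fun z => ‖Ψ z‖ₑ) hm hp hq (measurable_enorm_opSTFT R Q).aemeasurable hΨ.enorm
  refine le_trans (mixedNorm_mono_ae (Filter.Eventually.of_forall fun z => ?_)) h
  gcongr
  exact enorm_twistedConv_le Ψ (opSTFT R Q) z

theorem memLpqm_twistedConv (hm : m.IsModerate v) (hp : 1 ≤ p) (hq : 1 ≤ q) {R Q : HS d}
    (hk : kernelNorm v R Q < ∞) {Ψ : Phase d → HS d} (hΨ : MemLpqm p q m Ψ) :
    MemLpqm p q m (twistedConv Ψ (opSTFT R Q)) :=
  ⟨aestronglyMeasurable_twistedConv hΨ.1 (continuous_opSTFT R Q),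
    (weightedNorm_twistedConv_le hm hp hq R Q hΨ.1).trans_lt (ENNReal.mul_lt_top hk hΨ.2)⟩

theorem twistedConv_congr {F G H : Phase d → HS d} (h : F =ᵐ[volume] G) :
    twistedConv F H = twistedConv G H :=
  funext fun z => integral_congr_ae (twistedIntegrand_congr h z)

set_option maxHeartbeats 1000000 in
/-- Associativity of the twisted convolution with two operator STFTs, together with the
reproducing formula: `(Ψ ♮ 𝔙_S P) ♮ 𝔙_Q R = tr(S* R) Ψ ♮ 𝔙_Q P`. -/
theorem twistedConv_twistedConv (hm : m.IsModerate v) (hp : 1 ≤ p) (hq : 1 ≤ q) {S P Q R : HS d}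
    (hSP : kernelNorm v S P < ∞) (hQR : kernelNorm v Q R < ∞) {Ψ : Phase d → HS d}
    (hΨ : MemLpqm p q m Ψ) :
    twistedConv (twistedConv Ψ (opSTFT S P)) (opSTFT Q R) =ᵐ[volume]
      HSOp.traceInner S R • twistedConv Ψ (opSTFT Q P) := by
  set G : Phase d → ℝ≥0∞ := fun w => ∫⁻ y, ‖opSTFT S P (w - y)‖ₑ * ‖Ψ y‖ₑ with hG
  have hGm : AEMeasurable G := aemeasurable_convolution (measurable_enorm_opSTFT S P) hΨ.1.enorm
  have hG1 : mixedNorm p q (fun z => ENNReal.ofReal (m z) * G z) < ∞ :=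
    (mixedNorm_weight_mul_convolution_le (N := fun z => ‖opSTFT S P z‖ₑ) (G := fun z => ‖Ψ z‖ₑ)
      hm hp hq (measurable_enorm_opSTFT S P).aemeasurable hΨ.1.enorm).trans_lt
      (ENNReal.mul_lt_top hSP hΨ.2)
  filter_upwards [ae_convolution_lt_top hm hp hq (measurable_enorm_opSTFT Q R) hGm hQR hG1]
    with z hz
  -- For fixed `y` the inner integrand is the operator STFT of `T y = π(y) P Ψ(y)`, and `K w`
  -- applies the kernel of the outer twisted convolution.
  let T : Phase d → HS d := fun y => HSOp.leftComp (timeFreqShift y).toContinuousLinearMap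
    (HSOp.leftComp (HSOp.toCLM P) (Ψ y))
  let K : Phase d → HS d →L[ℂ] HS d := fun w =>
    character w.1 (w.2 - z.2) • HSOp.leftCompL (HSOp.toCLML (opSTFT Q R (z - w)))
  have hK : ∀ (w : Phase d) (F : Phase d → HS d),
      K w (F w) = twistedIntegrand F (opSTFT Q R) z w := fun w F => rfl
  have hKle : ∀ w (A : HS d), ‖K w A‖ₑ ≤ ‖opSTFT Q R (z - w)‖ₑ * ‖A‖ₑ := fun w A =>
    enorm_twistedIntegrand_le (fun _ => A) (opSTFT Q R) z w
  have hKc : Continuous K := by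
    have h1 : Continuous fun w : Phase d => character w.1 (w.2 - z.2) := by
      unfold character
      fun_prop
    have h2 := continuous_opSTFT Q R
    have h3 : Continuous fun w : Phase d => HSOp.leftCompL (HSOp.toCLML (opSTFT Q R (z - w))) := by
      fun_prop
    exact h1.smul h3
  have hKG : ∀ w y, ‖K w (twistedIntegrand Ψ (opSTFT S P) w y)‖ₑ ≤
      ‖opSTFT Q R (z - w)‖ₑ * (‖opSTFT S P (w - y)‖ₑ * ‖Ψ y‖ₑ) := fun w y =>
    (hKle w _).trans (mul_le_mul_right (enorm_twistedIntegrand_le Ψ (opSTFT S P) w y) _)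
  have hGw : ∀ w, ∫⁻ y, ‖opSTFT Q R (z - w)‖ₑ * (‖opSTFT S P (w - y)‖ₑ * ‖Ψ y‖ₑ) =
      ‖opSTFT Q R (z - w)‖ₑ * G w := fun w =>
    lintegral_const_mul' ‖opSTFT Q R (z - w)‖ₑ (fun y => ‖opSTFT S P (w - y)‖ₑ * ‖Ψ y‖ₑ)
      enorm_ne_top
  -- Absolute convergence of the double integral, at every `z` where `|𝔙_Q R| * |𝔙_S P| * |Ψ|` is
  -- finite.
  have hint : Integrable (Function.uncurry fun w y => K w (twistedIntegrand Ψ (opSTFT S P) w y))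
      ((volume : Measure (Phase d)).prod volume) := by
    have hmeas : AEStronglyMeasurable
        (Function.uncurry fun w y => K w (twistedIntegrand Ψ (opSTFT S P) w y))
        ((volume : Measure (Phase d)).prod volume) :=
      isBoundedBilinearMap_apply.continuous.comp_aestronglyMeasurable
        ((hKc.comp continuous_fst).aestronglyMeasurable.prodMk
          (aestronglyMeasurable_twistedIntegrand_uncurry hΨ.1 (continuous_opSTFT S P)))
    refine ⟨hmeas, ?_⟩
    rw [hasFiniteIntegral_iff_enorm, lintegral_prod _ hmeas.enorm]
    refine lt_of_le_of_lt (lintegral_mono fun w => ?_) hz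
    rw [← hGw w]
    exact lintegral_mono fun y => hKG w y
  have e1 : twistedConv (twistedConv Ψ (opSTFT S P)) (opSTFT Q R) z =
      ∫ w, ∫ y, K w (twistedIntegrand Ψ (opSTFT S P) w y) := by
    rw [twistedConv]
    refine integral_congr_ae ?_
    filter_upwards [ae_integrable_twistedIntegrand hm hp hq hSP hΨ] with w hw
    rw [(K w).integral_comp_comm hw, ← hK w (twistedConv Ψ (opSTFT S P)), twistedConv]
  -- With the order of integration exchanged, the reproducing formula evaluates the inner integral.
  have e2 : ∫ y, ∫ w, K w (twistedIntegrand Ψ (opSTFT S P) w y) =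
      ∫ y, HSOp.traceInner S R • twistedIntegrand Ψ (opSTFT Q P) z y := by
    refine integral_congr_ae ?_
    filter_upwards [hint.prod_left_ae] with y hy
    have e : ∀ w, K w (twistedIntegrand Ψ (opSTFT S P) w y) =
        twistedIntegrand (opSTFT S (T y)) (opSTFT Q R) z w := fun w => by
      rw [twistedIntegrand_opSTFT Ψ S P w y]
      exact hK w (opSTFT S (T y))
    simp only [Function.uncurry_apply_pair, e] at hy
    simp_rw [e]
    have h := twistedConv_opSTFT hy
    rw [twistedConv] at h
    rw [h, twistedIntegrand_opSTFT Ψ Q P z y]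
  rw [e1, integral_integral_swap hint, e2, integral_smul, Pi.smul_apply, twistedConv]

end WeightedConvolution

/-! ### Decay of the short-time Fourier transform of Schwartz functions -/

section SchwartzEstimates

variable {d : ℕ}

/-- The seminorms `max_{k ≤ m₁, n ≤ m₂} sup_t |t|^k |D^n f(t)|`, which increase with `m` and define
the topology of the Schwartz space. -/
def schwartzNorm (d : ℕ) (m : ℕ × ℕ) : Seminorm ℂ 𝓢(Rd d, ℂ) :=
  (Finset.Iic m).sup (schwartzSeminormFamily ℂ (Rd d) ℂ)

theorem schwartzNorm_le_of_forall {m : ℕ × ℕ} {f : 𝓢(Rd d, ℂ)} {a : ℝ} (ha : 0 ≤ a)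
    (h : ∀ n ≤ m.2, ∀ t, (1 + ‖t‖) ^ m.1 * ‖iteratedFDeriv ℝ n f t‖ ≤ a) :
    schwartzNorm d m f ≤ a := by
  refine Seminorm.finset_sup_apply_le ha fun i hi => ?_
  obtain ⟨h1, h2⟩ := Prod.mk_le_mk.1 (Finset.mem_Iic.1 hi)
  refine SchwartzMap.seminorm_le_bound ℂ i.1 i.2 f ha fun t => le_trans ?_ (h i.2 h2 t)
  gcongr
  calc ‖t‖ ^ i.1 ≤ (1 + ‖t‖) ^ i.1 := by gcongr; linarith
    _ ≤ (1 + ‖t‖) ^ m.1 := pow_le_pow_right₀ (by linarith [norm_nonneg t]) h1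

theorem one_add_pow_mul_le_schwartzNorm {m : ℕ × ℕ} {k n : ℕ} (hk : k ≤ m.1) (hn : n ≤ m.2)
    (f : 𝓢(Rd d, ℂ)) (t : Rd d) :
    (1 + ‖t‖) ^ k * ‖iteratedFDeriv ℝ n f t‖ ≤ 2 ^ m.1 * schwartzNorm d m f :=
  SchwartzMap.one_add_le_sup_seminorm_apply (𝕜 := ℂ) hk hn f t

/-- A continuous seminorm on the Schwartz space is bounded by a single one of the seminorms
`schwartzNorm`, as these are directed. -/
theorem exists_seminorm_le_schwartzNorm {p : Seminorm ℂ 𝓢(Rd d, ℂ)} (hp : Continuous p) :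
    ∃ (C : ℝ) (m : ℕ × ℕ), 0 ≤ C ∧ ∀ f, p f ≤ C * schwartzNorm d m f := by
  obtain ⟨s, C, -, h⟩ := Seminorm.bound_of_continuous (schwartz_withSeminorms ℂ (Rd d) ℂ) p hp
  refine ⟨C, s.sup id, C.2, fun f => (h f).trans ?_⟩
  change (C : ℝ) * s.sup (schwartzSeminormFamily ℂ (Rd d) ℂ) f ≤ _
  have hs : s ⊆ Finset.Iic (s.sup id) := fun i hi =>
    Finset.mem_Iic.2 (Finset.le_sup (f := id) hi)
  exact mul_le_mul_of_nonneg_left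
    ((Finset.sup_mono hs : s.sup (schwartzSeminormFamily ℂ (Rd d) ℂ) ≤ schwartzNorm d _) f) C.2

theorem continuous_schwartzNorm (m : ℕ × ℕ) : Continuous (schwartzNorm d m) := by
  refine Seminorm.continuous_of_le ?_ (Seminorm.finset_sup_le_sum _ _)
  rw [FunLike.coe_sum]
  refine (continuous_finsetSum (Finset.Iic m) fun i _ =>
    (schwartz_withSeminorms ℂ (Rd d) ℂ).continuous_seminorm i).congr fun f => ?_
  rw [Finset.sum_apply]

theorem exists_norm_tempered_le (u : 𝓢'(Rd d, ℂ)) :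
    ∃ (C : ℝ) (m : ℕ × ℕ), 0 ≤ C ∧ ∀ f, ‖u f‖ ≤ C * schwartzNorm d m f :=
  exists_seminorm_le_schwartzNorm (p := (normSeminorm ℂ ℂ).comp (u : 𝓢(Rd d, ℂ) →ₗ[ℂ] ℂ))
    (continuous_norm.comp u.continuous)

theorem exists_schwartzNorm_fourier_le (m : ℕ × ℕ) :
    ∃ (C : ℝ) (m' : ℕ × ℕ), 0 ≤ C ∧
      ∀ f : 𝓢(Rd d, ℂ), schwartzNorm d m (FourierTransform.fourier f) ≤ C * schwartzNorm d m' f :=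
  exists_seminorm_le_schwartzNorm
    (p := (schwartzNorm d m).comp
      (FourierTransform.fourierCLM ℂ 𝓢(Rd d, ℂ) : 𝓢(Rd d, ℂ) →ₗ[ℂ] 𝓢(Rd d, ℂ)))
    ((continuous_schwartzNorm m).comp (FourierTransform.fourierCLM ℂ 𝓢(Rd d, ℂ)).continuous)

theorem one_add_norm_pow_le (N : ℕ) (x t : Rd d) :
    (1 + ‖x‖) ^ N ≤ (1 + ‖t - x‖) ^ N * (1 + ‖t‖) ^ N := by
  rw [← mul_pow]
  gcongr
  have : ‖x‖ ≤ ‖t‖ + ‖t - x‖ := by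
    have := norm_sub_le t (t - x)
    rwa [sub_sub_cancel] at this
  nlinarith [norm_nonneg t, norm_nonneg (t - x), mul_nonneg (norm_nonneg t) (norm_nonneg (t - x))]

theorem one_add_norm_pow_le' (N : ℕ) (x t : Rd d) :
    (1 + ‖t‖) ^ N ≤ (1 + ‖x‖) ^ N * (1 + ‖t - x‖) ^ N := by
  rw [← mul_pow]
  gcongr
  have : ‖t‖ ≤ ‖x‖ + ‖t - x‖ := by
    have := norm_add_le x (t - x)
    rwa [add_sub_cancel] at this
  nlinarith [norm_nonneg t, norm_nonneg (t - x), mul_nonneg (norm_nonneg x) (norm_nonneg (t - x))]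

/-- The product `k · φ₀(· - x)`, whose Fourier transform is the STFT of `k` at `(x, ·)`. -/
def windowed (x : Rd d) (k : 𝓢(Rd d, ℂ)) : 𝓢(Rd d, ℂ) :=
  SchwartzMap.smulLeftCLM ℂ k (SchwartzMap.compSubConstCLM ℂ x (gaussian d))

theorem windowed_apply (x : Rd d) (k : 𝓢(Rd d, ℂ)) (t : Rd d) :
    windowed x k t = k t * gaussian d (t - x) := by
  rw [windowed, SchwartzMap.smulLeftCLM_apply_apply k.hasTemperateGrowth]
  rfl

theorem iteratedFDeriv_schwartz_sub (f : 𝓢(Rd d, ℂ)) (x t : Rd d) (n : ℕ) :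
    iteratedFDeriv ℝ n (fun s => f (s - x)) t = iteratedFDeriv ℝ n f (t - x) := by
  rw [iteratedFDeriv_comp_sub]

/-- Multiplication by the translated Gaussian gives rapid decay in the translation parameter, since
`1 + |x| ≤ (1 + |t - x|) (1 + |t|)`. -/
theorem schwartzNorm_windowed_le (m : ℕ × ℕ) (N : ℕ) :
    ∃ (C : ℝ) (m' : ℕ × ℕ), 0 ≤ C ∧ ∀ (k : 𝓢(Rd d, ℂ)) (x : Rd d),
      (1 + ‖x‖) ^ N * schwartzNorm d m (windowed x k) ≤ C * schwartzNorm d m' k := by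
  set G : ℝ := 2 ^ N * schwartzNorm d (N, m.2) (gaussian d) with hG
  refine ⟨2 ^ m.2 * G * 2 ^ (N + m.1), (N + m.1, m.2), by positivity, fun k x => ?_⟩
  rw [← le_div_iff₀' (by positivity)]
  refine schwartzNorm_le_of_forall (by positivity) fun n hn t => ?_
  rw [le_div_iff₀' (by positivity)]
  set B := 2 ^ (N + m.1) * schwartzNorm d (N + m.1, m.2) k with hB
  have hfun : (windowed x k : Rd d → ℂ) = fun t => k t * gaussian d (t - x) :=
    funext (windowed_apply x k)
  have h1 := norm_iteratedFDeriv_mul_le (f := k) (g := fun t => gaussian d (t - x))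
    (k.smooth ⊤) (((gaussian d).smooth ⊤).comp (contDiff_id.sub contDiff_const)) t
    (n := n) (by exact_mod_cast le_top)
  rw [hfun]
  calc (1 + ‖x‖) ^ N * ((1 + ‖t‖) ^ m.1 *
        ‖iteratedFDeriv ℝ n (fun t => k t * gaussian d (t - x)) t‖)
      ≤ ((1 + ‖t - x‖) ^ N * (1 + ‖t‖) ^ N) * ((1 + ‖t‖) ^ m.1 *
        ∑ i ∈ Finset.range (n + 1), (n.choose i : ℝ) * ‖iteratedFDeriv ℝ i k t‖ *
          ‖iteratedFDeriv ℝ (n - i) (fun t => gaussian d (t - x)) t‖) := by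
        gcongr
        exact one_add_norm_pow_le N x t
    _ = ∑ i ∈ Finset.range (n + 1), (n.choose i : ℝ) *
          (((1 + ‖t‖) ^ (N + m.1) * ‖iteratedFDeriv ℝ i k t‖) *
          ((1 + ‖t - x‖) ^ N * ‖iteratedFDeriv ℝ (n - i) (gaussian d) (t - x)‖)) := by
        rw [Finset.mul_sum, Finset.mul_sum]
        refine Finset.sum_congr rfl fun i _ => ?_
        rw [iteratedFDeriv_schwartz_sub, pow_add]
        ring
    _ ≤ ∑ i ∈ Finset.range (n + 1), (n.choose i : ℝ) * (B * G) := by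
        gcongr with i hi
        · exact one_add_pow_mul_le_schwartzNorm (m := (N + m.1, m.2)) le_rfl
            ((Nat.le_of_lt_succ (Finset.mem_range.1 hi)).trans hn) k t
        · exact one_add_pow_mul_le_schwartzNorm (m := (N, m.2)) le_rfl
            ((Nat.sub_le n i).trans hn) (gaussian d) (t - x)
    _ = 2 ^ n * (B * G) := by
        rw [← Finset.sum_mul]
        congr 1
        exact_mod_cast Nat.sum_range_choose n
    _ ≤ 2 ^ m.2 * (B * G) := by
        gcongr
        norm_num
    _ = _ := by rw [hB]; ring

/-- For Schwartz functions the STFT is the pointwise defined Fourier transform of a Schwartz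
function. -/
theorem gaussSTFT_schwartz (k : 𝓢(Rd d, ℂ)) (w : Phase d) :
    gaussSTFT (k.toLp 2 volume) w = FourierTransform.fourier (windowed w.1 k) w.2 := by
  rw [gaussSTFT, inner_timeFreqShift_eq_fourier, SchwartzMap.fourier_coe]
  rw [Real.fourier_eq, Real.fourier_eq]
  refine integral_congr_ae ?_
  filter_upwards [k.coeFn_toLp 2 volume, (measurePreserving_sub w.1).quasiMeasurePreserving.ae
    (Filter.EventuallyEq.eventually ((gaussian d).coeFn_toLp 2))] with t h1 h2
  rw [h1, h2, windowed_apply, gaussian_apply, Complex.conj_ofReal]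

theorem one_add_norm_phase_le (w : Phase d) : 1 + ‖w‖ ≤ (1 + ‖w.1‖) * (1 + ‖w.2‖) := by
  rw [Prod.norm_def]
  rcases max_cases ‖w.1‖ ‖w.2‖ with ⟨h, -⟩ | ⟨h, -⟩ <;> rw [h] <;>
    nlinarith [norm_nonneg w.1, norm_nonneg w.2, mul_nonneg (norm_nonneg w.1) (norm_nonneg w.2)]

/-- The STFT of a Schwartz function decays rapidly, with control by its Schwartz seminorms. -/
theorem exists_gaussSTFT_decay (d N : ℕ) :
    ∃ (C : ℝ) (m : ℕ × ℕ), 0 ≤ C ∧ ∀ (k : 𝓢(Rd d, ℂ)) (w : Phase d),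
      (1 + ‖w‖) ^ N * ‖gaussSTFT (k.toLp 2 volume) w‖ ≤ C * schwartzNorm d m k := by
  obtain ⟨C₁, m₁, hC₁, h₁⟩ := exists_schwartzNorm_fourier_le (d := d) (N, 0)
  obtain ⟨C₂, m₂, hC₂, h₂⟩ := schwartzNorm_windowed_le (d := d) m₁ N
  refine ⟨2 ^ N * (C₁ * C₂), m₂, by positivity, fun k w => ?_⟩
  have h := one_add_pow_mul_le_schwartzNorm (m := (N, 0)) le_rfl le_rfl
    (FourierTransform.fourier (windowed w.1 k)) w.2
  rw [norm_iteratedFDeriv_zero, ← gaussSTFT_schwartz] at h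
  calc (1 + ‖w‖) ^ N * ‖gaussSTFT (k.toLp 2 volume) w‖
      ≤ ((1 + ‖w.1‖) * (1 + ‖w.2‖)) ^ N * ‖gaussSTFT (k.toLp 2 volume) w‖ := by
        gcongr
        exact one_add_norm_phase_le w
    _ = (1 + ‖w.1‖) ^ N * ((1 + ‖w.2‖) ^ N * ‖gaussSTFT (k.toLp 2 volume) w‖) := by
        rw [mul_pow]; ring
    _ ≤ (1 + ‖w.1‖) ^ N * (2 ^ N * (C₁ * schwartzNorm d m₁ (windowed w.1 k))) := by
        refine mul_le_mul_of_nonneg_left (h.trans ?_) (by positivity)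
        exact mul_le_mul_of_nonneg_left (h₁ _) (by positivity)
    _ = 2 ^ N * (C₁ * ((1 + ‖w.1‖) ^ N * schwartzNorm d m₁ (windowed w.1 k))) := by ring
    _ ≤ 2 ^ N * (C₁ * (C₂ * schwartzNorm d m₂ k)) := by
        have := h₂ k w.1
        exact mul_le_mul_of_nonneg_left (mul_le_mul_of_nonneg_left this hC₁) (by positivity)
    _ = _ := by ring

/-- The character is the composition of `s ↦ exp (2πis)` with the linear form `⟨ω, ·⟩`. -/
theorem norm_iteratedFDeriv_character_le (ω t : Rd d) (n : ℕ) :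
    ‖iteratedFDeriv ℝ n (character ω) t‖ ≤ (2 * Real.pi * ‖ω‖) ^ n := by
  set e : ℝ → ℂ := fun s => Complex.exp (2 * Real.pi * s * I) with he
  have hsm : ContDiff ℝ ((⊤ : ℕ∞) : WithTop ℕ∞) e := Complex.contDiff_exp.comp
      ((contDiff_const.mul Complex.ofRealCLM.contDiff).mul contDiff_const)
  have key : ∀ n : ℕ, iteratedDeriv n e = fun s : ℝ => (2 * Real.pi * I) ^ n * e s := by
    intro n
    induction n with
    | zero => simp
    | succ n ih =>
      rw [iteratedDeriv_succ, ih]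
      funext s
      have hd : HasDerivAt e (e s * (2 * Real.pi * I)) s := by
        have h0 : HasDerivAt (fun s : ℝ => (2 * Real.pi * s * I : ℂ)) (2 * Real.pi * I) s := by
          have := ((hasDerivAt_id s).ofReal_comp.const_mul (2 * Real.pi : ℂ)).mul_const I
          simpa using this
        exact h0.cexp
      rw [(hd.const_mul _).deriv]
      ring
  have hcomp : character ω = e ∘ innerSL ℝ ω := rfl
  rw [hcomp, ContinuousLinearMap.iteratedFDeriv_comp_right _ hsm t (by exact_mod_cast le_top)]
  refine (ContinuousMultilinearMap.norm_compContinuousLinearMap_le _ _).trans ?_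
  rw [norm_iteratedFDeriv_eq_norm_iteratedDeriv, key, norm_mul, he]
  dsimp only
  rw [show (2 * Real.pi * (innerSL ℝ ω t : ℝ) * I : ℂ) =
    ((2 * Real.pi * innerSL ℝ ω t : ℝ) : ℂ) * I by push_cast; ring, norm_exp_ofReal_mul_I]
  simp only [Finset.prod_const, Finset.card_univ, Fintype.card_fin, innerSL_apply_norm]
  simp [abs_of_pos Real.pi_pos, mul_pow]

/-- The Schwartz seminorms of `π(w) φ₀` grow at most polynomially in `w`. -/
theorem exists_schwartzNorm_gaussianShift_le (m : ℕ × ℕ) :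
    ∃ C : ℝ, 0 ≤ C ∧ ∀ w : Phase d,
      schwartzNorm d m (gaussianShift w) ≤ C * (1 + ‖w‖) ^ (m.1 + m.2) := by
  set G : ℝ := 2 ^ m.1 * schwartzNorm d m (gaussian d) with hG
  refine ⟨2 ^ m.2 * ((2 * Real.pi) ^ m.2 * G), by positivity, fun w => ?_⟩
  refine schwartzNorm_le_of_forall (by positivity) fun n hn t => ?_
  have hfun : (gaussianShift w : Rd d → ℂ) = fun t => character w.2 t * gaussian d (t - w.1) :=
    funext (gaussianShift_apply w)
  have h1 := norm_iteratedFDeriv_mul_le (f := character w.2) (g := fun t => gaussian d (t - w.1))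
    (hasTemperateGrowth_character w.2).1
    (((gaussian d).smooth ⊤).comp (contDiff_id.sub contDiff_const)) t
    (n := n) (by exact_mod_cast le_top)
  have hpi : 1 ≤ 2 * Real.pi * (1 + ‖w‖) := by
    nlinarith [Real.pi_gt_three, norm_nonneg w]
  rw [hfun]
  calc (1 + ‖t‖) ^ m.1 *
        ‖iteratedFDeriv ℝ n (fun t => character w.2 t * gaussian d (t - w.1)) t‖
      ≤ ((1 + ‖w.1‖) ^ m.1 * (1 + ‖t - w.1‖) ^ m.1) *
        ∑ i ∈ Finset.range (n + 1), (n.choose i : ℝ) * ‖iteratedFDeriv ℝ i (character w.2) t‖ *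
          ‖iteratedFDeriv ℝ (n - i) (fun t => gaussian d (t - w.1)) t‖ := by
        gcongr
        exact one_add_norm_pow_le' m.1 w.1 t
    _ = (1 + ‖w.1‖) ^ m.1 * ∑ i ∈ Finset.range (n + 1), (n.choose i : ℝ) *
          (‖iteratedFDeriv ℝ i (character w.2) t‖ *
          ((1 + ‖t - w.1‖) ^ m.1 * ‖iteratedFDeriv ℝ (n - i) (gaussian d) (t - w.1)‖)) := by
        rw [mul_assoc, Finset.mul_sum]
        congr 1
        refine Finset.sum_congr rfl fun i _ => ?_
        rw [iteratedFDeriv_schwartz_sub]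
        ring
    _ ≤ (1 + ‖w‖) ^ m.1 * ∑ i ∈ Finset.range (n + 1), (n.choose i : ℝ) *
          ((2 * Real.pi * (1 + ‖w‖)) ^ m.2 * G) := by
        gcongr with i hi
        · exact norm_fst_le w
        · calc _ ≤ (2 * Real.pi * ‖w.2‖) ^ i := norm_iteratedFDeriv_character_le _ _ _
            _ ≤ (2 * Real.pi * (1 + ‖w‖)) ^ i := by
              gcongr
              linarith [norm_snd_le w]
            _ ≤ _ := pow_le_pow_right₀ hpi ((Nat.le_of_lt_succ (Finset.mem_range.1 hi)).trans hn)
        · exact one_add_pow_mul_le_schwartzNorm le_rfl ((Nat.sub_le n i).trans hn) (gaussian d) _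
    _ = (1 + ‖w‖) ^ m.1 * (2 ^ n * ((2 * Real.pi * (1 + ‖w‖)) ^ m.2 * G)) := by
        rw [← Finset.sum_mul]
        congr 2
        exact_mod_cast Nat.sum_range_choose n
    _ ≤ (1 + ‖w‖) ^ m.1 * (2 ^ m.2 * ((2 * Real.pi * (1 + ‖w‖)) ^ m.2 * G)) := by
        gcongr
        norm_num
    _ = _ := by rw [pow_add, mul_pow]; ring

end SchwartzEstimates

/-! ### The Gabor expansion of a Schwartz function -/

section GaussianExpansion

variable {d : ℕ}

theorem integrable_one_add_norm_pow_inv (d : ℕ) :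
    Integrable fun w : Phase d => ((1 + ‖w‖) ^ (2 * d + 1))⁻¹ := by
  have h := integrable_one_add_norm (E := Phase d) (μ := volume) (r := ((2 * d + 1 : ℕ) : ℝ)) (by
    simp only [Module.finrank_prod, finrank_euclideanSpace, Fintype.card_fin]
    push_cast
    linarith)
  refine h.congr (Filter.Eventually.of_forall fun w => ?_)
  dsimp only
  rw [Real.rpow_neg (by positivity), Real.rpow_natCast]

theorem continuous_gaussSTFT (h : L2 d) : Continuous (gaussSTFT h) :=
  continuous_inner_timeFreqShift _ h

theorem norm_gaussSTFT_le (k : 𝓢(Rd d, ℂ)) (N : ℕ) :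
    ∃ C : ℝ, 0 ≤ C ∧ ∀ w : Phase d, (1 + ‖w‖) ^ N * ‖gaussSTFT (k.toLp 2 volume) w‖ ≤
      C * ((1 + ‖w‖) ^ (2 * d + 1))⁻¹ := by
  obtain ⟨C, m, hC, h⟩ := exists_gaussSTFT_decay d (N + (2 * d + 1))
  refine ⟨C * schwartzNorm d m k, by positivity, fun w => ?_⟩
  rw [← div_eq_mul_inv, le_div_iff₀ (by positivity)]
  refine le_trans (le_of_eq ?_) (h k w)
  rw [pow_add]
  ring

theorem integrable_pow_mul_gaussSTFT (k : 𝓢(Rd d, ℂ)) (N : ℕ) :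
    Integrable fun w : Phase d => (1 + ‖w‖) ^ N * ‖gaussSTFT (k.toLp 2 volume) w‖ := by
  obtain ⟨C, hC, h⟩ := norm_gaussSTFT_le k N
  have hc := continuous_gaussSTFT (k.toLp 2 volume)
  refine ((integrable_one_add_norm_pow_inv d).const_mul C).mono'
    (Continuous.aestronglyMeasurable (by fun_prop)) (Filter.Eventually.of_forall fun w => ?_)
  rw [Real.norm_of_nonneg (by positivity)]
  exact h w

/-- Uncurrying of a linear map into the `n`-linear maps to an `(n + 1)`-linear map. -/
def uncurryDeriv (d n : ℕ) : (Rd d →L[ℝ] (Rd d [×n]→L[ℝ] ℂ)) ≃L[ℝ] (Rd d [×(n + 1)]→L[ℝ] ℂ) :=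
  (continuousMultilinearCurryLeftEquiv ℝ (fun _ : Fin (n + 1) => Rd d) ℂ).symm

theorem iteratedFDeriv_succ_eq_uncurryDeriv (f : Rd d → ℂ) (n : ℕ) (t : Rd d) :
    iteratedFDeriv ℝ (n + 1) f t = uncurryDeriv d n (fderiv ℝ (iteratedFDeriv ℝ n f) t) := rfl

/-- The derivatives of `π(w) φ₀` depend smoothly on the phase space variable. -/
theorem contDiff_iteratedFDeriv_gaussianShift (n : ℕ) :
    ContDiff ℝ ((⊤ : ℕ∞) : WithTop ℕ∞)
      fun y : Phase d × Rd d => iteratedFDeriv ℝ n (gaussianShift y.1) y.2 := by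
  induction n with
  | zero =>
    have h : ContDiff ℝ ((⊤ : ℕ∞) : WithTop ℕ∞)
        fun y : Phase d × Rd d => gaussianShift y.1 y.2 := by
      simp only [gaussianShift_apply, gaussian_apply, character]
      refine ContDiff.mul (ContDiff.cexp ?_) ?_
      · refine (contDiff_const.mul ?_).mul contDiff_const
        exact Complex.ofRealCLM.contDiff.comp
          ((contDiff_snd.comp contDiff_fst).inner ℝ contDiff_snd)
      · refine Complex.ofRealCLM.contDiff.comp (contDiff_const.mul (ContDiff.exp ?_))
        exact contDiff_const.mul ((contDiff_snd.sub (contDiff_fst.comp contDiff_fst)).norm_sq ℝ)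
    simp only [iteratedFDeriv_zero_eq_comp, Function.comp_apply]
    exact (continuousMultilinearCurryFin0 ℝ (Rd d) ℂ).symm.contDiff.comp h
  | succ n ih =>
    simp only [iteratedFDeriv_succ_eq_uncurryDeriv]
    refine ContDiff.continuousLinearMap_comp (𝕜 := ℝ) (E := Phase d × Rd d)
      (F := Rd d →L[ℝ] (Rd d [×n]→L[ℝ] ℂ)) (G := Rd d [×(n + 1)]→L[ℝ] ℂ)
      (uncurryDeriv d n).toContinuousLinearMap ?_
    refine ContDiff.fderiv (m := ((⊤ : ℕ∞) : WithTop ℕ∞))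
      (f := fun y : Phase d × Rd d => iteratedFDeriv ℝ n (gaussianShift y.1)) ?_ contDiff_snd
      (by exact_mod_cast le_top)
    exact ih.comp ((contDiff_fst.comp contDiff_fst).prodMk contDiff_snd)

theorem continuous_iteratedFDeriv_gaussianShift (n : ℕ) (t : Rd d) :
    Continuous fun w : Phase d => iteratedFDeriv ℝ n (gaussianShift w) t := by
  have h1 := (contDiff_iteratedFDeriv_gaussianShift (d := d) n).continuous
  have h2 : Continuous fun w : Phase d => (w, t) := by fun_prop
  have h3 := h1.comp h2
  exact h3

/-- The term `⟨k, π(w) φ₀⟩ π(w) φ₀` of the Gabor expansion of `k`. -/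
def gaborTerm (k : 𝓢(Rd d, ℂ)) (w : Phase d) : 𝓢(Rd d, ℂ) :=
  gaussSTFT (k.toLp 2 volume) w • gaussianShift w

theorem iteratedFDeriv_gaborTerm (k : 𝓢(Rd d, ℂ)) (w : Phase d) (n : ℕ) (t : Rd d) :
    iteratedFDeriv ℝ n (gaborTerm k w) t =
      gaussSTFT (k.toLp 2 volume) w • iteratedFDeriv ℝ n (gaussianShift w) t :=
  iteratedFDeriv_const_smul_apply (((gaussianShift w).smooth n).contDiffAt)

theorem continuous_iteratedFDeriv_gaborTerm (k : 𝓢(Rd d, ℂ)) (n : ℕ) (t : Rd d) :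
    Continuous fun w : Phase d => iteratedFDeriv ℝ n (gaborTerm k w) t := by
  simp_rw [iteratedFDeriv_gaborTerm]
  exact (continuous_gaussSTFT _).smul (continuous_iteratedFDeriv_gaussianShift n t)

/-- The normalisation `‖φ₀‖ = 1` as an integral. -/
theorem integral_gaussian_mul_gaussian (d : ℕ) :
    ∫ t, gaussian d t * gaussian d t = 1 := by
  have h : (inner ℂ ((gaussian d).toLp 2 volume) ((gaussian d).toLp 2 volume) : ℂ) = 1 := by
    rw [inner_self_eq_norm_sq_to_K, norm_gaussian]
    simp
  rw [L2.inner_def] at h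
  rw [← h]
  refine integral_congr_ae ?_
  filter_upwards [(gaussian d).coeFn_toLp 2 volume] with t ht
  rw [ht, RCLike.inner_apply, gaussian_apply, Complex.conj_ofReal]

theorem norm_iteratedFDeriv_gaussianShift_le (d n : ℕ) :
    ∃ C : ℝ, 0 ≤ C ∧ ∀ (w : Phase d) (t : Rd d),
      ‖iteratedFDeriv ℝ n (gaussianShift w) t‖ ≤ C * (1 + ‖w‖) ^ n := by
  obtain ⟨C, hC, h⟩ := exists_schwartzNorm_gaussianShift_le (d := d) (0, n)
  refine ⟨C, hC, fun w t => ?_⟩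
  have h1 := one_add_pow_mul_le_schwartzNorm (m := (0, n)) le_rfl le_rfl (gaussianShift w) t
  simp only [pow_zero, one_mul, zero_add] at h1 h
  exact h1.trans (h w)

theorem norm_iteratedFDeriv_gaborTerm_le (k : 𝓢(Rd d, ℂ)) (n : ℕ) :
    ∃ C : ℝ, 0 ≤ C ∧ ∀ (w : Phase d) (t : Rd d), ‖iteratedFDeriv ℝ n (gaborTerm k w) t‖ ≤
      C * ((1 + ‖w‖) ^ n * ‖gaussSTFT (k.toLp 2 volume) w‖) := by
  obtain ⟨C, hC, h⟩ := norm_iteratedFDeriv_gaussianShift_le d n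
  refine ⟨C, hC, fun w t => ?_⟩
  rw [iteratedFDeriv_gaborTerm, norm_smul]
  calc _ ≤ ‖gaussSTFT (k.toLp 2 volume) w‖ * (C * (1 + ‖w‖) ^ n) := by
        gcongr
        exact h w t
    _ = _ := by ring

theorem integrable_iteratedFDeriv_gaborTerm (k : 𝓢(Rd d, ℂ)) (n : ℕ) (t : Rd d) :
    Integrable fun w : Phase d => iteratedFDeriv ℝ n (gaborTerm k w) t := by
  obtain ⟨C, -, h⟩ := norm_iteratedFDeriv_gaborTerm_le k n
  exact ((integrable_pow_mul_gaussSTFT k n).const_mul C).mono'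
    (continuous_iteratedFDeriv_gaborTerm k n t).aestronglyMeasurable
    (Filter.Eventually.of_forall fun w => h w t)

/-- The Gabor expansion of a Schwartz function, from Fourier inversion in `ω`. -/
theorem integral_gaussSTFT_mul_gaussianShift (k : 𝓢(Rd d, ℂ)) (t : Rd d) :
    ∫ w : Phase d, gaussSTFT (k.toLp 2 volume) w * gaussianShift w t = k t := by
  have hint : Integrable (fun w : Phase d =>
      gaussSTFT (k.toLp 2 volume) w * gaussianShift w t) := by
    have h := integrable_iteratedFDeriv_gaborTerm k 0 t
    simp only [iteratedFDeriv_zero_eq_comp, Function.comp_apply] at h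
    have h2 := (continuousMultilinearCurryFin0 ℝ (Rd d)
      ℂ).toContinuousLinearEquiv.toContinuousLinearMap.integrable_comp h
    refine h2.congr (Filter.Eventually.of_forall fun w => ?_)
    simp [gaborTerm]
  rw [Measure.volume_eq_prod] at hint ⊢
  rw [integral_prod _ hint]
  -- Fourier inversion for `k · φ₀(· - x)`, evaluated at `t`.
  have hx : ∀ x : Rd d, ∫ ω, gaussSTFT (k.toLp 2 volume) (x, ω) * gaussianShift (x, ω) t =
      k t * (gaussian d (t - x) * gaussian d (t - x)) := fun x => by
    have h1 : (FourierTransformInv.fourierInv (FourierTransform.fourier (windowed x k)) :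
        𝓢(Rd d, ℂ)) t = windowed x k t := by
      rw [FourierTransform.fourierInv_fourier_eq]
    rw [SchwartzMap.fourierInv_coe, Real.fourierInv_eq'] at h1
    rw [windowed_apply] at h1
    rw [← mul_assoc, ← h1, ← integral_mul_const]
    refine integral_congr_ae (Filter.Eventually.of_forall fun ω => ?_)
    dsimp only
    rw [gaussSTFT_schwartz, gaussianShift_apply, character, smul_eq_mul]
    push_cast
    ring
  simp_rw [hx]
  rw [integral_const_mul,
    integral_sub_left_eq_self (fun x => gaussian d x * gaussian d x) volume t,
    integral_gaussian_mul_gaussian, mul_one]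

/-- The Gabor expansion may be differentiated termwise. -/
theorem integral_iteratedFDeriv_gaborTerm (k : 𝓢(Rd d, ℂ)) (n : ℕ) (t : Rd d) :
    ∫ w : Phase d, iteratedFDeriv ℝ n (gaborTerm k w) t = iteratedFDeriv ℝ n k t := by
  induction n generalizing t with
  | zero =>
    simp only [iteratedFDeriv_zero_eq_comp, Function.comp_apply]
    have h := (continuousMultilinearCurryFin0 ℝ (Rd d)
      ℂ).symm.toContinuousLinearEquiv.integral_comp_comm (μ := volume)
        fun w : Phase d => gaborTerm k w t
    refine h.trans ?_
    have e : ∫ w : Phase d, gaborTerm k w t = k t := integral_gaussSTFT_mul_gaussianShift k t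
    rw [e]
    rfl
  | succ n ih =>
    obtain ⟨C, hC, hb⟩ := norm_iteratedFDeriv_gaborTerm_le k (n + 1)
    have hcd : ∀ w : Phase d, Differentiable ℝ (iteratedFDeriv ℝ n (gaborTerm k w)) := fun w =>
      ((gaborTerm k w).smooth ⊤).differentiable_iteratedFDeriv
        (by exact_mod_cast WithTop.coe_lt_top n)
    have hmeas : AEStronglyMeasurable
        (fun w : Phase d => fderiv ℝ (iteratedFDeriv ℝ n (gaborTerm k w)) t) volume := by
      have h := (uncurryDeriv d n).symm.continuous.comp_aestronglyMeasurable (μ := volume)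
        (continuous_iteratedFDeriv_gaborTerm k (n + 1) t).aestronglyMeasurable
      refine h.congr (Filter.Eventually.of_forall fun w => ?_)
      exact (uncurryDeriv d n).symm_apply_apply _
    -- Differentiation under the integral sign, with a majorant that does not depend on `t`.
    have hderiv := hasFDerivAt_integral_of_dominated_of_fderiv_le (𝕜 := ℝ) (μ := volume)
      (F := fun t (w : Phase d) => iteratedFDeriv ℝ n (gaborTerm k w) t)
      (F' := fun t (w : Phase d) => fderiv ℝ (iteratedFDeriv ℝ n (gaborTerm k w)) t)
      (bound := fun w => C * ((1 + ‖w‖) ^ (n + 1) * ‖gaussSTFT (k.toLp 2 volume) w‖))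
      (s := Set.univ) (x₀ := t) Filter.univ_mem
      (Filter.Eventually.of_forall fun s =>
        (integrable_iteratedFDeriv_gaborTerm k n s).aestronglyMeasurable)
      (integrable_iteratedFDeriv_gaborTerm k n t)
      hmeas
      (Filter.Eventually.of_forall fun w s _ => by
        rw [norm_fderiv_iteratedFDeriv]
        exact hb w s)
      ((integrable_pow_mul_gaussSTFT k (n + 1)).const_mul C)
      (Filter.Eventually.of_forall fun w s _ => (hcd w s).hasFDerivAt)
    simp_rw [ih] at hderiv
    simp only [iteratedFDeriv_succ_eq_uncurryDeriv]
    have h := ContinuousLinearEquiv.integral_comp_comm (𝕜 := ℝ)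
      (E := Rd d →L[ℝ] (Rd d [×n]→L[ℝ] ℂ)) (F := Rd d [×(n + 1)]→L[ℝ] ℂ) (μ := volume)
      (uncurryDeriv d n) fun w : Phase d => fderiv ℝ (iteratedFDeriv ℝ n (gaborTerm k w)) t
    refine h.trans ?_
    have e : ∫ w : Phase d, fderiv ℝ (iteratedFDeriv ℝ n (gaborTerm k w)) t =
      fderiv ℝ (iteratedFDeriv ℝ n k) t := hderiv.fderiv.symm
    rw [e]

/-- The Schwartz seminorms are controlled by weighted `L¹` norms of the STFT: differentiate the
Gabor expansion termwise and use the polynomial growth of the seminorms of `π(w) φ₀`. -/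
theorem schwartzNorm_le_integral (d : ℕ) (m : ℕ × ℕ) :
    ∃ C : ℝ, 0 ≤ C ∧ ∀ k : 𝓢(Rd d, ℂ), schwartzNorm d m k ≤
      C * ∫ w : Phase d, (1 + ‖w‖) ^ (m.1 + m.2) * ‖gaussSTFT (k.toLp 2 volume) w‖ := by
  obtain ⟨C, hC, h⟩ := exists_schwartzNorm_gaussianShift_le (d := d) m
  have hi : ∀ k : 𝓢(Rd d, ℂ), 0 ≤
      ∫ w : Phase d, (1 + ‖w‖) ^ (m.1 + m.2) * ‖gaussSTFT (k.toLp 2 volume) w‖ := fun k =>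
    integral_nonneg fun w => by positivity
  refine ⟨2 ^ m.1 * C, by positivity, fun k => schwartzNorm_le_of_forall
    (mul_nonneg (by positivity) (hi k)) fun n hn t => ?_⟩
  rw [← integral_iteratedFDeriv_gaborTerm k n t, ← integral_const_mul]
  calc (1 + ‖t‖) ^ m.1 * ‖∫ w : Phase d, iteratedFDeriv ℝ n (gaborTerm k w) t‖
      = ‖∫ w : Phase d, ((1 + ‖t‖) ^ m.1 : ℝ) • iteratedFDeriv ℝ n (gaborTerm k w) t‖ := by
        rw [integral_smul, norm_smul, Real.norm_of_nonneg (by positivity)]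
    _ ≤ _ := by
        refine norm_integral_le_of_norm_le
          ((integrable_pow_mul_gaussSTFT k (m.1 + m.2)).const_mul _)
          (Filter.Eventually.of_forall fun w => ?_)
        rw [iteratedFDeriv_gaborTerm, norm_smul, norm_smul, Real.norm_of_nonneg (by positivity)]
        have h1 := one_add_pow_mul_le_schwartzNorm (m := m) le_rfl hn (gaussianShift w) t
        have h2 := h1.trans (mul_le_mul_of_nonneg_left (h w) (by positivity))
        calc _ = ‖gaussSTFT (k.toLp 2 volume) w‖ *
              ((1 + ‖t‖) ^ m.1 * ‖iteratedFDeriv ℝ n (gaussianShift w) t‖) := by ring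
          _ ≤ ‖gaussSTFT (k.toLp 2 volume) w‖ * (2 ^ m.1 * (C * (1 + ‖w‖) ^ (m.1 + m.2))) :=
              mul_le_mul_of_nonneg_left h2 (norm_nonneg _)
          _ = _ := by ring

end GaussianExpansion

/-! ### Inversion of the short-time Fourier transform of tempered distributions -/

section Inversion

variable {d : ℕ}

/-- A linear functional that is bounded for the seminorm `‖ι ·‖` factors through `ι` by a continuous
functional, by Hahn–Banach on the range of `ι`. -/
theorem exists_clm_comp_eq {E F : Type*} [AddCommGroup E] [Module ℂ E] [NormedAddCommGroup F]
    [NormedSpace ℂ F] (ι : E →ₗ[ℂ] F) (u : E →ₗ[ℂ] ℂ) (C : ℝ)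
    (h : ∀ k, ‖u k‖ ≤ C * ‖ι k‖) : ∃ g : F →L[ℂ] ℂ, ∀ k, g (ι k) = u k := by
  have hker : LinearMap.ker ι ≤ LinearMap.ker u := fun k hk => by
    have := h k
    rw [LinearMap.mem_ker.1 hk, norm_zero, mul_zero] at this
    exact LinearMap.mem_ker.2 (norm_le_zero_iff.1 this)
  set f : LinearMap.range ι →ₗ[ℂ] ℂ :=
    (LinearMap.ker ι).liftQ u hker ∘ₗ ι.quotKerEquivRange.symm.toLinearMap with hf
  have hfu : ∀ k, f ⟨ι k, LinearMap.mem_range_self ι k⟩ = u k := fun k => by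
    rw [hf, LinearMap.comp_apply, LinearEquiv.coe_coe, LinearMap.quotKerEquivRange_symm_apply_image,
      Submodule.mkQ_apply, Submodule.liftQ_apply]
  obtain ⟨g, hg, -⟩ := exists_extension_norm_eq (LinearMap.range ι) (f.mkContinuous C (by
    rintro ⟨_, k, rfl⟩
    rw [hfu]
    exact h k))
  refine ⟨g, fun k => ?_⟩
  rw [← hfu k]
  exact hg ⟨ι k, LinearMap.mem_range_self ι k⟩

theorem memLp_one_add_norm_pow_inv (d : ℕ) :
    MemLp (fun w : Phase d => ((1 + ‖w‖) ^ (2 * d + 1))⁻¹) 2 volume := by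
  have hc : Continuous fun w : Phase d => ((1 + ‖w‖) ^ (2 * d + 1))⁻¹ :=
    Continuous.inv₀ (by fun_prop) fun w => by positivity
  rw [memLp_two_iff_integrable_sq hc.aestronglyMeasurable]
  refine (integrable_one_add_norm_pow_inv d).mono' (hc.pow 2).aestronglyMeasurable
    (Filter.Eventually.of_forall fun w => ?_)
  rw [Real.norm_of_nonneg (by positivity), sq]
  refine mul_le_of_le_one_left (by positivity) (inv_le_one_of_one_le₀ ?_)
  exact one_le_pow₀ (by linarith [norm_nonneg w])

theorem memLp_weighted_gaussSTFT (k : 𝓢(Rd d, ℂ)) (M : ℕ) :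
    MemLp (fun w : Phase d => (((1 + ‖w‖) ^ M : ℝ) : ℂ) * gaussSTFT (k.toLp 2 volume) w)
      2 volume := by
  obtain ⟨C, hC, h⟩ := norm_gaussSTFT_le k M
  refine ((memLp_one_add_norm_pow_inv d).const_mul C).mono' ?_
    (Filter.Eventually.of_forall fun w => ?_)
  · have := continuous_gaussSTFT (k.toLp 2 volume)
    exact Continuous.aestronglyMeasurable (by fun_prop)
  · rw [norm_mul, Complex.norm_real, Real.norm_of_nonneg (by positivity)]
    exact h w

/-- The map taking a Schwartz function to its weighted STFT in `L²`. -/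
def weightedSTFT (d M : ℕ) : 𝓢(Rd d, ℂ) →ₗ[ℂ] Lp ℂ 2 (volume : Measure (Phase d)) where
  toFun k := (memLp_weighted_gaussSTFT k M).toLp _
  map_add' k l := by
    rw [← MemLp.toLp_add]
    refine MemLp.toLp_congr _ _ (Filter.Eventually.of_forall fun w => ?_)
    have e : (k + l).toLp 2 volume = k.toLp 2 volume + l.toLp 2 volume :=
      map_add (SchwartzMap.toLpCLM ℂ (E := Rd d) ℂ 2 volume) k l
    simp only [gaussSTFT, e, inner_add_right, Pi.add_apply, mul_add]
  map_smul' c k := by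
    rw [RingHom.id_apply, ← MemLp.toLp_const_smul]
    refine MemLp.toLp_congr _ _ (Filter.Eventually.of_forall fun w => ?_)
    have e : (c • k).toLp 2 volume = c • k.toLp 2 volume :=
      map_smul (SchwartzMap.toLpCLM ℂ (E := Rd d) ℂ 2 volume) c k
    simp only [gaussSTFT, e, inner_smul_right, Pi.smul_apply, smul_eq_mul]
    ring

theorem norm_toLp_two {α : Type*} [MeasurableSpace α] {μ : Measure α} {f : α → ℂ}
    (hf : MemLp f 2 μ) : ‖hf.toLp f‖ = (∫ w, ‖f w‖ ^ (2 : ℝ) ∂μ) ^ (1 / (2 : ℝ)) := by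
  rw [Lp.norm_toLp, hf.eLpNorm_eq_integral_rpow_norm (by norm_num) (by norm_num),
    ENNReal.toReal_ofReal (by positivity)]
  simp

/-- A tempered distribution is represented by a square integrable function on phase space: it is
bounded for a weighted `L²` norm of the STFT, so that the theorems of Hahn–Banach and Riesz
apply. -/
theorem exists_tempered_eq_integral (u : 𝓢'(Rd d, ℂ)) :
    ∃ (b : Lp ℂ 2 (volume : Measure (Phase d))) (M : ℕ), ∀ k : 𝓢(Rd d, ℂ),
      u k = ∫ w : Phase d, conj (b w) *
        ((((1 + ‖w‖) ^ M : ℝ) : ℂ) * gaussSTFT (k.toLp 2 volume) w) := by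
  obtain ⟨C, m, hC, h⟩ := exists_norm_tempered_le u
  obtain ⟨C', hC', h'⟩ := schwartzNorm_le_integral d m
  set M := m.1 + m.2 + (2 * d + 1) with hM
  set R : ℝ := (∫ w : Phase d, ‖((1 + ‖w‖) ^ (2 * d + 1))⁻¹‖ ^ (2 : ℝ)) ^ (1 / (2 : ℝ)) with hR
  have hbound : ∀ k, ‖(u : 𝓢(Rd d, ℂ) →ₗ[ℂ] ℂ) k‖ ≤ C * C' * R * ‖weightedSTFT d M k‖ := fun k => by
    -- Cauchy–Schwarz turns the weighted `L¹` norm of the STFT into an `L²` norm; the exponent `M`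
    -- leaves room for the square integrable factor `(1 + |w|)^(-(2d + 1))`.
    have hCS := integral_mul_norm_le_Lp_mul_Lq (μ := (volume : Measure (Phase d)))
      (f := fun w : Phase d => ((1 + ‖w‖) ^ (2 * d + 1))⁻¹)
      (g := fun w : Phase d => ‖(((1 + ‖w‖) ^ M : ℝ) : ℂ) * gaussSTFT (k.toLp 2 volume) w‖)
      Real.HolderConjugate.two_two (by simpa using memLp_one_add_norm_pow_inv d)
      (by simpa using (memLp_weighted_gaussSTFT k M).norm)
    simp only [norm_norm] at hCS
    rw [← norm_toLp_two (memLp_weighted_gaussSTFT k M)] at hCS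
    have e : ∀ w : Phase d, (1 + ‖w‖) ^ (m.1 + m.2) * ‖gaussSTFT (k.toLp 2 volume) w‖ =
        ‖((1 + ‖w‖) ^ (2 * d + 1))⁻¹‖ *
          ‖(((1 + ‖w‖) ^ M : ℝ) : ℂ) * gaussSTFT (k.toLp 2 volume) w‖ := fun w => by
      rw [norm_mul, Complex.norm_real, Real.norm_of_nonneg (by positivity),
        Real.norm_of_nonneg (by positivity), hM, pow_add _ (m.1 + m.2)]
      field_simp
    calc ‖u k‖ ≤ C * schwartzNorm d m k := h k
      _ ≤ C * (C' * (R * ‖weightedSTFT d M k‖)) := by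
        refine mul_le_mul_of_nonneg_left ((h' k).trans
          (mul_le_mul_of_nonneg_left ?_ hC')) hC
        simp_rw [e]
        exact hCS
      _ = _ := by ring
  obtain ⟨g, hg⟩ := exists_clm_comp_eq (weightedSTFT d M) (u : 𝓢(Rd d, ℂ) →ₗ[ℂ] ℂ) _ hbound
  refine ⟨(InnerProductSpace.toDual ℂ _).symm g, M, fun k => ?_⟩
  have h1 : u k = inner ℂ ((InnerProductSpace.toDual ℂ _).symm g) (weightedSTFT d M k) := by
    rw [InnerProductSpace.toDual_symm_apply, hg]
    rfl
  rw [h1, L2.inner_def]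
  refine integral_congr_ae ?_
  filter_upwards [(memLp_weighted_gaussSTFT k M).coeFn_toLp] with w hw
  have hw' : (weightedSTFT d M k : Phase d → ℂ) w =
    (((1 + ‖w‖) ^ M : ℝ) : ℂ) * gaussSTFT (k.toLp 2 volume) w := hw
  rw [hw', RCLike.inner_apply, mul_comm]

theorem gaussSTFT_gaussianShift (w w' : Phase d) :
    gaussSTFT ((gaussianShift w').toLp 2 volume) w =
      inner ℂ (timeFreqShift w ((gaussian d).toLp 2 volume))
        (timeFreqShift w' ((gaussian d).toLp 2 volume)) := by
  rw [gaussSTFT, timeFreqShift_gaussian w']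

/-- Inversion formula for the STFT of a tempered distribution: in the representation of `u` by a
function on phase space, Moyal's identity gives the reproducing formula of the STFT under the
integral. -/
theorem tempered_inversion (u : 𝓢'(Rd d, ℂ)) (k : 𝓢(Rd d, ℂ)) :
    Integrable (fun w : Phase d => u (gaussianShift w) * gaussSTFT (k.toLp 2 volume) w) ∧
      ∫ w : Phase d, u (gaussianShift w) * gaussSTFT (k.toLp 2 volume) w = u k := by
  obtain ⟨b, M, hb⟩ := exists_tempered_eq_integral u
  obtain ⟨C, m, hC, hdec⟩ := exists_gaussSTFT_decay d (M + (2 * d + 1))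
  obtain ⟨C', hC', hgs⟩ := exists_schwartzNorm_gaussianShift_le (d := d) m
  set φ := (gaussian d).toLp 2 volume with hφ
  set K : Phase d → Phase d → ℂ := fun w' w => conj (b w) * ((((1 + ‖w‖) ^ M : ℝ) : ℂ) *
    gaussSTFT ((gaussianShift w').toLp 2 volume) w) * gaussSTFT (k.toLp 2 volume) w' with hK
  have hbρ : Integrable fun w : Phase d => ‖b w‖ * ((1 + ‖w‖) ^ (2 * d + 1))⁻¹ :=
    (Lp.memLp b).norm.integrable_mul (memLp_one_add_norm_pow_inv d)
  -- `K w' w` integrates in `w` to the integrand of the formula and in `w'` to the representation of `u k`.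
  have hint : Integrable (Function.uncurry K) (volume.prod volume) := by
    refine (((integrable_pow_mul_gaussSTFT k (m.1 + m.2)).mul_prod hbρ).const_mul (C * C')).mono'
      ?_ (Filter.Eventually.of_forall fun y => ?_)
    · simp only [hK, gaussSTFT_gaussianShift]
      have h1 : AEStronglyMeasurable (fun y : Phase d × Phase d => conj (b y.2))
          ((volume : Measure (Phase d)).prod (volume : Measure (Phase d))) :=
        Complex.continuous_conj.comp_aestronglyMeasurable
          (Lp.aestronglyMeasurable b).comp_snd
      have h2 : Continuous fun y : Phase d × Phase d => (((((1 + ‖y.2‖) ^ M : ℝ) : ℂ) *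
          inner ℂ (timeFreqShift y.2 φ) (timeFreqShift y.1 φ)) *
          gaussSTFT (k.toLp 2 volume) y.1) := by
        have c1 := continuous_timeFreqShift φ
        have c2 := continuous_gaussSTFT (k.toLp 2 volume)
        refine ((by fun_prop : Continuous fun y : Phase d × Phase d =>
          (((1 + ‖y.2‖) ^ M : ℝ) : ℂ)).mul ?_).mul (c2.comp continuous_fst)
        exact (c1.comp continuous_snd).inner (c1.comp continuous_fst)
      refine (h1.mul h2.aestronglyMeasurable).congr (Filter.Eventually.of_forall fun y => ?_)
      simp only [Pi.mul_apply, Function.uncurry, hφ, mul_assoc]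
    · obtain ⟨w', w⟩ := y
      have h1 := (hdec (gaussianShift w') w).trans (mul_le_mul_of_nonneg_left (hgs w') hC)
      have h2 : (1 + ‖w‖) ^ M * ‖gaussSTFT ((gaussianShift w').toLp 2 volume) w‖ ≤
          C * (C' * (1 + ‖w'‖) ^ (m.1 + m.2)) * ((1 + ‖w‖) ^ (2 * d + 1))⁻¹ := by
        rw [← div_eq_mul_inv, le_div_iff₀ (by positivity)]
        refine le_trans (le_of_eq ?_) h1
        rw [pow_add]
        ring
      simp only [Function.uncurry_apply_pair, hK, norm_mul, RCLike.norm_conj, Complex.norm_real]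
      rw [Real.norm_of_nonneg (by positivity : (0:ℝ) ≤ (1 + ‖w‖) ^ M)]
      calc _ ≤ ‖b w‖ * (C * (C' * (1 + ‖w'‖) ^ (m.1 + m.2)) * ((1 + ‖w‖) ^ (2 * d + 1))⁻¹) *
            ‖gaussSTFT (k.toLp 2 volume) w'‖ :=
          mul_le_mul_of_nonneg_right (mul_le_mul_of_nonneg_left h2 (norm_nonneg _)) (norm_nonneg _)
        _ = _ := by ring
  have e1 : ∀ w', ∫ w, K w' w = u (gaussianShift w') * gaussSTFT (k.toLp 2 volume) w' :=
    fun w' => by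
      rw [hb (gaussianShift w'), ← integral_mul_const]
  -- Moyal's identity with both windows equal to `φ₀`.
  have e2 : ∀ w, ∫ w', K w' w =
      conj (b w) * ((((1 + ‖w‖) ^ M : ℝ) : ℂ) * gaussSTFT (k.toLp 2 volume) w) := fun w => by
    have h := integral_inner_mul_inner (timeFreqShift w φ) (k.toLp 2 volume) φ φ
    rw [inner_self_eq_norm_sq_to_K, hφ, norm_gaussian] at h
    simp only [hK, mul_assoc]
    rw [integral_const_mul, integral_const_mul]
    simp only [gaussSTFT_gaussianShift]
    congr 2
    refine h.trans ?_
    simp [gaussSTFT]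
  refine ⟨hint.integral_prod_left.congr (Filter.Eventually.of_forall e1), ?_⟩
  simp_rw [← e1]
  rw [integral_integral_swap hint]
  simp_rw [e2]
  exact (hb k).symm

end Inversion

/-! ### Admissible windows and the Gaussian window -/

section Windows

variable {d : ℕ} {v m : Weight d} {p q : ℝ≥0∞}

/-- The reflected weight `z ↦ v (-z)`. It enters because `𝔙_R Q` and `𝔙_Q R` have the same norm at
opposite points, while `v` need not be symmetric. -/
def Weight.reflect (v : Weight d) : Weight d where
  toFun z := v (-z)
  pos z := v.pos (-z)
  locallyIntegrable := by
    intro z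
    obtain ⟨U, hU, hv⟩ := v.locallyIntegrable (-z)
    refine ⟨Neg.neg ⁻¹' U, continuous_neg.continuousAt.preimage_mem_nhds hU, ?_⟩
    exact ((Measure.measurePreserving_neg (volume : Measure (Phase d))).integrableOn_comp_preimage
      (MeasurableEquiv.neg (Phase d)).measurableEmbedding).2 hv

theorem Weight.IsSubmultiplicative.reflect (hv : v.IsSubmultiplicative) :
    v.reflect.IsSubmultiplicative := fun z w => by
  change v (-(z + w)) ≤ v (-z) * v (-w)
  rw [neg_add]
  exact hv _ _

theorem Weight.HasPolynomialGrowth.reflect (hv : v.HasPolynomialGrowth) :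
    v.reflect.HasPolynomialGrowth := by
  obtain ⟨C, N, h⟩ := hv
  refine ⟨C, N, fun z => ?_⟩
  change v (-z) ≤ _
  simpa only [norm_neg] using h (-z)

theorem kernelNorm_reflect (v : Weight d) (R Q : HS d) :
    kernelNorm v.reflect R Q = kernelNorm v Q R := by
  have h := lintegral_neg_eq_self (μ := (volume : Measure (Phase d)))
    fun z => ENNReal.ofReal (v z) * ‖opSTFT Q R z‖ₑ
  rw [kernelNorm, kernelNorm, ← h]
  refine lintegral_congr fun z => ?_
  rw [← ofReal_norm (opSTFT Q R (-z)), norm_opSTFT_neg, ofReal_norm]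
  rfl

theorem opSTFT_gaussianWindow_rankOne (e₀ e γ : L2 d) (z : Phase d) :
    opSTFT (gaussianWindow e₀) (HSOp.rankOne γ e) z = gaussSTFT γ z • HSOp.rankOne e₀ e := by
  refine HSOp.ext_inner fun f g => ?_
  rw [inner_opSTFT, gaussianWindow, HSOp.toCLM_rankOne, HSOp.toCLM_rankOne, map_smul, map_smul,
    smul_apply, HSOp.toCLM_rankOne, inner_smul_left, inner_smul_right, inner_smul_right,
    inner_smul_right, inner_conj_symm, gaussSTFT]
  ring

/-- Operators `γ ⊗ e` with `γ` in the Schwartz space have a rapidly decaying STFT for the Gaussian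
window, which compensates for every weight of polynomial growth. -/
theorem exists_weight_mul_opSTFT_rankOne_le (hvp : v.HasPolynomialGrowth) (e₀ e : L2 d)
    (γ : 𝓢(Rd d, ℂ)) : ∃ C : ℝ, 0 ≤ C ∧ ∀ z, ENNReal.ofReal (v z) *
      ‖opSTFT (gaussianWindow e₀) (HSOp.rankOne (γ.toLp 2 volume) e) z‖ₑ ≤
        ENNReal.ofReal C * ENNReal.ofReal ((1 + ‖z‖) ^ (-(2 * ((d : ℝ) + 1)))) := by
  obtain ⟨C, N, h⟩ := hvp
  have hC : 0 ≤ C := by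
    have := (v.pos 0).le.trans (h 0)
    simpa using this
  obtain ⟨D, n, hD, hdec⟩ := exists_gaussSTFT_decay d (N + 2 * (d + 1))
  refine ⟨C * (D * schwartzNorm d n γ) * (‖e₀‖ * ‖e‖), by positivity, fun z => ?_⟩
  rw [← ENNReal.ofReal_mul (by positivity), ← ofReal_norm,
    ← ENNReal.ofReal_mul (v.pos z).le]
  refine ENNReal.ofReal_le_ofReal ?_
  rw [opSTFT_gaussianWindow_rankOne, norm_smul, HSOp.norm_rankOne,
    Real.rpow_neg (by positivity),
    show 2 * ((d : ℝ) + 1) = ((2 * (d + 1) : ℕ) : ℝ) by push_cast; rfl,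
    Real.rpow_natCast, ← div_eq_mul_inv, le_div_iff₀ (by positivity)]
  calc v z * (‖gaussSTFT (γ.toLp 2 volume) z‖ * (‖e₀‖ * ‖e‖)) * (1 + ‖z‖) ^ (2 * (d + 1))
      ≤ (C * (1 + ‖z‖) ^ N) * (‖gaussSTFT (γ.toLp 2 volume) z‖ * (‖e₀‖ * ‖e‖)) *
          (1 + ‖z‖) ^ (2 * (d + 1)) := by
        gcongr
        exact h z
    _ = C * ((1 + ‖z‖) ^ (N + 2 * (d + 1)) * ‖gaussSTFT (γ.toLp 2 volume) z‖) *
          (‖e₀‖ * ‖e‖) := by rw [pow_add]; ring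
    _ ≤ _ := mul_le_mul_of_nonneg_right
        (mul_le_mul_of_nonneg_left (hdec γ z) hC) (by positivity)

theorem lintegral_phase_decay_lt_top (d : ℕ) :
    ∫⁻ z : Phase d, ENNReal.ofReal ((1 + ‖z‖) ^ (-(2 * ((d : ℝ) + 1)))) < ∞ := by
  have h := integrable_one_add_norm (E := Phase d) (μ := volume) (r := 2 * ((d : ℝ) + 1)) (by
    simp only [Module.finrank_prod, finrank_euclideanSpace, Fintype.card_fin]
    push_cast
    linarith)
  have h2 := h.2
  rw [hasFiniteIntegral_iff_ofReal (Filter.Eventually.of_forall fun x => by positivity)] at h2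
  exact h2

theorem kernelNorm_gaussianWindow_rankOne_lt_top (hvp : v.HasPolynomialGrowth) (e₀ e : L2 d)
    (γ : 𝓢(Rd d, ℂ)) :
    kernelNorm v (gaussianWindow e₀) (HSOp.rankOne (γ.toLp 2 volume) e) < ∞ := by
  obtain ⟨C, -, h⟩ := exists_weight_mul_opSTFT_rankOne_le hvp e₀ e γ
  refine (lintegral_mono h).trans_lt ?_
  rw [lintegral_const_mul' _ _ ENNReal.ofReal_ne_top]
  exact ENNReal.mul_lt_top ENNReal.ofReal_lt_top (lintegral_phase_decay_lt_top d)

theorem kernelNorm_gaussianWindow_self_lt_top (hvp : v.HasPolynomialGrowth) (e₀ : L2 d) :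
    kernelNorm v (gaussianWindow e₀) (gaussianWindow e₀) < ∞ :=
  kernelNorm_gaussianWindow_rankOne_lt_top hvp e₀ e₀ (gaussian d)

theorem conj_traceInner (R S : HS d) : conj (HSOp.traceInner R S) = HSOp.traceInner S R := by
  have h := (HSOp.hasSum_traceInner R S).map (starRingEnd ℂ) Complex.continuous_conj
  refine h.unique ?_
  convert HSOp.hasSum_traceInner S R using 2 with i
  exact inner_conj_symm _ _

/-- Some rank one operator `γ ⊗ e` with Schwartz `γ` is not orthogonal to a given nonzero operator
in the Hilbert–Schmidt inner product. -/
theorem exists_traceInner_rankOne_ne_zero {S : HS d} (hS : S ≠ 0) :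
    ∃ (γ : 𝓢(Rd d, ℂ)) (e : L2 d),
      HSOp.traceInner S (HSOp.rankOne (γ.toLp 2 volume) e) ≠ 0 := by
  obtain ⟨i, hi⟩ : ∃ i, HSOp.toCLM S (onb (L2 d) i) ≠ 0 := by
    by_contra! h
    refine hS (HSOp.toCLM_injective (HSOp.ext_onb fun i => ?_))
    rw [h i, map_zero, zero_apply]
  obtain ⟨γ, hγ⟩ : ∃ γ : 𝓢(Rd d, ℂ),
      (inner ℂ (γ.toLp 2 volume) (HSOp.toCLM S (onb (L2 d) i)) : ℂ) ≠ 0 := by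
    by_contra! h
    refine hi ((SchwartzMap.denseRange_toLpCLM (E := Rd d) (F := ℂ) (p := 2) (μ := volume)
      (by norm_num)).eq_zero_of_inner_right ℂ h)
  refine ⟨γ, onb (L2 d) i, fun h => hγ ?_⟩
  rw [← HSOp.traceInner_rankOne, ← conj_traceInner, h, map_zero]

/-- Admissibility passes from `𝔙_S S` to `𝔙_{S₀} S`: convolve `𝔙_S S` with `𝔙_{S₀} R`, where `R` is
a Schwartz operator of rank one that is not orthogonal to `S`. -/
theorem kernelNorm_gaussianWindow_lt_top (hv : v.IsSubmultiplicative)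
    (hvp : v.HasPolynomialGrowth) (e₀ : L2 d) {S : HS d} (hS : kernelNorm v S S < ∞) :
    kernelNorm v (gaussianWindow e₀) S < ∞ := by
  rcases eq_or_ne S 0 with rfl | hS0
  · have h : ∀ z, opSTFT (gaussianWindow e₀) (0 : HS d) z = 0 := fun z => by
      have := opSTFT_smul (gaussianWindow e₀) (0 : HS d) (0 : ℂ) z
      simpa using this
    simp [kernelNorm, h]
  obtain ⟨γ, e, hne⟩ := exists_traceInner_rankOne_ne_zero hS0
  set R := HSOp.rankOne (γ.toLp 2 volume) e with hR
  have hkR := kernelNorm_gaussianWindow_rankOne_lt_top hvp e₀ e γ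
  have hc := (continuous_opSTFT S S).aestronglyMeasurable (μ := volume)
  have hmem : MemLpqm 1 1 v (opSTFT S S) := ⟨hc, by rwa [weightedNorm_one_one v hc]⟩
  have hle := memLpqm_twistedConv hv le_rfl le_rfl hkR hmem
  have heq : twistedConv (opSTFT S S) (opSTFT (gaussianWindow e₀) R) =ᵐ[volume]
      HSOp.traceInner S R • opSTFT (gaussianWindow e₀) S := by
    filter_upwards [ae_integrable_twistedIntegrand hv le_rfl le_rfl hkR hmem] with z hz
    exact twistedConv_opSTFT hz
  have h1 := hle.2
  rw [weightedNorm_congr_ae heq, weightedNorm_smul,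
    weightedNorm_one_one v (continuous_opSTFT _ _).aestronglyMeasurable] at h1
  refine lt_of_le_of_ne le_top fun h0 => ?_
  rw [kernelNorm] at h0
  rw [h0, ENNReal.mul_top (by simpa using hne)] at h1
  exact h1.ne rfl

/-- The kernel in the opposite direction, by the same argument for the reflected weight. -/
theorem kernelNorm_gaussianWindow_right_lt_top (hv : v.IsSubmultiplicative)
    (hvp : v.HasPolynomialGrowth) (e₀ : L2 d) {S : HS d} (hS : kernelNorm v S S < ∞) :
    kernelNorm v S (gaussianWindow e₀) < ∞ := by
  rw [← kernelNorm_reflect]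
  exact kernelNorm_gaussianWindow_lt_top hv.reflect hvp.reflect e₀ (by rwa [kernelNorm_reflect])

theorem norm_gaussianWindow {e₀ : L2 d} (he₀ : ‖e₀‖ = 1) : ‖gaussianWindow e₀‖ = 1 := by
  rw [gaussianWindow, HSOp.norm_rankOne, norm_gaussian, he₀, mul_one]

end Windows

/-! ### Change of window -/

section Pairing

variable {d : ℕ}

theorem measurePreserving_neg_snd (d : ℕ) :
    MeasurePreserving ((MeasurableEquiv.refl (Rd d)).prodCongr (MeasurableEquiv.neg (Rd d)))
      (volume : Measure (Phase d)) volume :=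
  (MeasurePreserving.id (volume : Measure (Rd d))).prod
    (Measure.measurePreserving_neg (volume : Measure (Rd d)))

/-- The Gaussian is real, so that complex conjugation reflects the frequency variable. -/
theorem inner_timeFreqShift_gaussian_neg_snd (w z : Phase d) :
    (inner ℂ (timeFreqShift (w.1, -w.2) ((gaussian d).toLp 2 volume))
      (timeFreqShift (z.1, -z.2) ((gaussian d).toLp 2 volume)) : ℂ) =
      conj (inner ℂ (timeFreqShift w ((gaussian d).toLp 2 volume))
        (timeFreqShift z ((gaussian d).toLp 2 volume))) := by
  simp only [timeFreqShift_gaussian, L2.inner_def]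
  rw [← integral_conj]
  refine integral_congr_ae ?_
  filter_upwards [(gaussianShift (w.1, -w.2)).coeFn_toLp 2 volume,
    (gaussianShift (z.1, -z.2)).coeFn_toLp 2 volume, (gaussianShift w).coeFn_toLp 2 volume,
    (gaussianShift z).coeFn_toLp 2 volume] with t h1 h2 h3 h4
  rw [h1, h2, h3, h4, conj_gaussianShift, conj_gaussianShift, RCLike.inner_apply,
    RCLike.inner_apply, map_mul]

/-- The pairing with `π(z) φ₀` is the value of the STFT at `z`. -/
theorem hasPairing_gaussian (u : 𝓢'(Rd d, ℂ)) (z : Phase d) :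
    HasPairing u (timeFreqShift z ((gaussian d).toLp 2 volume)) (distSTFT u z) := by
  obtain ⟨h1, h2⟩ := tempered_inversion u (gaussianShift (z.1, -z.2))
  have e : (fun w : Phase d => distSTFT u w *
      conj (gaussSTFT (timeFreqShift z ((gaussian d).toLp 2 volume)) w)) =
      (fun w : Phase d => u (gaussianShift w) *
        gaussSTFT ((gaussianShift (z.1, -z.2)).toLp 2 volume) w) ∘
        (MeasurableEquiv.refl (Rd d)).prodCongr (MeasurableEquiv.neg (Rd d)) := by
    funext w
    change _ = u (gaussianShift (w.1, -w.2)) *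
        gaussSTFT ((gaussianShift (z.1, -z.2)).toLp 2 volume) (w.1, -w.2)
    rw [gaussSTFT_gaussianShift, inner_timeFreqShift_gaussian_neg_snd]
    rfl
  rw [HasPairing, e]
  refine ⟨((measurePreserving_neg_snd d).integrable_comp_emb
    (MeasurableEquiv.measurableEmbedding _)).2 h1, ?_⟩
  exact ((measurePreserving_neg_snd d).integral_comp' _).trans h2

theorem HasPairing.smul {u : 𝓢'(Rd d, ℂ)} {h : L2 d} {a : ℂ} (hu : HasPairing u h a) (c : ℂ) :
    HasPairing u (c • h) (conj c * a) := by
  have e : ∀ w, distSTFT u w * conj (gaussSTFT (c • h) w) =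
      conj c * (distSTFT u w * conj (gaussSTFT h w)) := fun w => by
    rw [gaussSTFT, inner_smul_right, map_mul]
    simp only [gaussSTFT]
    ring
  simp only [HasPairing, e]
  exact ⟨hu.1.const_mul _, by rw [integral_const_mul, hu.2]⟩

/-- A tempered distribution is determined by its STFT. -/
theorem eq_zero_of_distSTFT_eq_zero {u : 𝓢'(Rd d, ℂ)} (h : ∀ z, distSTFT u z = 0)
    (k : 𝓢(Rd d, ℂ)) : u k = 0 := by
  rw [← (tempered_inversion u k).2]
  have e : ∀ w : Phase d, u (gaussianShift w) = 0 := fun w => by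
    have := h (w.1, -w.2)
    simpa only [distSTFT, neg_neg] using this
  simp [e]

/-- For the window `φ₀ ⊗ e₀` the operator STFT is `f ↦ V_{φ₀}(T f)(z) e₀`. -/
theorem hasOpSTFTAt_gaussianWindow_iff {e₀ : L2 d} {T : SchwartzOpDual d} {z : Phase d}
    {A : HS d} : HasOpSTFTAt (gaussianWindow e₀) T z A ↔
      ∀ f : 𝓢(Rd d, ℂ), HSOp.toCLM A (f.toLp 2 volume) = distSTFT (T f) z • e₀ := by
  have h : ∀ (f : 𝓢(Rd d, ℂ)) (g : L2 d), HasPairing (T f)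
      (timeFreqShift z (HSOp.toCLM (gaussianWindow e₀) g))
        (inner ℂ g (distSTFT (T f) z • e₀)) := fun f g => by
    have := (hasPairing_gaussian (T f) z).smul (inner ℂ e₀ g)
    rw [gaussianWindow, HSOp.toCLM_rankOne, map_smul, inner_smul_right, mul_comm]
    rwa [inner_conj_symm] at this
  constructor
  · intro hA f
    exact ext_inner_left ℂ fun g => (hA f g).2.symm.trans (h f g).2
  · intro hA f g
    rw [hA f]
    exact h f g

theorem inner_twistedIntegrand_gaussianWindow (Ψ : Phase d → HS d) (R : HS d) (e₀ : L2 d)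
    (z w : Phase d) (g f : L2 d) :
    inner ℂ g (HSOp.toCLM (twistedIntegrand Ψ (opSTFT R (gaussianWindow e₀)) z w) f) =
      inner ℂ e₀ (HSOp.toCLM (Ψ w) f) *
        conj (gaussSTFT (timeFreqShift z (HSOp.toCLM R g)) w) := by
  rw [inner_twistedIntegrand, gaussianWindow, HSOp.toCLM_rankOne, map_smul, inner_smul_right,
    gaussSTFT, inner_conj_symm]

/-- The operator STFT for an arbitrary window is recovered from the one for the Gaussian window
by twisted convolution. -/
theorem hasOpSTFTAt_twistedConv {e₀ : L2 d} (he₀ : ‖e₀‖ = 1) {T : SchwartzOpDual d}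
    {Ψ : Phase d → HS d} (hΨ : ∀ᵐ w, HasOpSTFTAt (gaussianWindow e₀) T w (Ψ w)) {R : HS d}
    {z : Phase d} (hint : Integrable (twistedIntegrand Ψ (opSTFT R (gaussianWindow e₀)) z)) :
    HasOpSTFTAt R T z (twistedConv Ψ (opSTFT R (gaussianWindow e₀)) z) := by
  intro f g
  have e : (fun w => inner ℂ g (HSOp.toCLM
      (twistedIntegrand Ψ (opSTFT R (gaussianWindow e₀)) z w) (f.toLp 2 volume))) =ᵐ[volume]
      fun w => distSTFT (T f) w * conj (gaussSTFT (timeFreqShift z (HSOp.toCLM R g)) w) := by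
    filter_upwards [hΨ] with w hw
    rw [inner_twistedIntegrand_gaussianWindow, hasOpSTFTAt_gaussianWindow_iff.1 hw f,
      inner_smul_right, inner_self_eq_norm_sq_to_K, he₀]
    simp
  refine ⟨(integrable_inner_twistedIntegrand hint g _).congr e, ?_⟩
  rw [inner_twistedConv hint, integral_congr_ae e]

end Pairing

section WindowChange

variable {d : ℕ} {v m : Weight d} {p q : ℝ≥0∞}

theorem lintegral_decay_sub_mul_le (hp : 1 ≤ p) (hq : 1 ≤ q) {g : Phase d → ℝ≥0∞}
    (hg : AEMeasurable g) (z : Phase d) :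
    ∫⁻ w, ENNReal.ofReal ((1 + ‖z - w‖) ^ (-(2 * ((d : ℝ) + 1)))) * g w ≤
      mixedNorm p q g *
        (1 + ∫⁻ x : Rd d, ENNReal.ofReal ((1 + ‖x‖) ^ (-((d : ℝ) + 1)))) ^ 2 := by
  have hg' := hg.measurable_mk
  have e1 : ∫⁻ w, ENNReal.ofReal ((1 + ‖z - w‖) ^ (-(2 * ((d : ℝ) + 1)))) * g w =
      ∫⁻ w, ENNReal.ofReal ((1 + ‖z - w‖) ^ (-(2 * ((d : ℝ) + 1)))) * hg.mk g w := by
    refine lintegral_congr_ae ?_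
    filter_upwards [hg.ae_eq_mk] with w hw
    rw [hw]
  rw [e1, mixedNorm_congr_ae hg.ae_eq_mk, ← mixedNorm_comp_sub hg' (-z),
    ← lintegral_add_right_eq_self _ z]
  refine le_trans (le_of_eq (lintegral_congr fun w => ?_)) (lintegral_mul_decay_le hp hq
    (hg'.comp (measurable_id.sub_const (-z))).aemeasurable)
  simp only [sub_neg_eq_add]
  rw [sub_add_cancel_right, norm_neg, mul_comm]

/-- The convolution with the rapidly decaying kernel `𝔙_{S₀} S₀` maps `L^{p,q}_m` into `L^∞_m`. -/
theorem exists_weight_mul_convolution_le (hm : m.IsModerate v) (hvp : v.HasPolynomialGrowth)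
    (hp : 1 ≤ p) (hq : 1 ≤ q) (e₀ : L2 d) {Ψ : Phase d → HS d} (hΨ : MemLpqm p q m Ψ) :
    ∃ K : ℝ≥0∞, K < ∞ ∧ ∀ z, ENNReal.ofReal (m z) *
      ∫⁻ w, ‖opSTFT (gaussianWindow e₀) (gaussianWindow e₀) (z - w)‖ₑ * ‖Ψ w‖ₑ ≤ K := by
  obtain ⟨C, -, h⟩ := exists_weight_mul_opSTFT_rankOne_le hvp e₀ e₀ (gaussian d)
  have hg := aemeasurable_weighted m hΨ.1
  have hdec := (lintegral_decay_lt_top d).ne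
  refine ⟨ENNReal.ofReal C * (weightedNorm p q m Ψ *
    (1 + ∫⁻ x : Rd d, ENNReal.ofReal ((1 + ‖x‖) ^ (-((d : ℝ) + 1)))) ^ 2), ?_, fun z => ?_⟩
  · have := hΨ.2.ne
    finiteness
  · refine (weight_mul_convolution_le hm
      (fun z => ‖opSTFT (gaussianWindow e₀) (gaussianWindow e₀) z‖ₑ) (fun w => ‖Ψ w‖ₑ) z).trans ?_
    calc _ ≤ ∫⁻ w, ENNReal.ofReal C * (ENNReal.ofReal ((1 + ‖z - w‖) ^ (-(2 * ((d : ℝ) + 1)))) *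
          (ENNReal.ofReal (m w) * ‖Ψ w‖ₑ)) := by
          refine lintegral_mono fun w => ?_
          rw [← mul_assoc (ENNReal.ofReal C)]
          exact mul_le_mul_left (h (z - w)) _
      _ ≤ _ := by
          rw [lintegral_const_mul' _ _ ENNReal.ofReal_ne_top]
          gcongr
          exact lintegral_decay_sub_mul_le hp hq hg z

/-- The window change for elements of a coorbit space, valid at every point of phase space. The
function `𝔙_{S₀} T` lies in `L^∞_m`, so that its convolution with `𝔙_R S₀ ∈ L¹_v` converges
everywhere. -/
theorem opSTFTDual_of_mem_coorbit [Fact (1 ≤ p)] [Fact (1 ≤ q)] (hm : m.IsModerate v)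
    (hvp : v.HasPolynomialGrowth) {e₀ : L2 d} (he₀ : ‖e₀‖ = 1) {T : SchwartzOpDual d}
    (hT : T ∈ coorbit p q m e₀) {R : HS d} (hR : kernelNorm v R (gaussianWindow e₀) < ∞)
    (z : Phase d) :
    HasOpSTFTAt R T z
      (twistedConv (opSTFTDual (gaussianWindow e₀) T) (opSTFT R (gaussianWindow e₀)) z) := by
  set S₀ := gaussianWindow e₀ with hS₀
  set Ψ := opSTFTDual S₀ T with hΨ
  have hp : 1 ≤ p := Fact.out
  have hq : 1 ≤ q := Fact.out
  have hmem : MemLpqm p q m Ψ := hT.2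
  have hae : ∀ᵐ w, HasOpSTFTAt S₀ T w (Ψ w) := by
    filter_upwards [hT.1] with w ⟨A, hA⟩
    rw [hΨ, hA.eq]
    exact hA
  obtain ⟨K, hK, hb⟩ := exists_weight_mul_convolution_le hm hvp hp hq e₀ hmem
  have hm0 : ∀ z, ENNReal.ofReal (m z) ≠ 0 := fun z => (ENNReal.ofReal_pos.2 (m.pos z)).ne'
  have key : ∀ {a b : ℝ≥0∞}, a ≠ 0 → b < ∞ → ∀ {c : ℝ≥0∞}, a * c ≤ b → c < ∞ :=
    fun ha hb c hc => lt_of_le_of_ne le_top fun h0 => by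
      rw [h0, ENNReal.mul_top ha] at hc
      exact (hc.trans_lt hb).ne rfl
  -- The case `R = S₀`: at every point `Ψ` equals its twisted convolution with `𝔙_{S₀} S₀`, so that
  -- `m Ψ` is bounded everywhere.
  have hB : ∀ w, Ψ w = twistedConv Ψ (opSTFT S₀ S₀) w := fun w =>
    (hasOpSTFTAt_twistedConv he₀ hae (integrable_twistedIntegrand hmem.1
      (continuous_opSTFT S₀ S₀) (key (hm0 w) hK (hb w)))).eq
  have hbound : ∀ w, ENNReal.ofReal (m w) * ‖Ψ w‖ₑ ≤ K := fun w => by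
    rw [hB w]
    refine le_trans ?_ (hb w)
    gcongr
    exact enorm_twistedConv_le Ψ (opSTFT S₀ S₀) w
  refine hasOpSTFTAt_twistedConv he₀ hae (integrable_twistedIntegrand hmem.1
    (continuous_opSTFT R S₀) (key (hm0 z) (ENNReal.mul_lt_top hR hK) ?_))
  refine (weight_mul_convolution_le hm (fun z => ‖opSTFT R S₀ z‖ₑ) (fun w => ‖Ψ w‖ₑ) z).trans ?_
  calc _ ≤ ∫⁻ w, (ENNReal.ofReal (v (z - w)) * ‖opSTFT R S₀ (z - w)‖ₑ) * K := by
        refine lintegral_mono fun w => ?_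
        exact mul_le_mul_right (hbound w) _
    _ = kernelNorm v R S₀ * K := by
        rw [lintegral_mul_const' _ _ hK.ne, kernelNorm,
          lintegral_sub_left_eq_self (fun w => ENNReal.ofReal (v w) * ‖opSTFT R S₀ w‖ₑ) z]

end WindowChange

/-! ### Synthesis of operators from functions on phase space -/

section Synthesis

variable {d : ℕ} {v m : Weight d} {p q : ℝ≥0∞}

/-- Elements of `L^{p,q}_m` are integrable against a negative power of `1 + |w|`, because a
`v`-moderate weight cannot decay faster than a power of it. -/
theorem exists_integrable_pow_inv_mul_norm (hm : m.IsModerate v) (hvp : v.HasPolynomialGrowth)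
    (hp : 1 ≤ p) (hq : 1 ≤ q) {A : Phase d → HS d} (hA : MemLpqm p q m A) :
    ∃ N : ℕ, Integrable fun w => ((1 + ‖w‖) ^ N)⁻¹ * ‖A w‖ := by
  obtain ⟨C, N, hC⟩ := hvp
  refine ⟨N + 2 * (d + 1), ?_⟩
  have hmeas : AEStronglyMeasurable
      (fun w : Phase d => ((1 + ‖w‖) ^ (N + 2 * (d + 1)))⁻¹ * ‖A w‖) :=
    (Continuous.inv₀ (by fun_prop) fun w => by positivity).aestronglyMeasurable.mul hA.1.norm
  refine ⟨hmeas, ?_⟩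
  have hC0 : 0 ≤ C := by
    have := (v.pos 0).le.trans (hC 0)
    simpa using this
  -- Moderateness with `0 = -w + w` bounds the weight from below.
  have hm0 : ∀ w, m 0 ≤ C * (1 + ‖w‖) ^ N * m w := fun w => by
    have h1 := hm (-w) w
    rw [neg_add_cancel] at h1
    refine h1.trans (mul_le_mul_of_nonneg_right ?_ (m.pos w).le)
    simpa only [norm_neg] using hC (-w)
  have hreal : ∀ w, ((1 + ‖w‖) ^ (N + 2 * (d + 1)))⁻¹ ≤
      C / m 0 * (m w * (1 + ‖w‖) ^ (-(2 * ((d : ℝ) + 1)))) := fun w => by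
    rw [Real.rpow_neg (by positivity), show 2 * ((d : ℝ) + 1) = ((2 * (d + 1) : ℕ) : ℝ) by
      push_cast; rfl, Real.rpow_natCast, pow_add, mul_inv, ← mul_assoc]
    refine mul_le_mul_of_nonneg_right ?_ (by positivity)
    have := m.pos 0
    rw [inv_eq_one_div, div_le_iff₀ (by positivity), div_mul_eq_mul_div, div_mul_eq_mul_div,
      le_div_iff₀ this, one_mul]
    linarith [hm0 w]
  have hdec := (lintegral_decay_lt_top d).ne
  rw [hasFiniteIntegral_iff_enorm]
  refine lt_of_le_of_lt (b := ENNReal.ofReal (C / m 0) * ∫⁻ w, (ENNReal.ofReal (m w) * ‖A w‖ₑ) *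
    ENNReal.ofReal ((1 + ‖w‖) ^ (-(2 * ((d : ℝ) + 1))))) ?_ ?_
  · rw [← lintegral_const_mul' _ _ ENNReal.ofReal_ne_top]
    refine lintegral_mono fun w => ?_
    rw [enorm_mul, enorm_norm, Real.enorm_of_nonneg (by positivity)]
    have h1 := ENNReal.ofReal_le_ofReal (hreal w)
    have := m.pos 0
    rw [ENNReal.ofReal_mul (by positivity), ENNReal.ofReal_mul (m.pos w).le] at h1
    refine (mul_le_mul_left h1 _).trans_eq ?_
    ring
  · refine ENNReal.mul_lt_top ENNReal.ofReal_lt_top ((lintegral_mul_decay_le hp hq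
      (aemeasurable_weighted m hA.1)).trans_lt ?_)
    have := hA.2.ne
    rw [weightedNorm] at this
    finiteness

/-- The integrand of the bilinear form `(h, k) ↦ ∫ ⟨A(w) h, e₀⟩ ⟨k, conj (π(w) φ₀)⟩ dw`, by which a
function `A` on phase space defines an operator from the Schwartz space to its dual. Since
it has to be linear in `k`, evaluation at `conj (π(w) φ₀)` is written as the STFT of `k` at the
point with the opposite frequency. -/
def synthesisIntegrand (e₀ : L2 d) (A : Phase d → HS d) (h : L2 d) (k : 𝓢(Rd d, ℂ))
    (w : Phase d) : ℂ :=
  inner ℂ e₀ (HSOp.toCLM (A w) h) * gaussSTFT (k.toLp 2 volume) (w.1, -w.2)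

variable {A : Phase d → HS d}

theorem aestronglyMeasurable_synthesisIntegrand (e₀ : L2 d) (hA : AEStronglyMeasurable A)
    (h : L2 d) (k : 𝓢(Rd d, ℂ)) : AEStronglyMeasurable (synthesisIntegrand e₀ A h k) := by
  have h1 : AEStronglyMeasurable fun w => (inner ℂ e₀ (HSOp.toCLM (A w) h) : ℂ) := by
    have := (matrixCoeff e₀ h).continuous.comp_aestronglyMeasurable hA
    refine this.congr (Filter.Eventually.of_forall fun w => ?_)
    exact matrixCoeff_apply _ _ _
  refine h1.mul (Continuous.aestronglyMeasurable ?_)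
  exact (continuous_gaussSTFT _).comp (by fun_prop)

theorem exists_norm_synthesisIntegrand_le (e₀ : L2 d) (A : Phase d → HS d) (N : ℕ) :
    ∃ (C : ℝ) (n : ℕ × ℕ), 0 ≤ C ∧ ∀ h k w, ‖synthesisIntegrand e₀ A h k w‖ ≤
      (C * ‖h‖ * schwartzNorm d n k) * (((1 + ‖w‖) ^ N)⁻¹ * ‖A w‖) := by
  obtain ⟨C, n, hC, hdec⟩ := exists_gaussSTFT_decay d N
  refine ⟨‖e₀‖ * C, n, by positivity, fun h k w => ?_⟩
  have h1 : ‖gaussSTFT (k.toLp 2 volume) (w.1, -w.2)‖ ≤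
      C * schwartzNorm d n k * ((1 + ‖w‖) ^ N)⁻¹ := by
    rw [← div_eq_mul_inv, le_div_iff₀ (by positivity), mul_comm]
    have := hdec k (w.1, -w.2)
    rwa [show ‖((w.1, -w.2) : Phase d)‖ = ‖w‖ by simp [Prod.norm_def]] at this
  rw [synthesisIntegrand, norm_mul]
  calc _ ≤ (‖e₀‖ * (‖A w‖ * ‖h‖)) * (C * schwartzNorm d n k * ((1 + ‖w‖) ^ N)⁻¹) := by
        refine mul_le_mul ((norm_inner_le_norm _ _).trans ?_) h1 (norm_nonneg _) (by positivity)
        gcongr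
        exact HSOp.norm_apply_le _ _
    _ = _ := by ring

/-- The operator from the Schwartz space to its dual that is synthesised from a function on phase
space of at most polynomial growth, in the integrated sense. -/
theorem exists_schwartzOpDual (e₀ : L2 d) (hA : AEStronglyMeasurable A) {N : ℕ}
    (hN : Integrable fun w => ((1 + ‖w‖) ^ N)⁻¹ * ‖A w‖) :
    ∃ T : SchwartzOpDual d, ∀ f k, T f k =
      ∫ w, synthesisIntegrand e₀ A (f.toLp 2 volume) k w := by
  obtain ⟨C, n, hC, hb⟩ := exists_norm_synthesisIntegrand_le e₀ A N
  set J := ∫ w, ((1 + ‖w‖) ^ N)⁻¹ * ‖A w‖ with hJ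
  have hJ0 : 0 ≤ J := integral_nonneg fun w => by positivity
  have hint : ∀ h k, Integrable (synthesisIntegrand e₀ A h k) := fun h k =>
    (hN.const_mul (C * ‖h‖ * schwartzNorm d n k)).mono'
      (aestronglyMeasurable_synthesisIntegrand e₀ hA h k) (Filter.Eventually.of_forall (hb h k))
  have hle : ∀ h k, ‖∫ w, synthesisIntegrand e₀ A h k w‖ ≤
      (C * ‖h‖ * schwartzNorm d n k) * J := fun h k => by
    rw [hJ, ← integral_const_mul]
    exact norm_integral_le_of_norm_le (hN.const_mul _) (Filter.Eventually.of_forall (hb h k))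
  have add_left : ∀ h h' k, ∫ w, synthesisIntegrand e₀ A (h + h') k w =
      (∫ w, synthesisIntegrand e₀ A h k w) + ∫ w, synthesisIntegrand e₀ A h' k w := fun h h' k => by
    rw [← integral_add (hint h k) (hint h' k)]
    refine integral_congr_ae (Filter.Eventually.of_forall fun w => ?_)
    simp only [synthesisIntegrand, map_add, inner_add_right, add_mul]
  have smul_left : ∀ (c : ℂ) h k, ∫ w, synthesisIntegrand e₀ A (c • h) k w =
      c * ∫ w, synthesisIntegrand e₀ A h k w := fun c h k => by
    rw [← integral_const_mul]
    refine integral_congr_ae (Filter.Eventually.of_forall fun w => ?_)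
    simp only [synthesisIntegrand, map_smul, inner_smul_right, mul_assoc]
  have toLp_add : ∀ k k' : 𝓢(Rd d, ℂ),
      (k + k').toLp 2 volume = k.toLp 2 volume + k'.toLp 2 volume := fun k k' =>
    map_add (SchwartzMap.toLpCLM ℂ (E := Rd d) ℂ 2 volume) k k'
  have toLp_smul : ∀ (c : ℂ) (k : 𝓢(Rd d, ℂ)), (c • k).toLp 2 volume = c • k.toLp 2 volume :=
    fun c k => map_smul (SchwartzMap.toLpCLM ℂ (E := Rd d) ℂ 2 volume) c k
  have add_right : ∀ h k k', ∫ w, synthesisIntegrand e₀ A h (k + k') w =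
      (∫ w, synthesisIntegrand e₀ A h k w) + ∫ w, synthesisIntegrand e₀ A h k' w := fun h k k' => by
    rw [← integral_add (hint h k) (hint h k')]
    refine integral_congr_ae (Filter.Eventually.of_forall fun w => ?_)
    simp only [synthesisIntegrand, gaussSTFT, toLp_add, inner_add_right, mul_add]
  have smul_right : ∀ (c : ℂ) h k, ∫ w, synthesisIntegrand e₀ A h (c • k) w =
      c * ∫ w, synthesisIntegrand e₀ A h k w := fun c h k => by
    rw [← integral_const_mul]
    refine integral_congr_ae (Filter.Eventually.of_forall fun w => ?_)
    simp only [synthesisIntegrand, gaussSTFT, toLp_smul, inner_smul_right]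
    ring
  -- `D` and `E` fix one of the two arguments of the form, in which it is then continuous.
  let D : L2 d → 𝓢(Rd d, ℂ) →L[ℂ] ℂ := fun h =>
    SchwartzMap.mkCLMtoNormedSpace (𝕜 := ℂ) (σ := RingHom.id ℂ)
      (fun k => ∫ w, synthesisIntegrand e₀ A h k w) (add_right h) (fun c k => smul_right c h k)
      ⟨Finset.Iic n, C * ‖h‖ * J, by positivity, fun k => (hle h k).trans_eq (by
        change _ = C * ‖h‖ * J * schwartzNorm d n k
        ring)⟩
  let E : 𝓢(Rd d, ℂ) → L2 d →L[ℂ] ℂ := fun k =>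
    LinearMap.mkContinuous
      { toFun := fun h => ∫ w, synthesisIntegrand e₀ A h k w
        map_add' := fun h h' => add_left h h' k
        map_smul' := fun c h => smul_left c h k } (C * schwartzNorm d n k * J)
      fun h => (hle h k).trans_eq (by ring)
  refine ⟨{ toFun := fun f => ContinuousLinearMap.toPointwiseConvergenceCLM _ _ _ _
              (D (f.toLp 2 volume))
            map_add' := fun f f' => ?_
            map_smul' := fun c f => ?_
            cont := PointwiseConvergenceCLM.continuous_of_continuous_eval fun k => ?_ },
    fun f k => rfl⟩
  · ext k
    change ∫ w, synthesisIntegrand e₀ A ((f + f').toLp 2 volume) k w = _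
    rw [toLp_add, add_left]
    rfl
  · ext k
    change ∫ w, synthesisIntegrand e₀ A ((c • f).toLp 2 volume) k w = _
    rw [toLp_smul, smul_left]
    rfl
  · exact (E k).continuous.comp (SchwartzMap.toLpCLM ℂ (E := Rd d) ℂ 2 volume).continuous

/-- The operator STFT, for the Gaussian window, of the operator synthesised from `A` is the twisted
convolution of `A` with the reproducing kernel, and need not be `A` itself. -/
theorem hasOpSTFTAt_synthesis {e₀ : L2 d} {T : SchwartzOpDual d}
    (hT : ∀ f k, T f k = ∫ w, synthesisIntegrand e₀ A (f.toLp 2 volume) k w) {z : Phase d}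
    (hint : Integrable (twistedIntegrand A (opSTFT (gaussianWindow e₀) (gaussianWindow e₀)) z)) :
    HasOpSTFTAt (gaussianWindow e₀) T z
      (twistedConv A (opSTFT (gaussianWindow e₀) (gaussianWindow e₀)) z) := by
  refine hasOpSTFTAt_gaussianWindow_iff.2 fun f => ext_inner_left ℂ fun g => ?_
  rw [inner_twistedConv hint, inner_smul_right, distSTFT, hT, ← integral_mul_const]
  refine integral_congr_ae (Filter.Eventually.of_forall fun w => ?_)
  dsimp only
  rw [inner_twistedIntegrand_gaussianWindow, synthesisIntegrand, gaussSTFT_gaussianShift,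
    inner_timeFreqShift_gaussian_neg_snd, gaussianWindow, HSOp.toCLM_rankOne, map_smul, gaussSTFT,
    inner_smul_right, map_mul, inner_conj_symm]
  ring

end Synthesis

/-! ### The correspondence between coorbit spaces and reproducing subspaces -/

theorem MemLpqm.congr {d : ℕ} {m : Weight d} {p q : ℝ≥0∞} {F G : Phase d → HS d}
    (hF : MemLpqm p q m F) (h : F =ᵐ[volume] G) : MemLpqm p q m G :=
  ⟨hF.1.congr h, by rw [← weightedNorm_congr_ae h]; exact hF.2⟩

section Correspondence

variable {d : ℕ} {v m : Weight d} {p q : ℝ≥0∞} [hp : Fact (1 ≤ p)] [hq : Fact (1 ≤ q)]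

/-- The class in `L^{p,q}_m` of a function. -/
def MemLpqm.toLpqm {F : Phase d → HS d} (hF : MemLpqm p q m F) : Lpqm p q m :=
  ⟨AEEqFun.mk F hF.1, by
    change weightedNorm p q m _ < ∞
    rw [weightedNorm_congr_ae (AEEqFun.coeFn_mk F hF.1)]
    exact hF.2⟩

theorem MemLpqm.coeFn_toLpqm {F : Phase d → HS d} (hF : MemLpqm p q m F) :
    (hF.toLpqm.1 : Phase d → HS d) =ᵐ[volume] F := AEEqFun.coeFn_mk F hF.1

theorem MemLpqm.norm_toLpqm {F : Phase d → HS d} (hF : MemLpqm p q m F) :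
    ‖hF.toLpqm‖ = (weightedNorm p q m F).toReal := by
  rw [Lpqm.norm_def, weightedNorm_congr_ae hF.coeFn_toLpqm]

theorem Lpqm.memLpqm (F : Lpqm p q m) : MemLpqm p q m F.1 := ⟨F.1.aestronglyMeasurable, F.2⟩

theorem Lpqm.ext_ae {F G : Lpqm p q m} (h : (F.1 : Phase d → HS d) =ᵐ[volume] G.1) : F = G :=
  Subtype.ext (AEEqFun.ext h)

theorem memLpqm_twistedConv_coe (hm : m.IsModerate v) {R Q : HS d} (hk : kernelNorm v R Q < ∞)
    (F : Lpqm p q m) : MemLpqm p q m (twistedConv F.1 (opSTFT R Q)) :=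
  memLpqm_twistedConv hm hp.out hq.out hk (Lpqm.memLpqm F)

theorem twistedConv_coe_add (hm : m.IsModerate v) {R Q : HS d} (hk : kernelNorm v R Q < ∞)
    (F G : Lpqm p q m) : twistedConv (F + G : Lpqm p q m).1 (opSTFT R Q) =ᵐ[volume]
      twistedConv F.1 (opSTFT R Q) + twistedConv G.1 (opSTFT R Q) := by
  have e : ((F + G : Lpqm p q m).1 : Phase d → HS d) =ᵐ[volume] F.1 + G.1 :=
    AEEqFun.coeFn_add F.1 G.1
  rw [twistedConv_congr e]
  filter_upwards [ae_integrable_twistedIntegrand hm hp.out hq.out hk (Lpqm.memLpqm F),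
    ae_integrable_twistedIntegrand hm hp.out hq.out hk (Lpqm.memLpqm G)] with z h1 h2
  rw [Pi.add_apply, twistedConv, twistedIntegrand_add, integral_add' h1 h2]
  rfl

theorem twistedConv_coe_smul (R Q : HS d) (c : ℂ) (F : Lpqm p q m) :
    twistedConv (c • F : Lpqm p q m).1 (opSTFT R Q) = c • twistedConv F.1 (opSTFT R Q) := by
  have e : ((c • F : Lpqm p q m).1 : Phase d → HS d) =ᵐ[volume] c • (F.1 : Phase d → HS d) :=
    AEEqFun.coeFn_smul c F.1
  rw [twistedConv_congr e]
  funext z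
  rw [Pi.smul_apply, twistedConv, twistedIntegrand_smul]
  exact integral_smul c _

/-- Twisted convolution with `𝔙_R Q ∈ L¹_v` as a bounded operator on `L^{p,q}_m`. -/
def twistedConvL (p q : ℝ≥0∞) [hp : Fact (1 ≤ p)] [hq : Fact (1 ≤ q)] (hm : m.IsModerate v)
    {R Q : HS d} (hk : kernelNorm v R Q < ∞) : Lpqm p q m →L[ℂ] Lpqm p q m :=
  LinearMap.mkContinuous
    { toFun := fun F => (memLpqm_twistedConv_coe hm hk F).toLpqm
      map_add' := fun F G => Lpqm.ext_ae <| by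
        refine (MemLpqm.coeFn_toLpqm _).trans ((twistedConv_coe_add hm hk F G).trans ?_)
        refine Filter.EventuallyEq.trans ?_ (AEEqFun.coeFn_add _ _).symm
        exact ((MemLpqm.coeFn_toLpqm _).add (MemLpqm.coeFn_toLpqm _)).symm
      map_smul' := fun c F => Lpqm.ext_ae <| by
        refine (MemLpqm.coeFn_toLpqm _).trans ?_
        rw [twistedConv_coe_smul]
        refine Filter.EventuallyEq.trans ?_ (AEEqFun.coeFn_smul c _).symm
        exact ((MemLpqm.coeFn_toLpqm _).const_smul c).symm }
    (kernelNorm v R Q).toReal fun F => by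
      have h := weightedNorm_twistedConv_le hm hp.out hq.out R Q (Lpqm.memLpqm F).1
      refine (MemLpqm.norm_toLpqm (memLpqm_twistedConv_coe hm hk F)).trans_le ?_
      rw [Lpqm.norm_def, ← ENNReal.toReal_mul]
      exact ENNReal.toReal_mono (ENNReal.mul_lt_top hk F.2).ne h

theorem coeFn_twistedConvL (hm : m.IsModerate v) {R Q : HS d} (hk : kernelNorm v R Q < ∞)
    (F : Lpqm p q m) :
    ((twistedConvL p q hm hk F).1 : Phase d → HS d) =ᵐ[volume] twistedConv F.1 (opSTFT R Q) :=
  MemLpqm.coeFn_toLpqm (memLpqm_twistedConv_coe hm hk F)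

theorem mem_reproducingSpace_iff (hm : m.IsModerate v) {S : HS d} (hk : kernelNorm v S S < ∞)
    (F : Lpqm p q m) : F ∈ reproducingSpace S p q m ↔
      (F.1 : Phase d → HS d) =ᵐ[volume] twistedConv F.1 (opSTFT S S) := by
  constructor
  · intro h
    exact Filter.Eventually.mono h fun z hz => hz.2
  · intro h
    change ∀ᵐ z, _
    filter_upwards [h, ae_integrable_twistedIntegrand hm hp.out hq.out hk (Lpqm.memLpqm F)]
      with z h1 h2
    exact ⟨h2, h1⟩

/-- The reproducing space is the set of fixed points of a bounded operator. -/
theorem isClosed_reproducingSpace (hm : m.IsModerate v) {S : HS d} (hk : kernelNorm v S S < ∞) :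
    IsClosed (reproducingSpace S p q m : Set (Lpqm p q m)) := by
  have h : (reproducingSpace S p q m : Set (Lpqm p q m)) =
      {F | F = twistedConvL p q hm hk F} := by
    ext F
    rw [SetLike.mem_coe, mem_reproducingSpace_iff hm hk, Set.mem_ofPred_eq]
    constructor
    · intro h
      exact Lpqm.ext_ae (h.trans (coeFn_twistedConvL hm hk F).symm)
    · intro h
      exact (Filter.EventuallyEq.of_eq (congrArg (fun G : Lpqm p q m => (G.1 : Phase d → HS d))
        h)).trans (coeFn_twistedConvL hm hk F)
  rw [h]
  exact isClosed_eq continuous_id (twistedConvL p q hm hk).continuous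

variable {e₀ : L2 d} {S : HS d} {T : SchwartzOpDual d}

theorem opSTFTDual_eq_twistedConv (hm : m.IsModerate v) (hvp : v.HasPolynomialGrowth)
    (he₀ : ‖e₀‖ = 1) (hT : T ∈ coorbit p q m e₀) {R : HS d}
    (hR : kernelNorm v R (gaussianWindow e₀) < ∞) :
    opSTFTDual R T =
      twistedConv (opSTFTDual (gaussianWindow e₀) T) (opSTFT R (gaussianWindow e₀)) :=
  funext fun z => (opSTFTDual_of_mem_coorbit hm hvp he₀ hT hR z).eq

theorem memLpqm_opSTFTDual (hm : m.IsModerate v) (hvp : v.HasPolynomialGrowth)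
    (he₀ : ‖e₀‖ = 1) (hT : T ∈ coorbit p q m e₀) {R : HS d}
    (hR : kernelNorm v R (gaussianWindow e₀) < ∞) : MemLpqm p q m (opSTFTDual R T) := by
  rw [opSTFTDual_eq_twistedConv hm hvp he₀ hT hR]
  exact memLpqm_twistedConv hm hp.out hq.out hR hT.2

theorem traceInner_self_eq_one (hS : ‖S‖ = 1) : HSOp.traceInner S S = 1 := by
  rw [HSOp.traceInner_self, hS]
  simp

/-- The general reproducing formula `𝔙_S T ♮ 𝔙_R S = 𝔙_R T` for windows `S` of norm one. -/
theorem twistedConv_opSTFTDual (hm : m.IsModerate v) (hvp : v.HasPolynomialGrowth)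
    (he₀ : ‖e₀‖ = 1) (hT : T ∈ coorbit p q m e₀)
    (hS1 : ‖S‖ = 1) (hS : kernelNorm v S (gaussianWindow e₀) < ∞) {R : HS d}
    (hRS : kernelNorm v R S < ∞) (hR : kernelNorm v R (gaussianWindow e₀) < ∞) :
    twistedConv (opSTFTDual S T) (opSTFT R S) =ᵐ[volume] opSTFTDual R T := by
  rw [opSTFTDual_eq_twistedConv hm hvp he₀ hT hS, opSTFTDual_eq_twistedConv hm hvp he₀ hT hR]
  refine (twistedConv_twistedConv hm hp.out hq.out hS hRS hT.2).trans ?_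
  rw [traceInner_self_eq_one hS1, one_smul]

/-- The operator STFT for the window `S` as a linear map into the reproducing space. -/
theorem exists_analysisMap (hm : m.IsModerate v) (hvp : v.HasPolynomialGrowth)
    (he₀ : ‖e₀‖ = 1) (hS1 : ‖S‖ = 1) (hSS : kernelNorm v S S < ∞)
    (hS : kernelNorm v S (gaussianWindow e₀) < ∞) :
    ∃ Φ : coorbit p q m e₀ →ₗ[ℂ] reproducingSpace S p q m, ∀ T : coorbit p q m e₀,
      ((Φ T).1.1 : Phase d → HS d) =ᵐ[volume] opSTFTDual S T.1 := by
  have hmem : ∀ T : coorbit p q m e₀, MemLpqm p q m (opSTFTDual S T.1) := fun T =>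
    memLpqm_opSTFTDual hm hvp he₀ T.2 hS
  have hat : ∀ (T : coorbit p q m e₀) z, HasOpSTFTAt S T.1 z (opSTFTDual S T.1 z) := fun T z => by
    have h := opSTFTDual_of_mem_coorbit hm hvp he₀ T.2 hS z
    rwa [← h.eq] at h
  refine ⟨{ toFun := fun T => ⟨(hmem T).toLpqm, (mem_reproducingSpace_iff hm hSS _).2 ?_⟩
            map_add' := fun T T' => Subtype.ext (Lpqm.ext_ae ?_)
            map_smul' := fun c T => Subtype.ext (Lpqm.ext_ae ?_) },
    fun T => (hmem T).coeFn_toLpqm⟩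
  · rw [twistedConv_congr (hmem T).coeFn_toLpqm]
    exact (hmem T).coeFn_toLpqm.trans (twistedConv_opSTFTDual hm hvp he₀ T.2 hS1 hS hSS hS).symm
  · refine (hmem (T + T')).coeFn_toLpqm.trans ?_
    refine Filter.EventuallyEq.trans ?_ (AEEqFun.coeFn_add _ _).symm
    filter_upwards [(hmem T).coeFn_toLpqm, (hmem T').coeFn_toLpqm] with z h1 h2
    rw [Pi.add_apply, h1, h2]
    exact ((hat T z).add (hat T' z)).eq
  · refine (hmem (c • T)).coeFn_toLpqm.trans ?_
    refine Filter.EventuallyEq.trans ?_ (AEEqFun.coeFn_smul c _).symm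
    filter_upwards [(hmem T).coeFn_toLpqm] with z h1
    rw [Pi.smul_apply, h1]
    exact ((hat T z).smul c).eq

/-- The operator STFT determines the operator: `𝔙_S T = 0` forces `𝔙_{S₀} T = 0` almost everywhere,
then everywhere, and the inversion formula applies. -/
theorem eq_zero_of_opSTFTDual_ae_eq_zero (hm : m.IsModerate v) (hvp : v.HasPolynomialGrowth)
    (he₀ : ‖e₀‖ = 1) (hT : T ∈ coorbit p q m e₀) (hS1 : ‖S‖ = 1)
    (hS : kernelNorm v S (gaussianWindow e₀) < ∞) (hS' : kernelNorm v (gaussianWindow e₀) S < ∞)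
    (h0 : opSTFTDual S T =ᵐ[volume] 0) : T = 0 := by
  have hk := kernelNorm_gaussianWindow_self_lt_top hvp e₀
  have hzero : ∀ R Q : HS d, twistedConv (0 : Phase d → HS d) (opSTFT R Q) = 0 := fun R Q => by
    funext z
    rw [twistedConv, twistedIntegrand_zero]
    simp
  have h1 : opSTFTDual (gaussianWindow e₀) T =ᵐ[volume] 0 := by
    refine (twistedConv_opSTFTDual hm hvp he₀ hT hS1 hS hS' hk).symm.trans ?_
    rw [twistedConv_congr h0, hzero]
  have h2 : ∀ z, HasOpSTFTAt (gaussianWindow e₀) T z 0 := fun z => by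
    have h := opSTFTDual_of_mem_coorbit hm hvp he₀ hT hk z
    rwa [twistedConv_congr h1, hzero] at h
  have he : e₀ ≠ 0 := by
    rintro rfl
    simp at he₀
  ext f k
  refine eq_zero_of_distSTFT_eq_zero (fun z => ?_) k
  have h := hasOpSTFTAt_gaussianWindow_iff.1 (h2 z) f
  rw [map_zero, zero_apply] at h
  exact (smul_eq_zero.1 h.symm).resolve_right he

/-- Every element of the reproducing space is an operator STFT: it is that of the operator
synthesised from `Ψ ♮ 𝔙_{S₀} S`. -/
theorem exists_opSTFTDual_ae_eq (hm : m.IsModerate v) (hvp : v.HasPolynomialGrowth)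
    (he₀ : ‖e₀‖ = 1) (hSS : kernelNorm v S S < ∞)
    (hS : kernelNorm v S (gaussianWindow e₀) < ∞) (hS' : kernelNorm v (gaussianWindow e₀) S < ∞)
    {Ψ : Lpqm p q m} (hΨ : Ψ ∈ reproducingSpace S p q m) :
    ∃ T ∈ coorbit p q m e₀, opSTFTDual S T =ᵐ[volume] Ψ.1 := by
  have hk := kernelNorm_gaussianWindow_self_lt_top hvp e₀
  set S₀ := gaussianWindow e₀ with hS₀
  have htr : HSOp.traceInner S₀ S₀ = 1 := traceInner_self_eq_one (norm_gaussianWindow he₀)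
  set A := twistedConv Ψ.1 (opSTFT S₀ S) with hA
  have hAm : MemLpqm p q m A := memLpqm_twistedConv hm hp.out hq.out hS' (Lpqm.memLpqm Ψ)
  -- `A` satisfies the reproducing formula of `S₀`, so it is the STFT of what is
  -- synthesised from it.
  have hAA : twistedConv A (opSTFT S₀ S₀) =ᵐ[volume] A := by
    have h := twistedConv_twistedConv hm hp.out hq.out hS' hk (Lpqm.memLpqm Ψ)
    rwa [htr, one_smul] at h
  obtain ⟨N, hN⟩ := exists_integrable_pow_inv_mul_norm hm hvp hp.out hq.out hAm
  obtain ⟨T, hT⟩ := exists_schwartzOpDual e₀ hAm.1 hN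
  have hat : ∀ᵐ z, HasOpSTFTAt S₀ T z (twistedConv A (opSTFT S₀ S₀) z) :=
    (ae_integrable_twistedIntegrand hm hp.out hq.out hk hAm).mono fun z hz =>
      hasOpSTFTAt_synthesis hT hz
  have hTA : opSTFTDual S₀ T =ᵐ[volume] A :=
    Filter.EventuallyEq.trans (hat.mono fun z hz => hz.eq) hAA
  have hTmem : T ∈ coorbit p q m e₀ := ⟨hat.mono fun z hz => ⟨_, hz⟩, hAm.congr hTA.symm⟩
  refine ⟨T, hTmem, ?_⟩
  rw [opSTFTDual_eq_twistedConv hm hvp he₀ hTmem hS, twistedConv_congr hTA]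
  have h := twistedConv_twistedConv hm hp.out hq.out hS' hS (Lpqm.memLpqm Ψ)
  rw [htr, one_smul] at h
  exact h.trans ((mem_reproducingSpace_iff hm hSS Ψ).1 hΨ).symm

/-- On a coorbit space the norm induced by a window `R` is dominated by the one induced by a window
`S` of norm one, with the `L¹_v` norm of `𝔙_R S` as constant. -/
theorem coorbitNorm_le (hm : m.IsModerate v) (hvp : v.HasPolynomialGrowth)
    (he₀ : ‖e₀‖ = 1) (hT : T ∈ coorbit p q m e₀) (hS1 : ‖S‖ = 1)
    (hS : kernelNorm v S (gaussianWindow e₀) < ∞) {R : HS d}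
    (hRS : kernelNorm v R S < ∞) (hR : kernelNorm v R (gaussianWindow e₀) < ∞) :
    coorbitNorm R p q m T ≤ (kernelNorm v R S).toReal * coorbitNorm S p q m T := by
  have hmem := memLpqm_opSTFTDual hm hvp he₀ hT hS
  rw [coorbitNorm, coorbitNorm, ← ENNReal.toReal_mul]
  refine ENNReal.toReal_mono (ENNReal.mul_lt_top hRS hmem.2).ne ?_
  rw [← weightedNorm_congr_ae (twistedConv_opSTFTDual hm hvp he₀ hT hS1 hS hRS hR)]
  exact weightedNorm_twistedConv_le hm hp.out hq.out R S hmem.1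

end Correspondence

end

theorem mainTheorem3 (d : ℕ) (v m : Weight d) (hv : v.IsSubmultiplicative)
    (hvp : v.HasPolynomialGrowth) (hm : m.IsModerate v)
    (p q : ℝ≥0∞) [Fact (1 ≤ p)] [Fact (1 ≤ q)]
    (e₀ : L2 d) (he₀ : ‖e₀‖ = 1)
    (S : HS d) (hS : S ∈ admissible v) (hS1 : ‖S‖ = 1) :
    -- `𝔙_S T (z)` is defined for every `T ∈ 𝔐^{p,q}_m` and every `z`
    (∀ T ∈ coorbit p q m e₀, ∀ z, ∃ A, HasOpSTFTAt S T z A) ∧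
    -- `Ψ ♮ 𝔙_S S` is defined for every `Ψ ∈ L^{p,q}_m`
    (∀ Ψ : Lpqm p q m, ∀ᵐ z, Integrable (twistedIntegrand Ψ.1 (opSTFT S S) z)) ∧
    -- the subspace of all `Ψ` with `Ψ = Ψ ♮ 𝔙_S S` is closed
    IsClosed (reproducingSpace S p q m : Set (Lpqm p q m)) ∧
    -- `T ↦ 𝔙_S T` is a linear bijection onto it, isometric for the norm that `S` induces
    (∃ Φ : coorbit p q m e₀ ≃ₗ[ℂ] reproducingSpace S p q m,
      ∀ T : coorbit p q m e₀,
        ((Φ T).1.1 : Phase d → HS d) =ᵐ[volume] opSTFTDual S T.1 ∧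
        ‖Φ T‖ = coorbitNorm S p q m T.1) ∧
    -- this norm is equivalent to the norm of `𝔐^{p,q}_m` given by `S₀ = φ₀ ⊗ e₀`
    (∃ c C : ℝ, 0 < c ∧ 0 < C ∧ ∀ T ∈ coorbit p q m e₀,
      c * coorbitNorm (gaussianWindow e₀) p q m T ≤ coorbitNorm S p q m T ∧
      coorbitNorm S p q m T ≤ C * coorbitNorm (gaussianWindow e₀) p q m T) ∧
    -- `𝔐^{p,q}_m` consists of those `T` in the coorbit spaces with `𝔙_S T ∈ L^{p,q}_m`
    (∀ (m' : Weight d) (p' q' : ℝ≥0∞) [Fact (1 ≤ p')] [Fact (1 ≤ q')], m'.IsModerate v →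
      ∀ T ∈ coorbit p' q' m' e₀, T ∈ coorbit p q m e₀ ↔ T ∈ coorbitWith S p q m) := by
  have hp : 1 ≤ p := Fact.out
  have hq : 1 ≤ q := Fact.out
  set S₀ := gaussianWindow e₀ with hS₀
  have hSS := kernelNorm_lt_top_of_admissible hS
  have h00 : kernelNorm v S₀ S₀ < ∞ := kernelNorm_gaussianWindow_self_lt_top hvp e₀
  have h0S : kernelNorm v S₀ S < ∞ := kernelNorm_gaussianWindow_lt_top hv hvp e₀ hSS
  have hS0 : kernelNorm v S S₀ < ∞ := kernelNorm_gaussianWindow_right_lt_top hv hvp e₀ hSS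
  have hn0 : ‖S₀‖ = 1 := norm_gaussianWindow he₀
  refine ⟨fun T hT z => ⟨_, opSTFTDual_of_mem_coorbit hm hvp he₀ hT hS0 z⟩,
    fun Ψ => ae_integrable_twistedIntegrand hm hp hq hSS (Lpqm.memLpqm Ψ),
    isClosed_reproducingSpace hm hSS, ?_, ?_, ?_⟩
  · obtain ⟨Φ, hΦ⟩ := exists_analysisMap (p := p) (q := q) hm hvp he₀ hS1 hSS hS0
    have hinj : Function.Injective Φ := by
      rw [← LinearMap.ker_eq_bot, LinearMap.ker_eq_bot']
      intro T hT
      refine Subtype.ext (eq_zero_of_opSTFTDual_ae_eq_zero hm hvp he₀ T.2 hS1 hS0 h0S ?_)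
      refine (hΦ T).symm.trans ?_
      rw [hT]
      exact AEEqFun.coeFn_zero
    have hsurj : Function.Surjective Φ := fun Ψ => by
      obtain ⟨T, hT, h⟩ := exists_opSTFTDual_ae_eq hm hvp he₀ hSS hS0 h0S Ψ.2
      exact ⟨⟨T, hT⟩, Subtype.ext (Lpqm.ext_ae ((hΦ ⟨T, hT⟩).trans h))⟩
    refine ⟨LinearEquiv.ofBijective Φ ⟨hinj, hsurj⟩, fun T => ⟨hΦ T, ?_⟩⟩
    change ‖(Φ T).1‖ = _
    rw [Lpqm.norm_def, weightedNorm_congr_ae (hΦ T), coorbitNorm]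
  -- The summands `1` only serve to make the constants visibly positive.
  · refine ⟨((kernelNorm v S₀ S).toReal + 1)⁻¹, (kernelNorm v S S₀).toReal + 1, by positivity,
      by positivity, fun T hT => ⟨?_, ?_⟩⟩
    · have h := coorbitNorm_le hm hvp he₀ hT hS1 hS0 h0S h00
      have h0 : 0 ≤ coorbitNorm S p q m T := ENNReal.toReal_nonneg
      rw [inv_mul_le_iff₀ (by positivity)]
      linarith
    · have h := coorbitNorm_le hm hvp he₀ hT hn0 h00 hS0 hS0
      have h0 : 0 ≤ coorbitNorm S₀ p q m T := ENNReal.toReal_nonneg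
      linarith
  · intro m' p' q' _ _ hm' T hT
    constructor
    · intro h
      exact ⟨Filter.Eventually.of_forall fun z =>
        ⟨_, opSTFTDual_of_mem_coorbit hm hvp he₀ h hS0 z⟩, memLpqm_opSTFTDual hm hvp he₀ h hS0⟩
    · intro h
      -- `𝔙_{S₀} T = 𝔙_S T ♮ 𝔙_{S₀} S` holds by membership in the second coorbit space, and the
      -- right side lies in `L^{p,q}_m`.
      exact ⟨hT.1, (memLpqm_twistedConv hm hp hq h0S h.2).congr
        (twistedConv_opSTFTDual hm' hvp he₀ hT hS1 hS0 h0S h00)⟩
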